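/- Let $k$ be an algebraically closed field of characteristic $p>3$. For $n\ge 1$ let $A(n)=k[X_1,\dots,X_n]/(X_1^p,\dots,X_n^p)$, let $x_i$ be the image of $X_i$, and let $W(n)=\mathrm{Der}_k(A(n))$, which acts on the differential forms $\Omega^r_{A(n)/k}$ by Lie derivative. Consider the Lie subalgebras $$\widehat S(n)=\{\partial\in W(n)\mid \partial(dx_1\wedge\dots\wedge dx_n)=0\},$$ $$\widehat H(2m)=\Big\{\partial\in W(2m)\ \Big|\ \partial\Big(\sum_{i=1}^m dx_i\wedge dx_{2m+1-i}\Big)=0\Big\},$$ $$\widehat K(2m+1)=\{\partial\in W(2m+1)\mid \partial(\omega_K)\in A(2m+1)\,\omega_K\},$$ where $\omega_K=\sum_{i=1}^m(x_i\,dx_{2m+1-i}-x_{2m+1-i}\,dx_i)+dx_{2m+1}$. Let $L$ be one of the restricted simple Lie algebras of Cartan type, that is, one of - the Witt–Jacobson algebra $W(n)$ with $n\ge 1$; - the special algebra $S(n)$, which is the derived algebra $\widehat S(n)^{(1)}$ if $n\ge 3$ and the second derived algebra $\widehat S(2)^{(2)}$ if $n=2$; - the Hamiltonian algebra $H(2m)=\widehat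 H(2m)^{(1)}$ with $m\ge 2$; - the contact algebra $K(2m+1)=\widehat K(2m+1)^{(1)}$ with $m\ge 1$. Let $G=\mathrm{Aut}(L)$ be the group of Lie algebra automorphisms of $L$, acting on the dual space $L^*$ by the coadjoint action $(g.\chi)(y)=\chi(g^{-1}(y))$, and let $k[L^*]$ be the algebra of polynomial functions on $L^*$. Then the only $G$-invariant polynomial functions on $L^*$ are the constants: $$k[L^*]^G=k .$$ -/

import Mathlib

open scoped BigOperators

noncomputable section

namespace CartanType

/-- The truncated polynomial ring `A(n) = k[X₁, …, Xₙ] / (X₁ᵖ, …, Xₙᵖ)`. -/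
abbrev TruncPoly (k : Type*) [Field k] (p n : ℕ) : Type _ :=
  MvPolynomial (Fin n) k ⧸
    Ideal.span (Set.range fun i : Fin n => (MvPolynomial.X i ^ p : MvPolynomial (Fin n) k))

/-- The Lie algebra `W(n)` of all `k`-derivations of `A(n)`, the bracket being the commutator.
It is also an `A(n)`-module. -/
abbrev W (k : Type*) [Field k] (p n : ℕ) : Type _ :=
  Derivation k (TruncPoly k p n) (TruncPoly k p n)

section Forms

variable {k A : Type*} [Field k] [CommRing A] [Algebra k A]

/-- The differential `da` of `a`, as an `A`-linear form on derivations: `da (X) = X a`. -/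
def differential (k : Type*) {A : Type*} [Field k] [CommRing A] [Algebra k A] (a : A) :
    Derivation k A A →ₗ[A] A where
  toFun X := X a
  map_add' _ _ := rfl
  map_smul' _ _ := rfl

/-- Differential `r`-forms: alternating `A`-multilinear forms on the `A`-module of derivations.
For the truncated polynomial rings the module of Kähler differentials is free of finite rank, and
these forms are its `r`-th exterior power. -/
abbrev Form (k A : Type*) [Field k] [CommRing A] [Algebra k A] (r : ℕ) : Type _ :=
  Derivation k A A [⋀^Fin r]→ₗ[A] A

/-- The wedge product of `r` one-forms:
`(α₁ ∧ … ∧ αᵣ) (X₁, …, Xᵣ) = det (αⱼ (Xᵢ))`. -/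
def wedge {r : ℕ} (α : Fin r → (Derivation k A A →ₗ[A] A)) : Form k A r :=
  (Matrix.detRowAlternating (n := Fin r) (R := A)).compLinearMap (LinearMap.pi α)

/-- The natural action (Lie derivative) of a derivation `D` on `r`-forms:
`(D ω) (X₁, …, Xᵣ) = D (ω (X₁, …, Xᵣ)) - ∑ᵢ ω (X₁, …, [D, Xᵢ], …, Xᵣ)`. -/
def lieDeriv {r : ℕ} (D : Derivation k A A) (ω : (Fin r → Derivation k A A) → A) :
    (Fin r → Derivation k A A) → A :=
  fun X => D (ω X) - ∑ i, ω (Function.update X i ⁅D, X i⁆)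

theorem lieDeriv_zero {r : ℕ} (ω : Form k A r) : lieDeriv 0 ω = 0 := by
  funext X
  simp [lieDeriv]

theorem lieDeriv_add {r : ℕ} (D E : Derivation k A A) (ω : Form k A r) :
    lieDeriv (D + E) ω = lieDeriv D ω + lieDeriv E ω := by
  funext X
  simp only [lieDeriv, add_lie, AlternatingMap.map_update_add, Finset.sum_add_distrib,
    Derivation.add_apply, Pi.add_apply]
  ring

theorem lieDeriv_smul {r : ℕ} (c : k) (D : Derivation k A A) (ω : Form k A r) :
    lieDeriv (c • D) ω = c • lieDeriv D ω := by
  funext X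
  have h : ∀ Y : Derivation k A A, ⁅c • D, Y⁆ = (algebraMap k A c) • ⁅D, Y⁆ := by
    intro Y
    rw [smul_lie, algebraMap_smul]
  have h2 : ∀ i, ω (Function.update X i ⁅c • D, X i⁆)
      = c • ω (Function.update X i ⁅D, X i⁆) := by
    intro i
    rw [h, AlternatingMap.map_update_smul, algebraMap_smul]
  simp only [lieDeriv, h2, Derivation.smul_apply, Pi.smul_apply, smul_sub, Finset.smul_sum]

theorem lieDeriv_fun_smul {r : ℕ} (D : Derivation k A A) (u : A)
    (ω : (Fin r → Derivation k A A) → A) :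
    lieDeriv D (u • ω) = D u • ω + u • lieDeriv D ω := by
  funext X
  simp only [lieDeriv, Pi.smul_apply, Pi.add_apply, smul_eq_mul, Derivation.leibniz,
    ← Finset.mul_sum]
  ring

theorem lieDeriv_lie {r : ℕ} (D E : Derivation k A A) (ω : Form k A r) :
    lieDeriv ⁅D, E⁆ ω = lieDeriv D (lieDeriv E ω) - lieDeriv E (lieDeriv D ω) := by
  funext X
  have key : ∀ D E : Derivation k A A,
      lieDeriv D (lieDeriv E ω) X = D (E (ω X))
        - ∑ i, D (ω (Function.update X i ⁅E, X i⁆))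
        - ∑ i, E (ω (Function.update X i ⁅D, X i⁆))
        + ∑ i, ∑ j, (if j = i then 0 else
            ω (Function.update (Function.update X i ⁅D, X i⁆) j ⁅E, X j⁆))
        + ∑ i, ω (Function.update X i ⁅E, ⁅D, X i⁆⁆) := by
    intro D E
    have h : ∀ i, ∑ j, ω (Function.update (Function.update X i ⁅D, X i⁆) j
          ⁅E, Function.update X i ⁅D, X i⁆ j⁆)
        = ∑ j, (if j = i then 0 else
            ω (Function.update (Function.update X i ⁅D, X i⁆) j ⁅E, X j⁆))
          + ω (Function.update X i ⁅E, ⁅D, X i⁆⁆) := by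
      intro i
      have h2 : ω (Function.update X i ⁅E, ⁅D, X i⁆⁆)
          = ∑ j, (if j = i then ω (Function.update X i ⁅E, ⁅D, X i⁆⁆) else 0) := by simp
      rw [h2, ← Finset.sum_add_distrib]
      refine Finset.sum_congr rfl fun j _ => ?_
      by_cases hj : j = i
      · subst hj; simp
      · simp [hj]
    simp only [lieDeriv, map_sub, map_sum, Finset.sum_sub_distrib, h, Finset.sum_add_distrib]
    ring
  have sw : ∑ i, ∑ j, (if j = i then 0 else
        ω (Function.update (Function.update X i ⁅D, X i⁆) j ⁅E, X j⁆))
      = ∑ i, ∑ j, (if j = i then 0 else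
        ω (Function.update (Function.update X i ⁅E, X i⁆) j ⁅D, X j⁆)) := by
    rw [Finset.sum_comm]
    refine Finset.sum_congr rfl fun i _ => Finset.sum_congr rfl fun j _ => ?_
    by_cases hj : j = i
    · simp [hj]
    · rw [if_neg hj, if_neg (Ne.symm hj), Function.update_comm hj]
  rw [Pi.sub_apply, key D E, key E D, sw]
  simp only [lieDeriv, lie_lie, AlternatingMap.map_update_sub, Finset.sum_sub_distrib,
    Derivation.commutator_apply]
  ring

/-- The Lie algebra of all derivations `D` with `D ω = 0`. -/
def annihilator {r : ℕ} (ω : Form k A r) : LieSubalgebra k (Derivation k A A) where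
  carrier := {D | lieDeriv D ω = 0}
  zero_mem' := lieDeriv_zero ω
  add_mem' {D E} hD hE := by
    change lieDeriv D ω = 0 at hD
    change lieDeriv E ω = 0 at hE
    change lieDeriv (D + E) ω = 0
    rw [lieDeriv_add, hD, hE, add_zero]
  smul_mem' c D hD := by
    change lieDeriv D ω = 0 at hD
    change lieDeriv (c • D) ω = 0
    rw [lieDeriv_smul, hD, smul_zero]
  lie_mem' {D E} hD hE := by
    change lieDeriv D ω = 0 at hD
    change lieDeriv E ω = 0 at hE
    change lieDeriv ⁅D, E⁆ ω = 0
    rw [lieDeriv_lie, hD, hE]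
    funext X
    simp [lieDeriv]

/-- The Lie algebra of all derivations `D` with `D ω ∈ A ω`. -/
def conformalStabilizer {r : ℕ} (ω : Form k A r) : LieSubalgebra k (Derivation k A A) where
  carrier := {D | ∃ u : A, lieDeriv D ω = u • ⇑ω}
  zero_mem' := ⟨0, by rw [lieDeriv_zero, zero_smul]⟩
  add_mem' {D E} := by
    rintro ⟨u, hu⟩ ⟨v, hv⟩
    exact ⟨u + v, by rw [lieDeriv_add, hu, hv, add_smul]⟩
  smul_mem' c D := by
    rintro ⟨u, hu⟩
    exact ⟨c • u, by rw [lieDeriv_smul, hu, smul_assoc]⟩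
  lie_mem' {D E} := by
    rintro ⟨u, hu⟩ ⟨v, hv⟩
    refine ⟨D v - E u, ?_⟩
    rw [lieDeriv_lie, hu, hv, lieDeriv_fun_smul, lieDeriv_fun_smul, hu, hv]
    funext X
    simp only [Pi.sub_apply, Pi.add_apply, Pi.smul_apply, smul_eq_mul]
    ring

end Forms

section Algebras

variable (k : Type*) [Field k] (p : ℕ)

/-- The generator `xᵢ` of `A(n)`, the image of `Xᵢ`. -/
def x {n : ℕ} (i : Fin n) : TruncPoly k p n :=
  Ideal.Quotient.mk _ (MvPolynomial.X i)

/-- The one-form `dxᵢ` over `A(n)`. -/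
def dx {n : ℕ} (i : Fin n) : W k p n →ₗ[TruncPoly k p n] TruncPoly k p n :=
  differential k (x k p i)

/-- `dx₁ ∧ … ∧ dxₙ`. -/
def omegaS (n : ℕ) : Form k (TruncPoly k p n) n :=
  wedge fun i => dx k p i

/-- `∑ᵢ₌₁ᵐ dxᵢ ∧ dx_{i'}` over `A(2m)`, where `i' = 2m + 1 - i`. -/
def omegaH (m : ℕ) : Form k (TruncPoly k p (2 * m)) 2 :=
  ∑ i : Fin m,
    let j : Fin (2 * m) := Fin.castLE (by omega) i
    wedge ![dx k p j, dx k p j.rev]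

/-- `∑ᵢ₌₁ᵐ (xᵢ dx_{i'} - x_{i'} dxᵢ) + dx_{2m+1}` over `A(2m + 1)`, where `i' = 2m + 1 - i`. -/
def omegaK (m : ℕ) : Form k (TruncPoly k p (2 * m + 1)) 1 :=
  wedge fun _ =>
    (∑ i : Fin m,
      let j : Fin (2 * m) := Fin.castLE (by omega) i
      (x k p j.castSucc • dx k p j.rev.castSucc - x k p j.rev.castSucc • dx k p j.castSucc))
    + dx k p (Fin.last (2 * m))

/-- `{D ∈ W(n) | D (dx₁ ∧ … ∧ dxₙ) = 0}`. -/
def fullS (n : ℕ) : LieSubalgebra k (W k p n) := annihilator (omegaS k p n)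

/-- `{D ∈ W(2m) | D ω_H = 0}`. -/
def fullH (m : ℕ) : LieSubalgebra k (W k p (2 * m)) := annihilator (omegaH k p m)

/-- `{D ∈ W(2m + 1) | D ω_K ∈ A(2m + 1) ω_K}`. -/
def fullK (m : ℕ) : LieSubalgebra k (W k p (2 * m + 1)) := conformalStabilizer (omegaK k p m)

/-- The special algebra: the first derived algebra of `fullS` for `n ≠ 2`,
the second one for `n = 2`. -/
abbrev S (n : ℕ) : LieIdeal k (fullS k p n) :=
  LieAlgebra.derivedSeries k (fullS k p n) (if n = 2 then 2 else 1)

/-- The Hamiltonian algebra: the derived algebra of `fullH`. -/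
abbrev H (m : ℕ) : LieIdeal k (fullH k p m) :=
  LieAlgebra.derivedSeries k (fullH k p m) 1

/-- The contact algebra: the derived algebra of `fullK`. -/
abbrev K (m : ℕ) : LieIdeal k (fullK k p m) :=
  LieAlgebra.derivedSeries k (fullK k p m) 1

end Algebras

section Coadjoint

variable (k L : Type*) [Field k] [LieRing L] [LieAlgebra k L]

/-- The ring `k[L*]` of polynomial functions on `L*`, generated over `k` by the linear functions
`χ ↦ χ y` with `y ∈ L` (for a finite-dimensional `L` these are all linear functions on `L*`). -/
def polyFun : Subalgebra k (Module.Dual k L → k) :=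
  Algebra.adjoin k (Set.range fun (y : L) (χ : Module.Dual k L) => χ y)

variable {k L}

/-- The coadjoint action of an automorphism of `L`: `(g.χ) (y) = χ (g⁻¹ y)`. -/
def coadj (g : L ≃ₗ⁅k⁆ L) (χ : Module.Dual k L) : Module.Dual k L :=
  χ ∘ₗ (g.symm.toLinearEquiv : L →ₗ[k] L)

variable (k L)

/-- The ring `k[L*]^G` of polynomial functions on `L*` that are invariant under the coadjoint
action of `G = Aut(L)`. -/
def coadjointInvariants : Subalgebra k (Module.Dual k L → k) where
  carrier := {f | f ∈ polyFun k L ∧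
    ∀ (g : L ≃ₗ⁅k⁆ L) (χ : Module.Dual k L), f (coadj g χ) = f χ}
  mul_mem' {a b} ha hb :=
    ⟨mul_mem ha.1 hb.1, fun g χ => by rw [Pi.mul_apply, Pi.mul_apply, ha.2 g χ, hb.2 g χ]⟩
  add_mem' {a b} ha hb :=
    ⟨add_mem ha.1 hb.1, fun g χ => by rw [Pi.add_apply, Pi.add_apply, ha.2 g χ, hb.2 g χ]⟩
  algebraMap_mem' c := ⟨Subalgebra.algebraMap_mem _ c, fun _ _ => rfl⟩

end Coadjoint

end CartanType

end

/-!
Every algebra `L` in question is a Lie algebra of derivations of `A(n)` that is stable under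
conjugation by the dilations `xᵢ ↦ t^{wᵢ} xᵢ`, where all weights `wᵢ` are `1`, except that the last
variable of a contact algebra has weight `2`. Let `N` be the space of elements of `L` of weight
at most `0`, and `V ⊆ L*` its annihilator.

*Invariants are constant on `V`.* A functional in `V` involves positive weights only, so the
dilations contract it to `0`, and an invariant polynomial takes the same value on it as at `0`.

*`Aut(L) · V` is dense.* If `D` raises weights by at least `d`, with `d p` beyond the range of the
weights of `W(n)`, then the truncated series `exp (t ad D)` is an automorphism of `L` for every
`t` (`isTangent_of_mem_fil`), so `χ ∘ ad D` is a tangent direction of the orbit of `χ`. It remains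
to find one `χ₀ ∈ V` for which the `χ₀ ∘ ad D` span a complement of `V`, that is, for which
`y ∈ N` and `χ₀ ⁅D, y⁆ = 0` for all such `D` imply `y = 0`. A separable dominance argument is
replaced by a direct one (`coadjointInvariants_eq_bot`): the partial derivatives of a polynomial
that vanishes on `Aut(L) · V` vanish there as well, because a line through a point of `V` in the
direction `χ₀` has only finitely many degenerate points; a nonzero such polynomial of least degree
is therefore a `p`-th power, and its `p`-th root contradicts minimality.

*The functionals.* Let `∫` be the coefficient of the top monomial of `A(n)`. For `W(n)` with
`n ≥ 2`, `S(n)` and `H(2m)` the functional is `χ₀(D) = ∫ D(xₑ) H` for an explicit quintic `H`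
(`genPoly`), and only the fields `D_P(∂ₗ² f) = ∑ Pᵢⱼ ∂ⱼ∂ₗ² f ∂ᵢ` of a constant bivector `P` are
used; these lie in `L` because `D_P(∂ₗ f) = ⁅∂ₗ, D_P(f)⁆`. Integration by parts turns
`χ₀ ⁅D_P(∂ₗ² f), y⁆` into `-∫ ∂ₗ² f · Q` with `Q` linear in `y`, so that all coefficients of `Q`
of low weight at monomials divisible by `xₗ²` vanish, and these determine `y`
(`eq_zero_of_bivector_pairing`). For `K(2m+1)` the functional is `χ₀(D) = ∫ h ω_K(D)` for another
explicit polynomial `h` (`contactPoly`), the fields are the contact fields of the `∂_z F`, and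
`Q = y(h) + κ h` with a scalar `κ` (`eq_zero_of_cf_contactPoly`). For `W(1)` it is
`χ₀(f ∂) = ∫ f x`.
-/

open scoped BigOperators

noncomputable section

namespace CartanType

/-! ### Invariant functions and tangent directions -/

section Polynomials

variable {k : Type*} [Field k] {σ : Type*}

theorem totalDegree_pderiv_lt (P : MvPolynomial σ k) (i : σ) (hP : P.totalDegree ≠ 0) :
    (MvPolynomial.pderiv i P).totalDegree < P.totalDegree := by
  refine lt_of_le_of_lt (b := P.totalDegree - 1) ?_ (by omega)
  refine Finset.sup_le fun m hm => ?_
  have h1 : m + Finsupp.single i 1 ∈ P.support := by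
    rw [MvPolynomial.mem_support_iff] at hm ⊢
    rw [MvPolynomial.coeff_pderiv] at hm
    exact left_ne_zero_of_mul hm
  have h2 := MvPolynomial.le_totalDegree h1
  rw [Finsupp.sum_add_index' (fun _ => rfl) (fun _ _ _ => rfl), Finsupp.sum_single_index rfl] at h2
  omega

/-- Over a perfect field, a polynomial all of whose partial derivatives vanish is a `p`-th power. -/
theorem exists_pow_eq_of_pderiv_eq_zero (p : ℕ) [Fact p.Prime] [CharP k p] [PerfectRing k p]
    (P : MvPolynomial σ k) (h : ∀ i, MvPolynomial.pderiv i P = 0) : ∃ Q, Q ^ p = P := by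
  have hp : p ≠ 0 := (Fact.out : p.Prime).ne_zero
  have hd : ∀ s ∈ P.support, ∀ i, p ∣ s i := by
    intro s hs i
    by_cases h0 : s i = 0
    · simp [h0]
    have h1 := congrArg (MvPolynomial.coeff (s - Finsupp.single i 1)) (h i)
    have h2 : s - Finsupp.single i 1 + Finsupp.single i 1 = s := by
      ext j
      by_cases hj : j = i
      · subst hj; simp; omega
      · simp [Ne.symm hj]
    rw [MvPolynomial.coeff_pderiv, h2, MvPolynomial.coeff_zero, mul_eq_zero] at h1
    rcases h1 with h1 | h1
    · exact absurd h1 (MvPolynomial.mem_support_iff.1 hs)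
    · rw [← CharP.cast_eq_zero_iff k p, ← h1]
      have h3 := DFunLike.congr_fun h2 i
      simp only [Finsupp.add_apply, Finsupp.single_eq_same] at h3
      exact_mod_cast congrArg (Nat.cast (R := k)) h3.symm
  refine ⟨∑ s ∈ P.support, MvPolynomial.monomial (s.mapRange (· / p) (Nat.zero_div p))
    ((frobeniusEquiv k p).symm (P.coeff s)), ?_⟩
  have : ExpChar (MvPolynomial σ k) p := ExpChar.prime Fact.out
  rw [sum_pow_char]
  conv_rhs => rw [P.as_sum]
  refine Finset.sum_congr rfl fun s hs => ?_
  rw [MvPolynomial.monomial_pow, frobeniusEquiv_symm_pow_p]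
  have h1 : p • s.mapRange (· / p) (Nat.zero_div p) = s := by
    ext i
    simp [Nat.mul_div_cancel' (hd s hs i)]
  rw [h1]

/-- Chain rule for the substitution of univariate polynomials. -/
theorem derivative_aeval [Fintype σ] (q : σ → Polynomial k) (P : MvPolynomial σ k) :
    Polynomial.derivative (MvPolynomial.aeval q P) =
      ∑ i, MvPolynomial.aeval q (MvPolynomial.pderiv i P) * Polynomial.derivative (q i) := by
  classical
  induction P using MvPolynomial.induction_on with
  | C a => simp
  | add P Q hP hQ => simp [hP, hQ, add_mul, Finset.sum_add_distrib]
  | mul_X P j hP =>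
    simp only [map_mul, MvPolynomial.aeval_X, Polynomial.derivative_mul, hP, Derivation.leibniz,
      MvPolynomial.pderiv_X, smul_eq_mul, map_add, add_mul, Finset.sum_add_distrib]
    rw [add_comm]
    congr 1
    · rw [Finset.sum_eq_single j] <;> simp +contextual [eq_comm]
    · rw [Finset.sum_mul]
      exact Finset.sum_congr rfl fun i _ => by ring

theorem eval_aeval_polynomial (q : σ → Polynomial k) (P : MvPolynomial σ k) (t : k) :
    (MvPolynomial.aeval q P).eval t = MvPolynomial.eval (fun i => (q i).eval t) P := by
  rw [MvPolynomial.aeval_def, ← Polynomial.coe_evalRingHom, MvPolynomial.hom_eval₂]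
  simp only [MvPolynomial.eval, MvPolynomial.coe_eval₂Hom]
  congr 1
  ext x
  simp

/-- The derivative at `0` of a polynomial along a polynomial curve on which it vanishes is `0`. -/
theorem sum_pderiv_mul_derivative_eq_zero [Infinite k] [Fintype σ] (q : σ → Polynomial k)
    (P : MvPolynomial σ k) (h : ∀ t, MvPolynomial.eval (fun i => (q i).eval t) P = 0) :
    ∑ i, MvPolynomial.eval (fun i => (q i).eval 0) (MvPolynomial.pderiv i P) * (q i).coeff 1
      = 0 := by
  have h0 : MvPolynomial.aeval q P = 0 :=
    Polynomial.funext fun t => by rw [eval_aeval_polynomial, h, Polynomial.eval_zero]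
  have h1 := congrArg (Polynomial.eval 0) (derivative_aeval q P)
  rw [h0] at h1
  simpa [Polynomial.eval_finsetSum, eval_aeval_polynomial, Polynomial.eval_zero,
    ← Polynomial.coeff_zero_eq_eval_zero, Polynomial.coeff_derivative] using h1.symm

end Polynomials

section Criterion

variable {k L : Type*} [Field k] [LieRing L] [LieAlgebra k L]

theorem exists_eval_of_mem_polyFun {ι : Type*} [Fintype ι] (b : Module.Basis ι k L)
    {f : Module.Dual k L → k} (hf : f ∈ polyFun k L) :
    ∃ P : MvPolynomial ι k, ∀ χ, f χ = MvPolynomial.eval (fun i => χ (b i)) P := by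
  induction hf using Algebra.adjoin_induction with
  | mem f hf =>
    obtain ⟨y, rfl⟩ := hf
    refine ⟨∑ i, MvPolynomial.C (b.repr y i) * MvPolynomial.X i, fun χ => ?_⟩
    change χ y = _
    conv_lhs => rw [← b.sum_repr y]
    simp only [map_sum, map_smul, smul_eq_mul, map_mul, MvPolynomial.eval_C, MvPolynomial.eval_X]
  | algebraMap c => exact ⟨MvPolynomial.C c, fun χ => by simp [Pi.algebraMap_apply]⟩
  | add f g _ _ hf hg =>
    obtain ⟨P, hP⟩ := hf
    obtain ⟨Q, hQ⟩ := hg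
    exact ⟨P + Q, fun χ => by simp [hP, hQ]⟩
  | mul f g _ _ hf hg =>
    obtain ⟨P, hP⟩ := hf
    obtain ⟨Q, hQ⟩ := hg
    exact ⟨P * Q, fun χ => by simp [hP, hQ]⟩

/-- `D` is tangent to a polynomial one-parameter family `t ↦ ∑ᵢ tⁱ Tᵢ` of automorphisms, in the
sense that `T₀ = 1` and `T₁ = ad D`. -/
def IsTangent (k : Type*) {L : Type*} [Field k] [LieRing L] [LieAlgebra k L] (D : L) : Prop :=
  ∃ (d : ℕ) (T : ℕ → L →ₗ[k] L), (∀ y, T 0 y = y) ∧ (∀ y, T 1 y = ⁅D, y⁆) ∧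
    ∀ t : k, ∃ g : L ≃ₗ⁅k⁆ L, ∀ y, g y = ∑ i ∈ Finset.range (d + 2), t ^ i • T i y

/-- A linear perturbation `χ₁ + s χ₀` of a left nondegenerate pairing with `E` is left
nondegenerate for all but finitely many `s`. -/
theorem finite_degenerate [FiniteDimensional k L] (N E : Submodule k L)
    (χ₀ χ₁ : Module.Dual k L)
    (h : ∀ y ∈ N, (∀ D ∈ E, χ₀ ⁅D, y⁆ = 0) → y = 0) :
    {s : k | ¬ ∀ y ∈ N, (∀ D ∈ E, (χ₁ + s • χ₀) ⁅D, y⁆ = 0) → y = 0}.Finite := by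
  let M : Module.Dual k L → N →ₗ[k] E →ₗ[k] k := fun χ =>
    LinearMap.mk₂ k (fun y D => χ ⁅(D : L), (y : L)⁆) (by simp) (by simp) (by simp) (by simp)
  have hM : ∀ χ y D, M χ y D = χ ⁅(D : L), (y : L)⁆ := fun _ _ _ => rfl
  have hinj : LinearMap.ker (M χ₀) = ⊥ := by
    rw [LinearMap.ker_eq_bot']
    intro y hy
    ext
    exact h y y.2 fun D hD => by rw [← hM χ₀ y ⟨D, hD⟩, hy]; rfl
  obtain ⟨Λ, hΛ⟩ := LinearMap.exists_leftInverse_of_injective (M χ₀) hinj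
  let B : Module.End k N := Λ ∘ₗ M χ₁
  refine ((Module.End.finite_hasEigenvalue B).image (fun s => -s)).subset ?_
  intro s hs
  simp only [Set.mem_ofPred_eq, not_forall] at hs
  obtain ⟨y, hyN, hy, hy0⟩ := hs
  refine ⟨-s, ?_, neg_neg s⟩
  have h1 : M χ₁ ⟨y, hyN⟩ = (-s) • M χ₀ ⟨y, hyN⟩ := by
    ext D
    have := hy D D.2
    simp only [LinearMap.add_apply, LinearMap.smul_apply, smul_eq_mul] at this
    simp only [LinearMap.smul_apply, hM, smul_eq_mul]
    linear_combination this
  refine Module.End.hasEigenvalue_of_hasEigenvector (x := ⟨y, hyN⟩) ⟨?_, ?_⟩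
  · rw [Module.End.mem_eigenspace_iff]
    change Λ (M χ₁ ⟨y, hyN⟩) = _
    rw [h1, map_smul]
    congr 1
    exact LinearMap.congr_fun hΛ _
  · simpa [Subtype.ext_iff] using hy0

variable [IsAlgClosed k]

/-- Let `V` be the annihilator of `N`. If a polynomial vanishes on `Aut(L) · V`, then so do its
partial derivatives: at a point where the tangent directions span, its differential is `0`, and
such points are dense in `V`. -/
theorem eval_pderiv_eq_zero [FiniteDimensional k L] {ι : Type*} [Fintype ι]
    (b : Module.Basis ι k L) (N E : Submodule k L) (hE : ∀ D ∈ E, IsTangent k D)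
    (χ₀ : Module.Dual k L) (hχ₀ : ∀ y ∈ N, χ₀ y = 0)
    (hnd : ∀ y ∈ N, (∀ D ∈ E, χ₀ ⁅D, y⁆ = 0) → y = 0) (P : MvPolynomial ι k)
    (hP : ∀ (g : L ≃ₗ⁅k⁆ L) (χ : Module.Dual k L), (∀ y ∈ N, χ y = 0) →
      MvPolynomial.eval (fun i => χ (g (b i))) P = 0)
    (g : L ≃ₗ⁅k⁆ L) (χ : Module.Dual k L) (hχ : ∀ y ∈ N, χ y = 0) (i : ι) :
    MvPolynomial.eval (fun i => χ (g (b i))) (MvPolynomial.pderiv i P) = 0 := by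
  have : Infinite k := IsAlgClosed.instInfinite
  have key : ∀ χ : Module.Dual k L, (∀ y ∈ N, χ y = 0) →
      (∀ y ∈ N, (∀ D ∈ E, χ ⁅D, y⁆ = 0) → y = 0) →
      MvPolynomial.eval (fun i => χ (g (b i))) (MvPolynomial.pderiv i P) = 0 := by
    intro χ hχ hnd
    -- `Y` is the differential of `P` at `χ ∘ g`, transported by `g`.
    set c : ι → k := fun i =>
      MvPolynomial.eval (fun i => χ (g (b i))) (MvPolynomial.pderiv i P) with hc
    set Y : L := ∑ i, c i • g (b i) with hY
    have hYN : Y ∈ N := by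
      rw [← Subspace.forall_mem_dualAnnihilator_apply_eq_zero_iff]
      intro v hv
      rw [Submodule.mem_dualAnnihilator] at hv
      have := sum_pderiv_mul_derivative_eq_zero
        (fun i => Polynomial.C (χ (g (b i))) + Polynomial.C (v (g (b i))) * Polynomial.X) P
        (fun t => by
          have := hP g (χ + t • v) (fun y hy => by simp [hχ y hy, hv y hy])
          simpa only [LinearMap.add_apply, LinearMap.smul_apply, smul_eq_mul, Polynomial.eval_add,
            Polynomial.eval_mul, Polynomial.eval_C, Polynomial.eval_X, mul_comm t] using this)
      simpa [hY, hc, Polynomial.coeff_C] using this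
    have hY0 : Y = 0 := by
      refine hnd Y hYN fun D hD => ?_
      obtain ⟨d, T, hT0, hT1, hT⟩ := hE D hD
      have h1 : ∀ t : k, MvPolynomial.eval (fun i => ∑ j ∈ Finset.range (d + 2),
          t ^ j * χ (T j (g (b i)))) P = 0 := by
        intro t
        obtain ⟨e, he⟩ := hT t
        have := hP (g.trans e) χ hχ
        simpa [he] using this
      have h2 := sum_pderiv_mul_derivative_eq_zero
        (fun i => ∑ j ∈ Finset.range (d + 2),
          Polynomial.C (χ (T j (g (b i)))) * Polynomial.X ^ j) P
        (fun t => by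
          simpa only [Polynomial.eval_finsetSum, Polynomial.eval_mul, Polynomial.eval_C,
            Polynomial.eval_pow, Polynomial.eval_X, mul_comm (χ _)] using h1 t)
      have h3 : ∀ i, (∑ j ∈ Finset.range (d + 2),
          Polynomial.C (χ (T j (g (b i)))) * Polynomial.X ^ j : Polynomial k).coeff 1
            = χ ⁅D, g (b i)⁆ := by
        intro i
        simp [Polynomial.coeff_X_pow, hT1]
      have h4 : ∀ i, (∑ j ∈ Finset.range (d + 2),
          Polynomial.C (χ (T j (g (b i)))) * Polynomial.X ^ j : Polynomial k).eval 0
            = χ (g (b i)) := by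
        intro i
        rw [← Polynomial.coeff_zero_eq_eval_zero]
        simp [Polynomial.coeff_X_pow, hT0]
      simp only [h3, h4] at h2
      rw [hY, lie_sum, map_sum]
      simpa [hc] using h2
    have hli := (b.map g.toLinearEquiv).linearIndependent
    rw [Fintype.linearIndependent_iff] at hli
    exact hli c (by simpa [hY] using hY0) i
  -- On the line `χ + s χ₀` the derivative is a polynomial in `s` with infinitely many zeros.
  set q : Polynomial k := MvPolynomial.aeval
    (fun i => Polynomial.C (χ (g (b i))) + Polynomial.C (χ₀ (g (b i))) * Polynomial.X)
    (MvPolynomial.pderiv i P) with hq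
  have hqe : ∀ s, q.eval s = MvPolynomial.eval (fun i => (χ + s • χ₀) (g (b i)))
      (MvPolynomial.pderiv i P) := by
    intro s
    rw [hq, eval_aeval_polynomial]
    simp only [LinearMap.add_apply, LinearMap.smul_apply, smul_eq_mul, Polynomial.eval_add,
      Polynomial.eval_mul, Polynomial.eval_C, Polynomial.eval_X, mul_comm s]
  have hq0 : q = 0 := by
    refine Polynomial.eq_zero_of_infinite_isRoot q ?_
    refine ((finite_degenerate N E χ₀ χ hnd).infinite_compl).mono fun s hs => ?_
    simp only [Set.mem_compl_iff, Set.mem_ofPred_eq, not_not] at hs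
    rw [Set.mem_ofPred_eq, Polynomial.IsRoot.def, hqe]
    exact key _ (fun y hy => by simp [hχ y hy, hχ₀ y hy]) hs
  simpa [hq0] using (hqe 0).symm

/-- No nonzero polynomial vanishes on `Aut(L) · V`, by induction on the degree: its partial
derivatives vanish, so it is a `p`-th power, and its `p`-th root vanishes on `Aut(L) · V` too. -/
theorem eq_zero_of_vanishes_on_saturation (p : ℕ) [Fact p.Prime] [CharP k p]
    [FiniteDimensional k L] {ι : Type*} [Fintype ι]
    (b : Module.Basis ι k L) (N E : Submodule k L) (hE : ∀ D ∈ E, IsTangent k D)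
    (χ₀ : Module.Dual k L) (hχ₀ : ∀ y ∈ N, χ₀ y = 0)
    (hnd : ∀ y ∈ N, (∀ D ∈ E, χ₀ ⁅D, y⁆ = 0) → y = 0) (P : MvPolynomial ι k)
    (hP : ∀ (g : L ≃ₗ⁅k⁆ L) (χ : Module.Dual k L), (∀ y ∈ N, χ y = 0) →
      MvPolynomial.eval (fun i => χ (g (b i))) P = 0) : P = 0 := by
  induction hd : P.totalDegree using Nat.strong_induction_on generalizing P with
  | _ d ih =>
    by_cases h0 : P.totalDegree = 0
    · rw [MvPolynomial.totalDegree_eq_zero_iff_eq_C] at h0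
      have := hP LieEquiv.refl χ₀ hχ₀
      rw [h0, MvPolynomial.eval_C] at this
      rw [h0, this, MvPolynomial.C_0]
    have h1 : ∀ i, MvPolynomial.pderiv i P = 0 := fun i =>
      ih _ (hd ▸ totalDegree_pderiv_lt P i h0) _
        (fun g χ hχ => eval_pderiv_eq_zero b N E hE χ₀ hχ₀ hnd P hP g χ hχ i) rfl
    obtain ⟨Q, rfl⟩ := exists_pow_eq_of_pderiv_eq_zero p P h1
    have hp : 2 ≤ p := (Fact.out : p.Prime).two_le
    have hQd : (Q ^ p).totalDegree = p * Q.totalDegree := by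
      have hQ0 : Q ≠ 0 := by
        rintro rfl
        simp [zero_pow (by omega : p ≠ 0)] at h0
      clear * - hQ0
      induction p with
      | zero => simp
      | succ n ih =>
        rw [pow_succ, MvPolynomial.totalDegree_mul_of_isDomain (pow_ne_zero _ hQ0) hQ0, ih]
        ring
    have hQ : Q = 0 := by
      refine ih Q.totalDegree ?_ Q (fun g χ hχ => ?_) rfl
      · rw [← hd, hQd]
        have : Q.totalDegree ≠ 0 := fun h => h0 (by rw [hQd, h, mul_zero])
        nlinarith [Nat.pos_of_ne_zero this]
      · have := hP g χ hχ
        rw [map_pow] at this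
        exact pow_eq_zero_iff (by omega) |>.1 this
    rw [hQ, zero_pow (by omega)]

/-- If the invariants are constant on the annihilator `V` of `N`, and `Aut(L) · V` is dense
because the tangent directions `χ₀ ∘ ad D` (`D ∈ E`) at a point `χ₀ ∈ V` span a complement
of `V`, then all invariants are constant. -/
theorem coadjointInvariants_eq_bot (p : ℕ) [Fact p.Prime] [CharP k p]
    [FiniteDimensional k L]
    (N E : Submodule k L) (hE : ∀ D ∈ E, IsTangent k D)
    (χ₀ : Module.Dual k L) (hχ₀ : ∀ y ∈ N, χ₀ y = 0)
    (hnd : ∀ y ∈ N, (∀ D ∈ E, χ₀ ⁅D, y⁆ = 0) → y = 0)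
    (hN : ∀ f ∈ coadjointInvariants k L, ∀ χ : Module.Dual k L, (∀ y ∈ N, χ y = 0) →
      f χ = f 0) :
    coadjointInvariants k L = ⊥ := by
  rw [eq_bot_iff]
  intro f hf
  let b := Module.finBasis k L
  obtain ⟨P, hP⟩ := exists_eval_of_mem_polyFun b hf.1
  have h0 : P - MvPolynomial.C (f 0) = 0 := by
    refine eq_zero_of_vanishes_on_saturation p b N E hE χ₀ hχ₀ hnd _ fun g χ hχ => ?_
    have h1 := hf.2 g.symm χ
    rw [hP] at h1
    rw [map_sub, MvPolynomial.eval_C, sub_eq_zero, ← hN f hf χ hχ, ← h1]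
    rfl
  rw [Algebra.mem_bot]
  refine ⟨f 0, ?_⟩
  funext χ
  rw [hP χ, sub_eq_zero.1 h0, MvPolynomial.eval_C]
  rfl

end Criterion

/-! ### Truncated exponentials of nilpotent derivations -/

section Exponential

variable {k L : Type*} [Field k] [LieRing L] [LieAlgebra k L]

theorem ad_pow_lie (D y z : L) (n : ℕ) :
    (LieAlgebra.ad k L D ^ n) ⁅y, z⁆ = ∑ ij ∈ Finset.HasAntidiagonal.antidiagonal n,
      (n.choose ij.1 : k) •
        ⁅(LieAlgebra.ad k L D ^ ij.1) y, (LieAlgebra.ad k L D ^ ij.2) z⁆ := by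
  have hD : ∀ (m : ℕ) (y : L), (LieDerivation.inner k L L (-D))^[m] y =
      (LieAlgebra.ad k L D ^ m) y := by
    intro m y
    rw [Module.End.pow_apply]
    congr 1
    funext y
    simp [LieDerivation.inner_apply_apply]
  have h := LieDerivation.iterate_apply_lie (LieDerivation.inner k L L (-D)) n y z
  simp only [hD] at h
  rw [h]
  exact Finset.sum_congr rfl fun ij _ => (Nat.cast_smul_eq_nsmul k _ _).symm

/-- The exponential series of `ad D`, truncated below degree `p`. -/
def truncExp (k : Type*) {L : Type*} [Field k] [LieRing L] [LieAlgebra k L] (p : ℕ) (D : L) :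
    L →ₗ[k] L :=
  ∑ i ∈ Finset.range p, ((i.factorial : k)⁻¹) • LieAlgebra.ad k L D ^ i

variable (p : ℕ) [Fact p.Prime] [CharP k p]

theorem cast_factorial_ne_zero {i : ℕ} (hi : i < p) : (i.factorial : k) ≠ 0 := by
  rw [Ne, CharP.cast_eq_zero_iff k p, (Fact.out : p.Prime).dvd_factorial]
  omega

/-- The product of two truncated exponential series differs from the truncated series of the
product only by terms of degree at least `p`. -/
theorem truncExp_lie (D : L)
    (h : ∀ y z : L, ∀ a b, p ≤ a + b →
      ⁅(LieAlgebra.ad k L D ^ a) y, (LieAlgebra.ad k L D ^ b) z⁆ = 0) (y z : L) :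
    truncExp k p D ⁅y, z⁆ = ⁅truncExp k p D y, truncExp k p D z⁆ := by
  set u : ℕ → ℕ → L := fun a b =>
    ((a.factorial : k)⁻¹ * (b.factorial : k)⁻¹) •
      ⁅(LieAlgebra.ad k L D ^ a) y, (LieAlgebra.ad k L D ^ b) z⁆ with hu
  have h1 : truncExp k p D ⁅y, z⁆ =
      ∑ n ∈ Finset.range p, ∑ ij ∈ Finset.HasAntidiagonal.antidiagonal n, u ij.1 ij.2 := by
    simp only [truncExp, LinearMap.sum_apply, LinearMap.smul_apply, ad_pow_lie, Finset.smul_sum]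
    refine Finset.sum_congr rfl fun n hn => Finset.sum_congr rfl fun ij hij => ?_
    rw [Finset.HasAntidiagonal.mem_antidiagonal] at hij
    rw [Finset.mem_range] at hn
    rw [smul_smul, hu]
    congr 1
    have e := Nat.add_choose_mul_factorial_mul_factorial ij.1 ij.2
    rw [hij, ← Nat.choose_symm_of_eq_add hij.symm] at e
    have e' : (n.choose ij.1 : k) * ij.1.factorial * ij.2.factorial = n.factorial := by
      exact_mod_cast congrArg (Nat.cast (R := k)) e
    have n1 := cast_factorial_ne_zero (k := k) p (i := ij.1) (by omega)
    have n2 := cast_factorial_ne_zero (k := k) p (i := ij.2) (by omega)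
    have n3 := cast_factorial_ne_zero (k := k) p hn
    field_simp
    rw [← e']
  have h2 : ⁅truncExp k p D y, truncExp k p D z⁆ =
      ∑ a ∈ Finset.range p, ∑ b ∈ Finset.range p, u a b := by
    simp only [truncExp, LinearMap.sum_apply, LinearMap.smul_apply, sum_lie, lie_sum, hu,
      smul_lie, lie_smul, mul_smul, Finset.smul_sum]
    rw [Finset.sum_comm]
    exact Finset.sum_congr rfl fun a _ => Finset.sum_congr rfl fun b _ => smul_comm _ _ _
  rw [h1, h2, Finset.sum_sigma', ← Finset.sum_product']
  refine Finset.sum_bij_ne_zero (fun x _ _ => x.2) ?_ ?_ ?_ ?_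
  · rintro ⟨n, a, b⟩ hx -
    simp only [Finset.mem_sigma, Finset.mem_range, Finset.HasAntidiagonal.mem_antidiagonal,
      Finset.mem_product] at hx ⊢
    omega
  · rintro ⟨n, a, b⟩ hx - ⟨n', a', b'⟩ hx' - heq
    simp only [Finset.mem_sigma, Finset.mem_range,
      Finset.HasAntidiagonal.mem_antidiagonal] at hx hx'
    obtain ⟨rfl, rfl⟩ := Prod.mk.inj heq
    obtain rfl : n = n' := by omega
    rfl
  · rintro ⟨a, b⟩ - hne
    refine ⟨⟨a + b, a, b⟩, ?_, hne, rfl⟩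
    simp only [Finset.mem_sigma, Finset.mem_range, Finset.HasAntidiagonal.mem_antidiagonal,
      and_true]
    by_contra hab
    exact hne (by simp only [hu]; rw [h y z a b (by omega), smul_zero])
  · intros; rfl

theorem truncExp_bijective [FiniteDimensional k L] (D : L)
    (hD : LieAlgebra.ad k L D ^ p = 0) : Function.Bijective (truncExp k p D) := by
  have hp : 0 < p := (Fact.out : p.Prime).pos
  have h1 : truncExp k p D = 1 + LieAlgebra.ad k L D *
      ∑ i ∈ Finset.range (p - 1), (((i + 1).factorial : k)⁻¹) • LieAlgebra.ad k L D ^ i := by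
    obtain ⟨q, rfl⟩ : ∃ q, p = q + 1 := ⟨p - 1, by omega⟩
    rw [truncExp, Finset.sum_range_succ', add_comm]
    simp [Finset.mul_sum, pow_succ']
  have h2 : IsUnit (truncExp k p D) := by
    rw [h1]
    refine IsNilpotent.isUnit_one_add ?_
    refine Commute.isNilpotent_mul_right ?_ ⟨p, hD⟩
    exact Commute.sum_right _ _ _ fun i _ => (Commute.pow_right rfl _).smul_right _
  exact (Module.End.isUnit_iff _).1 h2

/-- If the higher Leibniz terms of `ad D` vanish, then `t ↦ exp (t ad D)` is a one-parameter family
of automorphisms with tangent vector `D`. -/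
theorem isTangent_of_ad_pow [FiniteDimensional k L] (D : L)
    (hD : LieAlgebra.ad k L D ^ p = 0)
    (h : ∀ y z : L, ∀ a b, p ≤ a + b →
      ⁅(LieAlgebra.ad k L D ^ a) y, (LieAlgebra.ad k L D ^ b) z⁆ = 0) : IsTangent k D := by
  have hp : 2 ≤ p := (Fact.out : p.Prime).two_le
  refine ⟨p - 2, fun i => ((i.factorial : k)⁻¹) • LieAlgebra.ad k L D ^ i, by simp, by simp,
    fun t => ?_⟩
  have hpow : ∀ i, LieAlgebra.ad k L (t • D) ^ i = t ^ i • LieAlgebra.ad k L D ^ i := by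
    intro i
    rw [map_smul, smul_pow]
  refine ⟨LieEquiv.ofBijective
    ({ truncExp k p (t • D) with
        map_lie' := fun {y z} => truncExp_lie p (t • D) (fun y z a b hab => ?_) y z } :
      L →ₗ⁅k⁆ L) (truncExp_bijective p (t • D) (by rw [hpow, hD, smul_zero])), fun y => ?_⟩
  · rw [hpow, hpow, LinearMap.smul_apply, LinearMap.smul_apply, smul_lie, lie_smul, h y z a b hab,
      smul_zero, smul_zero]
  · rw [Nat.sub_add_cancel hp]
    change truncExp k p (t • D) y = _
    simp only [truncExp, LinearMap.sum_apply, LinearMap.smul_apply, hpow]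
    exact Finset.sum_congr rfl fun i _ => smul_comm _ _ _

end Exponential

/-! ### Truncated polynomial rings and their derivations -/

section Instances

variable {k : Type*} [Field k] {p n : ℕ}

-- Without these shortcuts, instance search unfolds the quotient ring again at every step.
scoped instance : CommRing (TruncPoly k p n) := inferInstance
scoped instance : Ring (TruncPoly k p n) := inferInstance
scoped instance : CommSemiring (TruncPoly k p n) := inferInstance
scoped instance : Semiring (TruncPoly k p n) := inferInstance
scoped instance : AddCommGroup (TruncPoly k p n) := inferInstance
scoped instance : AddCommMonoid (TruncPoly k p n) := inferInstance
scoped instance : Algebra k (TruncPoly k p n) := inferInstance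
scoped instance : Module k (TruncPoly k p n) := inferInstance
scoped instance : SMul k (TruncPoly k p n) := inferInstance
scoped instance : AddCommGroup (W k p n) := inferInstance
scoped instance : AddCommMonoid (W k p n) := inferInstance
scoped instance : Module k (W k p n) := inferInstance
scoped instance : Module (TruncPoly k p n) (W k p n) := inferInstance
scoped instance : LieRing (W k p n) := inferInstance
scoped instance : LieAlgebra k (W k p n) := inferInstance

end Instances

section Coefficients

variable {k : Type*} [Field k] {p n : ℕ}

theorem mem_truncIdeal_iff (q : MvPolynomial (Fin n) k) :
    q ∈ Ideal.span (Set.range fun i : Fin n => (MvPolynomial.X i ^ p : MvPolynomial (Fin n) k)) ↔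
      ∀ a : Fin n →₀ ℕ, (∀ i, a i < p) → q.coeff a = 0 := by
  have h : (Set.range fun i : Fin n => (MvPolynomial.X i ^ p : MvPolynomial (Fin n) k)) =
      (fun s => MvPolynomial.monomial s (1 : k)) '' Set.range fun i : Fin n =>
        Finsupp.single i p := by
    rw [← Set.range_comp]
    congr 1
    funext i
    simp [MvPolynomial.X_pow_eq_monomial]
  rw [h, MvPolynomial.mem_ideal_span_monomial_image]
  constructor
  · intro hq a ha
    by_contra h0
    obtain ⟨_, ⟨i, rfl⟩, hi⟩ := hq a (MvPolynomial.mem_support_iff.2 h0)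
    have := hi i
    simp only [Finsupp.single_eq_same] at this
    exact absurd (ha i) (by omega)
  · intro hq a ha
    by_contra h0
    refine MvPolynomial.mem_support_iff.1 ha (hq a fun i => ?_)
    by_contra hi
    exact h0 ⟨_, ⟨i, rfl⟩, by simpa using hi⟩

/-- The projection `k[X₁, …, Xₙ] → A(n)`. -/
def proj (k : Type*) [Field k] (p n : ℕ) : MvPolynomial (Fin n) k →ₐ[k] TruncPoly k p n :=
  Ideal.Quotient.mkₐ k _

theorem proj_surjective : Function.Surjective (proj k p n) := Ideal.Quotient.mk_surjective

@[simp] theorem proj_X (i : Fin n) : proj k p n (MvPolynomial.X i) = x k p i := rfl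

theorem proj_eq_zero_iff (q : MvPolynomial (Fin n) k) :
    proj k p n q = 0 ↔ ∀ a : Fin n →₀ ℕ, (∀ i, a i < p) → q.coeff a = 0 :=
  Ideal.Quotient.eq_zero_iff_mem.trans (mem_truncIdeal_iff q)

theorem truncPoly_induction {C : TruncPoly k p n → Prop} (u : TruncPoly k p n)
    (hC : ∀ c : k, C (algebraMap k _ c)) (hadd : ∀ u v, C u → C v → C (u + v))
    (hX : ∀ u i, C u → C (u * x k p i)) : C u := by
  obtain ⟨q, rfl⟩ := proj_surjective u
  induction q using MvPolynomial.induction_on with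
  | C a => rw [← MvPolynomial.algebraMap_eq, AlgHom.commutes]; exact hC a
  | add P Q hP hQ => rw [map_add]; exact hadd _ _ hP hQ
  | mul_X P j hP => rw [map_mul, proj_X]; exact hX _ _ hP

/-- The coefficient of `x^a` in an element of `A(n)`. It is `0` by convention when `x^a = 0`, that
is, when some exponent is at least `p`. -/
def cf (a : Fin n →₀ ℕ) : TruncPoly k p n →ₗ[k] k where
  toFun u := open Classical in
    if ∀ i, a i < p then (Function.surjInv (proj_surjective (k := k) (p := p)) u).coeff a else 0
  map_add' u v := by
    split_ifs with h
    · have := (proj_eq_zero_iff (k := k) (p := p)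
        (Function.surjInv (proj_surjective (k := k) (p := p)) (u + v) -
        (Function.surjInv (proj_surjective (k := k) (p := p)) u +
        Function.surjInv (proj_surjective (k := k) (p := p)) v))).1
        (by simp [Function.surjInv_eq]) a h
      rwa [MvPolynomial.coeff_sub, sub_eq_zero, MvPolynomial.coeff_add] at this
    · simp
  map_smul' c u := by
    split_ifs with h
    · have := (proj_eq_zero_iff (k := k) (p := p)
        (Function.surjInv (proj_surjective (k := k) (p := p)) (c • u) -
        c • Function.surjInv (proj_surjective (k := k) (p := p)) u)).1
        (by simp [Function.surjInv_eq]) a h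
      rwa [MvPolynomial.coeff_sub, sub_eq_zero, MvPolynomial.coeff_smul] at this
    · simp

theorem cf_of_not_lt {a : Fin n →₀ ℕ} (ha : ¬ ∀ i, a i < p) (u : TruncPoly k p n) :
    cf a u = 0 := if_neg ha

theorem cf_proj {a : Fin n →₀ ℕ} (ha : ∀ i, a i < p) (q : MvPolynomial (Fin n) k) :
    cf a (proj k p n q) = q.coeff a := by
  have := (proj_eq_zero_iff (k := k) (p := p)
    (Function.surjInv (proj_surjective (k := k) (p := p)) (proj k p n q) - q)).1
    (by simp [Function.surjInv_eq]) a ha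
  rw [MvPolynomial.coeff_sub, sub_eq_zero] at this
  rw [← this]
  exact if_pos ha

theorem eq_zero_of_cf {u : TruncPoly k p n} (h : ∀ a, (∀ i, a i < p) → cf a u = 0) : u = 0 := by
  obtain ⟨q, rfl⟩ := proj_surjective u
  rw [proj_eq_zero_iff]
  intro a ha
  rw [← cf_proj ha]
  exact h a ha

instance : FiniteDimensional k (TruncPoly k p n) := by
  let F : TruncPoly k p n →ₗ[k] ((Fin n → Fin p) → k) :=
    LinearMap.pi fun a => cf (Finsupp.equivFunOnFinite.symm fun i => (a i : ℕ))
  refine Module.Finite.of_injective F ?_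
  rw [← LinearMap.ker_eq_bot, LinearMap.ker_eq_bot']
  intro u hu
  refine eq_zero_of_cf fun a ha => ?_
  have := congrFun hu fun i => ⟨a i, ha i⟩
  have e : (Finsupp.equivFunOnFinite.symm fun i => a i) = a := by
    ext i
    simp
  change cf (Finsupp.equivFunOnFinite.symm fun i => a i) u = 0 at this
  rwa [e] at this

theorem cf_mul {a : Fin n →₀ ℕ} (ha : ∀ i, a i < p) (u v : TruncPoly k p n) :
    cf a (u * v) = ∑ b ∈ Finset.HasAntidiagonal.antidiagonal a, cf b.1 u * cf b.2 v := by
  obtain ⟨q, rfl⟩ := proj_surjective u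
  obtain ⟨r, rfl⟩ := proj_surjective v
  rw [← map_mul, cf_proj ha, MvPolynomial.coeff_mul]
  refine Finset.sum_congr rfl fun b hb => ?_
  have hb := Finset.HasAntidiagonal.mem_antidiagonal.1 hb
  have h1 : ∀ i, b.1 i + b.2 i = a i := fun i => DFunLike.congr_fun hb i
  rw [cf_proj fun i => by have := h1 i; have := ha i; omega,
    cf_proj fun i => by have := h1 i; have := ha i; omega]

/-- The monomial `x^a`. -/
def mono (k : Type*) [Field k] (p : ℕ) {n : ℕ} (a : Fin n →₀ ℕ) : TruncPoly k p n :=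
  proj k p n (MvPolynomial.monomial a 1)

theorem cf_mono {a : Fin n →₀ ℕ} (ha : ∀ i, a i < p) (b : Fin n →₀ ℕ) :
    cf a (mono k p b) = if b = a then 1 else 0 := by
  classical
  rw [mono, cf_proj ha, MvPolynomial.coeff_monomial]

theorem cf_mono_mul {a : Fin n →₀ ℕ} (ha : ∀ i, a i < p) (b : Fin n →₀ ℕ)
    (u : TruncPoly k p n) :
    cf a (mono k p b * u) = if b ≤ a then cf (a - b) u else 0 := by
  obtain ⟨q, rfl⟩ := proj_surjective u
  rw [mono, ← map_mul, cf_proj ha, MvPolynomial.coeff_monomial_mul', one_mul, cf_proj]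
  exact fun i => lt_of_le_of_lt (Nat.sub_le _ _) (ha i)

theorem mono_add (a b : Fin n →₀ ℕ) : mono k p (a + b) = mono k p a * mono k p b := by
  rw [mono, mono, mono, ← map_mul, MvPolynomial.monomial_mul, one_mul]

@[simp] theorem mono_zero : mono k p (0 : Fin n →₀ ℕ) = 1 := by
  rw [mono, MvPolynomial.monomial_zero', MvPolynomial.C_1, map_one]

theorem mono_single (i : Fin n) (e : ℕ) : mono k p (Finsupp.single i e) = x k p i ^ e := by
  rw [mono, ← MvPolynomial.X_pow_eq_monomial, map_pow, proj_X]

end Coefficients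

section Derivations

theorem derivation_sum_apply {k A ι : Type*} [Field k] [CommRing A] [Algebra k A] (s : Finset ι)
    (D : ι → Derivation k A A) (u : A) : (∑ i ∈ s, D i) u = ∑ i ∈ s, D i u := by
  have := map_sum (Derivation.coeFnAddMonoidHom (R := k) (A := A) (M := A)) D s
  exact (congrFun this u).trans (Finset.sum_apply _ _ _)

variable {k : Type*} [Field k] {p n : ℕ}

theorem derivation_ext {D E : W k p n} (h : ∀ i, D (x k p i) = E (x k p i)) : D = E := by
  ext u
  induction u using truncPoly_induction with
  | hC c => simp
  | hadd u v hu hv => simp [hu, hv]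
  | hX u i hu => simp [hu, h]

variable [CharP k p]

/-- The derivation with prescribed values on the generators. -/
def ofCoord (v : Fin n → TruncPoly k p n) : W k p n :=
  Derivation.liftOfSurjective (f := proj k p n) proj_surjective
    (d := MvPolynomial.mkDerivation k fun i =>
      Function.surjInv (proj_surjective (k := k) (p := p)) (v i)) (by
    intro q hq
    have hq : q ∈ Ideal.span (Set.range fun i : Fin n =>
      (MvPolynomial.X i ^ p : MvPolynomial (Fin n) k)) := Ideal.Quotient.eq_zero_iff_mem.1 hq
    have h0 : ∀ i, proj k p n (MvPolynomial.X i ^ p) = 0 := fun i =>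
      Ideal.Quotient.eq_zero_iff_mem.2 (Ideal.subset_span ⟨i, rfl⟩)
    refine (Submodule.span_induction (p := fun q _ => proj k p n q = 0 ∧ proj k p n
      (MvPolynomial.mkDerivation k (fun i =>
        Function.surjInv (proj_surjective (k := k) (p := p)) (v i)) q) = 0)
      ?_ ?_ ?_ ?_ hq).2
    · rintro _ ⟨i, rfl⟩
      refine ⟨h0 i, ?_⟩
      rw [Derivation.leibniz_pow, ← Nat.cast_smul_eq_nsmul k p, CharP.cast_eq_zero, zero_smul,
        map_zero]
    · simp
    · intro q r _ _ hq hr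
      simp [hq, hr]
    · intro a q _ hq
      simp [hq])

@[simp] theorem ofCoord_x (v : Fin n → TruncPoly k p n) (i : Fin n) :
    ofCoord v (x k p i) = v i := by
  rw [← proj_X, ofCoord, Derivation.liftOfSurjective_apply, MvPolynomial.mkDerivation_X,
    Function.surjInv_eq (proj_surjective (k := k) (p := p))]

/-- The partial derivative `∂ᵢ`. -/
def pd (i : Fin n) : W k p n := ofCoord (Pi.single i 1)

theorem pd_x (i j : Fin n) : pd i (x k p j) = if i = j then 1 else 0 := by
  rw [pd, ofCoord_x, Pi.single_apply]
  simp [eq_comm]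

theorem pd_proj (i : Fin n) (q : MvPolynomial (Fin n) k) :
    pd i (proj k p n q) = proj k p n (MvPolynomial.pderiv i q) := by
  classical
  induction q using MvPolynomial.induction_on with
  | C a => rw [← MvPolynomial.algebraMap_eq, AlgHom.commutes]; simp
  | add P Q hP hQ => simp [hP, hQ]
  | mul_X P j hP =>
    simp only [map_mul, Derivation.leibniz, hP, proj_X, pd_x, MvPolynomial.pderiv_X, map_add,
      smul_eq_mul, Pi.single_apply]
    congr 2
    simp [apply_ite (proj k p n), eq_comm]

theorem eq_sum_pd (D : W k p n) : D = ∑ i, D (x k p i) • pd i := by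
  refine derivation_ext fun j => ?_
  rw [derivation_sum_apply]
  simp [pd_x]

theorem apply_eq_sum (D : W k p n) (u : TruncPoly k p n) : D u = ∑ i, D (x k p i) * pd i u := by
  conv_lhs => rw [eq_sum_pd D]
  rw [derivation_sum_apply]
  simp

theorem pd_comm (i j : Fin n) (u : TruncPoly k p n) : pd i (pd j u) = pd j (pd i u) := by
  have h : ⁅(pd i : W k p n), (pd j : W k p n)⁆ = 0 := by
    refine derivation_ext fun l => ?_
    simp only [Derivation.commutator_apply, pd_x, Derivation.coe_zero, Pi.zero_apply]
    split_ifs <;> simp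
  have := Derivation.congr_fun h u
  rwa [Derivation.commutator_apply, Derivation.coe_zero, Pi.zero_apply, sub_eq_zero] at this

theorem cf_pd {a : Fin n →₀ ℕ} (ha : ∀ i, a i < p) (i : Fin n) (u : TruncPoly k p n) :
    cf a (pd i u) = (a i + 1 : ℕ) * cf (a + Finsupp.single i 1) u := by
  obtain ⟨q, rfl⟩ := proj_surjective u
  rw [pd_proj, cf_proj ha, MvPolynomial.coeff_pderiv]
  by_cases h : a i + 1 = p
  · have h1 : ((a i + 1 : ℕ) : k) = 0 := by rw [h, CharP.cast_eq_zero]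
    rw [h1, zero_mul]
    have : (a i : k) + 1 = 0 := by exact_mod_cast h1
    rw [this, mul_zero]
  · rw [cf_proj]
    · push_cast; ring
    · intro j
      have := ha j
      by_cases hj : j = i
      · subst hj; simp; omega
      · simp [Finsupp.single_eq_of_ne hj, this]

/-- The largest exponent `(p - 1, …, p - 1)` of a nonzero monomial. -/
def top (p n : ℕ) : Fin n →₀ ℕ := Finsupp.equivFunOnFinite.symm fun _ => p - 1

@[simp] theorem top_apply {p n : ℕ} (i : Fin n) : top p n i = p - 1 := rfl

theorem top_lt {p n : ℕ} [Fact p.Prime] (i : Fin n) : top p n i < p := by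
  have := (Fact.out : p.Prime).pos
  simp; omega

/-- The integral on `A(n)`: the coefficient of the top monomial. -/
def integral (k : Type*) [Field k] (p n : ℕ) : TruncPoly k p n →ₗ[k] k := cf (top p n)

variable [Fact p.Prime]

theorem integral_pd (i : Fin n) (u : TruncPoly k p n) : integral k p n (pd i u) = 0 := by
  rw [integral, cf_pd top_lt, top_apply, Nat.sub_add_cancel (Fact.out : p.Prime).pos,
    CharP.cast_eq_zero, zero_mul]

/-- The divergence of a vector field. -/
def dvg (D : W k p n) : TruncPoly k p n := ∑ i, pd i (D (x k p i))

theorem integral_pd_mul (i : Fin n) (u v : TruncPoly k p n) :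
    integral k p n (pd i u * v) = - integral k p n (u * pd i v) := by
  have := integral_pd i (u * v)
  rw [Derivation.leibniz, map_add, smul_eq_mul, smul_eq_mul, mul_comm v] at this
  linear_combination this

/-- Integration by parts along a vector field. -/
theorem integral_apply_mul (D : W k p n) (u v : TruncPoly k p n) :
    integral k p n (D u * v) = - integral k p n (u * (D v + dvg D * v)) := by
  rw [apply_eq_sum D u, Finset.sum_mul, map_sum, apply_eq_sum D v, dvg, Finset.sum_mul,
    ← Finset.sum_add_distrib, Finset.mul_sum, map_sum, ← Finset.sum_neg_distrib]
  refine Finset.sum_congr rfl fun i _ => ?_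
  rw [mul_comm (D _), mul_assoc, integral_pd_mul, Derivation.leibniz, smul_eq_mul, smul_eq_mul]
  congr 3
  ring

theorem integral_mono_mul {k : Type*} [Field k] {p n : ℕ} [Fact p.Prime] {b : Fin n →₀ ℕ}
    (hb : ∀ i, b i < p) (u : TruncPoly k p n) :
    integral k p n (mono k p (top p n - b) * u) = cf b u := by
  have hp := (Fact.out : p.Prime).pos
  have hle : top p n - b ≤ top p n := fun i => by simp
  rw [integral, cf_mono_mul top_lt, if_pos hle]
  congr 2
  ext i
  have := hb i
  simp; omega

end Derivations

/-! ### Weights, dilations and the criterion -/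

section Weights

variable {k : Type*} [Field k] {p n : ℕ} (w : Fin n → ℕ)

/-- The weight of the monomial `x^a` when `xᵢ` has weight `wᵢ`. -/
def wt (a : Fin n →₀ ℕ) : ℤ := ∑ i, (a i : ℤ) * w i

theorem wt_add (a b : Fin n →₀ ℕ) : wt w (a + b) = wt w a + wt w b := by
  simp [wt, add_mul, Finset.sum_add_distrib]

theorem wt_single (i : Fin n) (e : ℕ) : wt w (Finsupp.single i e) = e * w i := by
  rw [wt, Finset.sum_eq_single i] <;> simp +contextual [eq_comm]

@[simp] theorem wt_zero : wt w 0 = 0 := by simp [wt]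

theorem wt_nonneg (a : Fin n →₀ ℕ) : 0 ≤ wt w a :=
  Finset.sum_nonneg fun _ _ => by positivity

theorem wt_top : wt w (top p n) = ((p - 1 : ℕ) : ℤ) * ∑ i, (w i : ℤ) := by
  simp [wt, Finset.mul_sum]

theorem wt_le_wt_top {a : Fin n →₀ ℕ} (ha : ∀ i, a i < p) : wt w a ≤ wt w (top p n) := by
  refine Finset.sum_le_sum fun i _ => ?_
  have := ha i
  rw [top_apply]
  have h : (a i : ℤ) ≤ ((p - 1 : ℕ) : ℤ) := by omega
  exact mul_le_mul_of_nonneg_right h (by positivity)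

/-- The elements of `A(n)` all of whose monomials have weight in `I`. -/
def wtSub (k : Type*) [Field k] (p : ℕ) (I : Set ℤ) : Submodule k (TruncPoly k p n) where
  carrier := {u | ∀ a, cf a u ≠ 0 → wt w a ∈ I}
  zero_mem' a ha := absurd (map_zero _) ha
  add_mem' {u v} hu hv a ha := by
    by_cases h : cf a u = 0
    · exact hv a fun h' => ha (by rw [map_add, h, h', add_zero])
    · exact hu a h
  smul_mem' c u hu a ha := hu a fun h => ha (by rw [map_smul, h, smul_zero])

variable {w}

theorem wtSub_mono {I J : Set ℤ} (h : I ⊆ J) : wtSub w k p I ≤ wtSub w k p J :=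
  fun _ hu a ha => h (hu a ha)

theorem cf_eq_zero_of_mem_wtSub {I : Set ℤ} {u : TruncPoly k p n} (hu : u ∈ wtSub w k p I)
    {a : Fin n →₀ ℕ} (ha : wt w a ∉ I) : cf a u = 0 := by
  by_contra h
  exact ha (hu a h)

theorem mul_mem_wtSub {I J K : Set ℤ} (h : ∀ i ∈ I, ∀ j ∈ J, i + j ∈ K) {u v : TruncPoly k p n}
    (hu : u ∈ wtSub w k p I) (hv : v ∈ wtSub w k p J) : u * v ∈ wtSub w k p K := by
  intro a ha
  have hap : ∀ i, a i < p := by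
    by_contra hap
    exact ha (cf_of_not_lt hap _)
  rw [cf_mul hap] at ha
  obtain ⟨b, hb, hb0⟩ := Finset.exists_ne_zero_of_sum_ne_zero ha
  rw [← Finset.HasAntidiagonal.mem_antidiagonal.1 hb, wt_add]
  exact h _ (hu _ (left_ne_zero_of_mul hb0)) _ (hv _ (right_ne_zero_of_mul hb0))

theorem mono_mem_wtSub {I : Set ℤ} {a : Fin n →₀ ℕ} (ha : wt w a ∈ I) :
    mono k p a ∈ wtSub w k p I := by
  intro b hb
  by_cases hbp : ∀ i, b i < p
  · rw [cf_mono hbp] at hb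
    rw [← of_not_not fun h => hb (if_neg h)]
    exact ha
  · exact absurd (cf_of_not_lt hbp _) hb

theorem x_mem_wtSub {I : Set ℤ} {i : Fin n} (hi : (w i : ℤ) ∈ I) : x k p i ∈ wtSub w k p I := by
  rw [← pow_one (x k p i), ← mono_single]
  exact mono_mem_wtSub (by rwa [wt_single, Nat.cast_one, one_mul])

theorem mem_wtSub_Ici_zero (u : TruncPoly k p n) : u ∈ wtSub w k p (Set.Ici 0) :=
  fun a _ => wt_nonneg w a

theorem eq_zero_of_mem_wtSub {I : Set ℤ} (hI : ∀ i ∈ I, wt w (top p n) < i) {u : TruncPoly k p n}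
    (hu : u ∈ wtSub w k p I) : u = 0 := by
  refine eq_zero_of_cf fun a ha => ?_
  by_contra h
  exact absurd (wt_le_wt_top w ha) (not_le.2 (hI _ (hu a h)))

variable [CharP k p]

theorem pd_mem_wtSub {I J : Set ℤ} {i : Fin n} (h : ∀ j ∈ I, j - w i ∈ J) {u : TruncPoly k p n}
    (hu : u ∈ wtSub w k p I) : pd i u ∈ wtSub w k p J := by
  intro a ha
  have hap : ∀ i, a i < p := by
    by_contra hap
    exact ha (cf_of_not_lt hap _)
  rw [cf_pd hap] at ha
  have := h _ (hu _ (right_ne_zero_of_mul ha))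
  rwa [wt_add, wt_single, Nat.cast_one, one_mul, add_sub_cancel_right] at this

/-- The functions of weight at least `d` detect, under the pairing `∫ f u`, the coefficients of `u`
whose weight is at most the top weight minus `d`. -/
theorem cf_eq_zero_of_integral {k : Type*} [Field k] {p n : ℕ} {w : Fin n → ℕ} [Fact p.Prime]
    {d : ℤ} {u : TruncPoly k p n}
    (h : ∀ f ∈ wtSub w k p (Set.Ici d), integral k p n (f * u) = 0) {b : Fin n →₀ ℕ}
    (hb : ∀ i, b i < p) (hd : wt w b ≤ wt w (top p n) - d) : cf b u = 0 := by
  rw [← integral_mono_mul hb]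
  refine h _ (mono_mem_wtSub ?_)
  have e : top p n - b + b = top p n := by
    ext i
    have := hb i
    simp; omega
  have := congrArg (wt w) e
  rw [wt_add] at this
  rw [Set.mem_Ici]
  omega

end Weights

section Filtration

variable {k : Type*} [Field k] {p n : ℕ} (w : Fin n → ℕ)

/-- The derivations that raise weights by at least `d`. -/
def fil (k : Type*) [Field k] (p : ℕ) (d : ℤ) : Submodule k (W k p n) where
  carrier := {D | ∀ l : ℤ, ∀ u ∈ wtSub w k p (Set.Ici l), D u ∈ wtSub w k p (Set.Ici (l + d))}
  zero_mem' _ _ _ := Submodule.zero_mem _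
  add_mem' hD hE l u hu := Submodule.add_mem _ (hD l u hu) (hE l u hu)
  smul_mem' c _ hD l u hu := Submodule.smul_mem _ c (hD l u hu)

/-- The derivations of weight at most `0`, the span of all `x^a ∂ᵢ` with `wt a ≤ wᵢ`. -/
def nonpos (k : Type*) [Field k] (p : ℕ) : Submodule k (W k p n) where
  carrier := {D | ∀ i, D (x k p i) ∈ wtSub w k p (Set.Iic (w i))}
  zero_mem' _ := Submodule.zero_mem _
  add_mem' hD hE i := Submodule.add_mem _ (hD i) (hE i)
  smul_mem' c _ hD i := Submodule.smul_mem _ c (hD i)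

variable {w}

theorem lie_mem_fil {d e : ℤ} {D E : W k p n} (hD : D ∈ fil w k p d) (hE : E ∈ fil w k p e) :
    ⁅D, E⁆ ∈ fil w k p (d + e) := by
  intro l u hu
  rw [Derivation.commutator_apply]
  refine Submodule.sub_mem _ ?_ ?_
  · have := hD _ _ (hE _ _ hu)
    rwa [add_assoc, add_comm e] at this
  · have := hE _ _ (hD _ _ hu)
    rwa [add_assoc] at this

theorem eq_zero_of_mem_fil (hw : ∀ i, 1 ≤ w i) {d : ℤ} (hd : wt w (top p n) ≤ d) {D : W k p n}
    (hD : D ∈ fil w k p d) : D = 0 := by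
  refine derivation_ext fun i => ?_
  refine eq_zero_of_mem_wtSub ?_ (hD (w i) _ (x_mem_wtSub (Set.mem_Ici.2 le_rfl)))
  intro j hj
  have := hw i
  rw [Set.mem_Ici] at hj
  omega

variable [CharP k p]

theorem mem_fil_of_coord {d : ℤ} {D : W k p n}
    (h : ∀ i, D (x k p i) ∈ wtSub w k p (Set.Ici (d + w i))) : D ∈ fil w k p d := by
  intro l u hu
  rw [apply_eq_sum]
  refine Submodule.sum_mem _ fun i _ => mul_mem_wtSub (J := Set.Ici (l - w i)) ?_ (h i)
    (pd_mem_wtSub ?_ hu)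
  · intro a ha b hb
    simp only [Set.mem_Ici] at *
    omega
  · intro a ha
    simp only [Set.mem_Ici] at *
    omega

theorem mem_fil_neg {r : ℕ} (hr : ∀ i, w i ≤ r) (D : W k p n) : D ∈ fil w k p (-r) := by
  refine mem_fil_of_coord fun i => wtSub_mono ?_ (mem_wtSub_Ici_zero _)
  rw [Set.Ici_subset_Ici]
  have := hr i
  omega

instance : FiniteDimensional k (W k p n) := by
  let F : W k p n →ₗ[k] (Fin n → TruncPoly k p n) :=
    { toFun := fun D i => D (x k p i)
      map_add' := fun _ _ => rfl
      map_smul' := fun _ _ => rfl }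
  exact Module.Finite.of_injective F fun D E h => derivation_ext (congrFun h)

end Filtration

section Dilation

section Conjugation

variable {k A : Type*} [Field k] [CommRing A] [Algebra k A]

/-- Transport of derivations along an automorphism of the algebra. -/
def conj (e : A ≃ₐ[k] A) : Derivation k A A ≃ₗ⁅k⁆ Derivation k A A where
  toFun D := Derivation.mk' (e.toLinearMap ∘ₗ D.toLinearMap ∘ₗ e.symm.toLinearMap) (by simp)
  map_add' D E := by ext u; exact map_add e _ _
  map_smul' c D := by ext u; exact map_smul e _ _
  map_lie' {D E} := by
    ext u
    change e (⁅D, E⁆ (e.symm u)) = e (D (e.symm (e (E (e.symm u))))) -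
      e (E (e.symm (e (D (e.symm u)))))
    simp [Derivation.commutator_apply]
  invFun D := Derivation.mk' (e.symm.toLinearMap ∘ₗ D.toLinearMap ∘ₗ e.toLinearMap) (by simp)
  left_inv D := by
    ext u
    change e.symm (e (D (e.symm (e u)))) = D u
    simp
  right_inv D := by
    ext u
    change e (e.symm (D (e (e.symm u)))) = D u
    simp

@[simp] theorem conj_apply (e : A ≃ₐ[k] A) (D : Derivation k A A) (u : A) :
    conj e D u = e (D (e.symm u)) := rfl

theorem conj_symm (e : A ≃ₐ[k] A) : (conj e).symm = conj e.symm := rfl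

end Conjugation

variable {k : Type*} [Field k] {p n : ℕ} (w : Fin n → ℕ)

/-- The endomorphism `xᵢ ↦ t^{wᵢ} xᵢ` of `A(n)`. -/
def dilHom (t : k) : TruncPoly k p n →ₐ[k] TruncPoly k p n :=
  Ideal.Quotient.liftₐ _ (MvPolynomial.aeval fun i => t ^ w i • x k p i) (by
    intro q hq
    have h0 : ∀ i, x k p i ^ p = (0 : TruncPoly k p n) := fun i =>
      Ideal.Quotient.eq_zero_iff_mem.2 (Ideal.subset_span ⟨i, rfl⟩)
    refine Submodule.span_induction (p := fun q _ => MvPolynomial.aeval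
      (fun i => t ^ w i • x k p i) q = 0) ?_ ?_ ?_ ?_ hq
    · rintro _ ⟨i, rfl⟩
      simp [smul_pow, h0]
    · simp
    · intro q r _ _ hq hr
      simp [hq, hr]
    · intro a q _ hq
      simp [hq])

@[simp] theorem dilHom_x (t : k) (i : Fin n) :
    dilHom w t (x k p i) = t ^ w i • x k p i := by
  change dilHom w t (Ideal.Quotient.mk _ (MvPolynomial.X i)) = _
  rw [dilHom]
  exact (Ideal.Quotient.lift_mk _ _ _).trans (MvPolynomial.aeval_X _ _)

theorem algHom_ext {F G : TruncPoly k p n →ₐ[k] TruncPoly k p n}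
    (h : ∀ i, F (x k p i) = G (x k p i)) : F = G := by
  ext u
  induction u using truncPoly_induction with
  | hC c => simp
  | hadd u v hu hv => simp [hu, hv]
  | hX u i hu => simp [hu, h]

/-- The dilation `xᵢ ↦ t^{wᵢ} xᵢ` of `A(n)`. -/
def dil (t : kˣ) : TruncPoly k p n ≃ₐ[k] TruncPoly k p n :=
  AlgEquiv.ofAlgHom (dilHom w (t : k)) (dilHom w ((t⁻¹ : kˣ) : k))
    (algHom_ext fun i => by simp [smul_smul])
    (algHom_ext fun i => by simp [smul_smul])

@[simp] theorem dil_x (t : kˣ) (i : Fin n) : dil w t (x k p i) = (t : k) ^ w i • x k p i :=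
  dilHom_x w _ i

theorem dil_symm (t : kˣ) : (dil w t : TruncPoly k p n ≃ₐ[k] _).symm = dil w t⁻¹ := by
  ext u
  rfl

theorem dil_mono (t : kˣ) (a : Fin n →₀ ℕ) :
    dil w t (mono k p a) = (t : k) ^ (wt w a).toNat • mono k p a := by
  induction a using Finsupp.induction_linear with
  | zero => simp
  | add a b ha hb =>
    rw [mono_add, map_mul, ha, hb, wt_add, Int.toNat_add (wt_nonneg w a) (wt_nonneg w b), pow_add,
      smul_mul_smul_comm]
  | single i e =>
    rw [mono_single, map_pow, dil_x, wt_single, smul_pow, ← pow_mul]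
    congr 2
    rw [mul_comm]
    exact_mod_cast (Int.toNat_natCast _).symm

theorem eq_sum_mono (u : TruncPoly k p n) :
    u = ∑ a : Fin n → Fin p, cf (Finsupp.equivFunOnFinite.symm fun i => (a i : ℕ)) u •
      mono k p (Finsupp.equivFunOnFinite.symm fun i => (a i : ℕ)) := by
  rw [← sub_eq_zero]
  refine eq_zero_of_cf fun b hb => ?_
  rw [map_sub, map_sum, Finset.sum_eq_single fun i => ⟨b i, hb i⟩]
  · rw [map_smul, cf_mono hb, if_pos, smul_eq_mul, mul_one, sub_eq_zero]
    · congr 1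
      congr 1
      ext i
      simp
    · ext i
      simp
  · intro a _ ha
    rw [map_smul, cf_mono hb, if_neg, smul_zero]
    intro h
    exact ha (funext fun i => Fin.ext (DFunLike.congr_fun h i))
  · simp

variable [CharP k p]

/-- A linear functional that vanishes on the derivations of weight `≤ 0` is contracted to `0` by the
dilations. -/
theorem exists_polynomial_conj_dil (ψ : W k p n →ₗ[k] k) (hψ : ∀ D ∈ nonpos w k p, ψ D = 0)
    (D : W k p n) : ∃ q : Polynomial k, q.eval 0 = 0 ∧
      ∀ t : kˣ, ψ (conj (dil w t) D) = q.eval (t : k) := by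
  let M : Submodule k (W k p n) :=
    { carrier := {D | ∃ q : Polynomial k, q.eval 0 = 0 ∧
        ∀ t : kˣ, ψ (conj (dil w t) D) = q.eval (t : k)}
      zero_mem' := ⟨0, by simp, by simp⟩
      add_mem' := by
        rintro D E ⟨q, hq0, hq⟩ ⟨r, hr0, hr⟩
        exact ⟨q + r, by simp [hq0, hr0], fun t => by simp [hq t, hr t]⟩
      smul_mem' := by
        rintro c D ⟨q, hq0, hq⟩
        exact ⟨c • q, by simp [hq0], fun t => by simp [hq t]⟩ }
  change D ∈ M
  rw [eq_sum_pd D]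
  refine Submodule.sum_mem _ fun i _ => ?_
  rw [eq_sum_mono (D (x k p i)), Finset.sum_smul]
  refine Submodule.sum_mem _ fun a _ => ?_
  rw [smul_assoc]
  refine Submodule.smul_mem _ _ ?_
  set b : Fin n →₀ ℕ := Finsupp.equivFunOnFinite.symm fun i => (a i : ℕ)
  by_cases hb : wt w b ≤ w i
  · have hmem : mono k p b • (pd i : W k p n) ∈ nonpos w k p := by
      intro j
      rw [Derivation.smul_apply, pd_x, smul_eq_mul]
      split_ifs with hij
      · subst hij
        rw [mul_one]
        exact mono_mem_wtSub hb
      · rw [mul_zero]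
        exact Submodule.zero_mem _
    have hconj : ∀ t : kˣ, conj (dil w t) (mono k p b • (pd i : W k p n)) ∈ nonpos w k p := by
      intro t j
      rw [conj_apply, dil_symm, dil_x, Derivation.map_smul, map_smul, Derivation.smul_apply, pd_x,
        smul_eq_mul]
      refine Submodule.smul_mem _ _ ?_
      split_ifs with hij
      · subst hij
        rw [mul_one, dil_mono]
        exact Submodule.smul_mem _ _ (mono_mem_wtSub hb)
      · rw [mul_zero, map_zero]
        exact Submodule.zero_mem _
    exact ⟨0, by simp, fun t => by rw [hψ _ (hconj t), Polynomial.eval_zero]⟩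
  · obtain ⟨e, he⟩ : ∃ e : ℕ, (wt w b).toNat = w i + (e + 1) :=
      ⟨(wt w b).toNat - w i - 1, by omega⟩
    refine ⟨Polynomial.C (ψ (mono k p b • pd i)) * Polynomial.X ^ (e + 1), by simp, fun t => ?_⟩
    have hconj : conj (dil w t) (mono k p b • (pd i : W k p n)) =
        (t : k) ^ (e + 1) • mono k p b • (pd i : W k p n) := by
      refine derivation_ext fun j => ?_
      rw [conj_apply, dil_symm, dil_x, Derivation.map_smul, map_smul, Derivation.smul_apply,
        Derivation.smul_apply, Derivation.smul_apply, pd_x, smul_eq_mul]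
      split_ifs with hij
      · subst hij
        rw [mul_one, dil_mono, smul_smul, he, pow_add, ← mul_assoc, ← mul_pow]
        simp
      · simp
    rw [hconj, map_smul, Polynomial.eval_mul, Polynomial.eval_C, Polynomial.eval_pow,
      Polynomial.eval_X, smul_eq_mul, mul_comm]

end Dilation

section Criterion

variable {k : Type*} [Field k]

theorem exists_extension_vanishing_on {V M : Type*} [AddCommGroup V] [Module k V] [AddCommGroup M]
    [Module k M] (f : V →ₗ[k] M) (N : Submodule k M) (χ : Module.Dual k V)
    (hχ : ∀ y, f y ∈ N → χ y = 0) :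
    ∃ ψ : M →ₗ[k] k, (∀ m ∈ N, ψ m = 0) ∧ ∀ y, χ y = ψ (f y) := by
  obtain ⟨ψ, rfl⟩ : χ ∈ LinearMap.range (N.mkQ ∘ₗ f).dualMap := by
    rw [LinearMap.range_dualMap_eq_dualAnnihilator_ker, Submodule.mem_dualAnnihilator]
    intro y hy
    rw [LinearMap.ker_comp, Submodule.ker_mkQ] at hy
    exact hχ y hy
  refine ⟨ψ ∘ₗ N.mkQ, fun m hm => ?_, fun y => rfl⟩
  have h0 : N.mkQ m = 0 := by
    rw [← LinearMap.mem_ker, Submodule.ker_mkQ]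
    exact hm
  rw [LinearMap.comp_apply, h0, map_zero]

variable {p n : ℕ} [Fact p.Prime] [CharP k p]

/-- The `p`-fold commutators with a derivation `D` of weight at least `d` have weight at least
`d p - r`, above all weights of `W(n)`, and likewise for the Leibniz terms of degree at least `p`.
Hence the truncated exponential of `ad D` is an automorphism. -/
theorem isTangent_of_mem_fil {w : Fin n → ℕ} (hw : ∀ i, 1 ≤ w i) {r d : ℕ} (hr : ∀ i, w i ≤ r)
    (hd : wt w (top p n) + 2 * r ≤ d * p) {L : Type*} [LieRing L] [LieAlgebra k L]
    [FiniteDimensional k L]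
    (ι : L →ₗ⁅k⁆ W k p n) (hι : Function.Injective ι) {D : L} (hD : ι D ∈ fil w k p d) :
    IsTangent k D := by
  have h1 : ∀ (a : ℕ) (y : L), ι ((LieAlgebra.ad k L D ^ a) y) ∈ fil w k p (d * a - r) := by
    intro a
    induction a with
    | zero =>
      intro y
      have := mem_fil_neg hr (ι y)
      simpa using this
    | succ a ih =>
      intro y
      rw [pow_succ', Module.End.mul_apply, LieAlgebra.ad_apply, LieHom.map_lie]
      have e : (d * ((a + 1 : ℕ) : ℤ) - r : ℤ) = d + (d * a - r) := by
        push_cast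
        ring
      rw [e]
      exact lie_mem_fil hD (ih y)
  refine isTangent_of_ad_pow p D ?_ fun y z a b hab => hι ?_
  · ext y
    refine hι ?_
    rw [LinearMap.zero_apply, map_zero]
    exact eq_zero_of_mem_fil hw (by have : (0 : ℤ) ≤ r := by positivity
                                    linarith) (h1 p y)
  · rw [LieHom.map_lie, map_zero]
    refine eq_zero_of_mem_fil hw ?_ (lie_mem_fil (h1 a y) (h1 b z))
    have : (d : ℤ) * p ≤ d * (a + b) := mul_le_mul_of_nonneg_left (by exact_mod_cast hab)
      (by positivity)
    linarith

/-- A dilation-stable Lie algebra of derivations of `A(n)` has only constant coadjoint invariants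
if some functional `χ₀` that vanishes on the weights `≤ 0` pairs these weights nondegenerately with
the part of weight at least `d`, where `d` is so large that exponentials exist. -/
theorem coadjointInvariants_eq_bot_of_pairing [IsAlgClosed k] {w : Fin n → ℕ}
    (hw : ∀ i, 1 ≤ w i) {r d : ℕ} (hr : ∀ i, w i ≤ r) (hd : wt w (top p n) + 2 * r ≤ d * p)
    {L : Type*} [LieRing L] [LieAlgebra k L] (ι : L →ₗ⁅k⁆ W k p n) (hι : Function.Injective ι)
    (hdil : ∀ t : kˣ, ∃ g : L ≃ₗ⁅k⁆ L, ∀ y, ι (g y) = conj (dil w t) (ι y))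
    (χ₀ : W k p n →ₗ[k] k) (hχ₀ : ∀ D ∈ nonpos w k p, χ₀ D = 0)
    (hnd : ∀ y : L, ι y ∈ nonpos w k p →
      (∀ D : L, ι D ∈ fil w k p d → χ₀ ⁅ι D, ι y⁆ = 0) → ι y = 0) :
    coadjointInvariants k L = ⊥ := by
  have : Infinite k := IsAlgClosed.instInfinite
  have : FiniteDimensional k L := Module.Finite.of_injective (ι : L →ₗ[k] W k p n) hι
  refine coadjointInvariants_eq_bot p ((nonpos w k p).comap (ι : L →ₗ[k] W k p n))
    ((fil w k p d).comap (ι : L →ₗ[k] W k p n)) (fun D hD => isTangent_of_mem_fil hw hr hd ι hι hD)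
    (χ₀ ∘ₗ (ι : L →ₗ[k] W k p n)) (fun y hy => hχ₀ _ hy) (fun y hy h => hι ?_) ?_
  · rw [map_zero]
    refine hnd y hy fun D hD => ?_
    have := h D hD
    rwa [LinearMap.comp_apply, LieHom.coe_toLinearMap, LieHom.map_lie] at this
  -- Along the dilations, `f χ` is a polynomial in `t` that is constant for `t ≠ 0`.
  · intro f hf χ hχ
    obtain ⟨ψ, h0, hψ⟩ := exists_extension_vanishing_on (ι : L →ₗ[k] W k p n) (nonpos w k p) χ hχ
    choose q hq0 hq using exists_polynomial_conj_dil w ψ h0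
    let b := Module.finBasis k L
    obtain ⟨P, hP⟩ := exists_eval_of_mem_polyFun b hf.1
    have h1 : ∀ t : kˣ, f χ = MvPolynomial.eval (fun i => (q (ι (b i))).eval (t : k)) P := by
      intro t
      obtain ⟨g, hg⟩ := hdil t
      rw [← hf.2 g.symm χ, hP]
      congr 2
      funext i
      rw [← hq, ← hg]
      exact hψ _
    set Q : Polynomial k := MvPolynomial.aeval (fun i => q (ι (b i))) P with hQ
    have h2 : Q = Polynomial.C (f χ) := by
      refine Polynomial.eq_of_infinite_eval_eq _ _
        ((Set.finite_singleton (0 : k)).infinite_compl.mono fun t ht => ?_)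
      rw [Set.mem_ofPred_eq, hQ, eval_aeval_polynomial, Polynomial.eval_C]
      exact (h1 (Units.mk0 t ht)).symm
    have h3 := congrArg (Polynomial.eval 0) h2
    rw [hQ, eval_aeval_polynomial, Polynomial.eval_C] at h3
    rw [← h3, hP 0]
    congr 2
    funext i
    rw [hq0]
    rfl

end Criterion

/-! ### Fields of constant bivectors -/

section AffineFields

variable {k : Type*} [Field k] {p n : ℕ} {w : Fin n → ℕ}

theorem smul_eq_algebraMap_mul (c : k) (u : TruncPoly k p n) :
    c • u = algebraMap k _ c * u := Algebra.smul_def c u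

theorem wt_mono {a b : Fin n →₀ ℕ} (h : a ≤ b) : wt w a ≤ wt w b :=
  Finset.sum_le_sum fun i _ => by
    have := h i
    gcongr

theorem apply_le_wt (hw : ∀ i, 1 ≤ w i) (a : Fin n →₀ ℕ) (i : Fin n) : (a i : ℤ) ≤ wt w a := by
  have h1 : (a i : ℤ) * w i ≤ wt w a :=
    Finset.single_le_sum (f := fun i => (a i : ℤ) * w i) (fun _ _ => by positivity)
      (Finset.mem_univ i)
  have h2 : (1 : ℤ) ≤ w i := by exact_mod_cast hw i
  nlinarith [(Nat.cast_nonneg (a i) : (0 : ℤ) ≤ a i)]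

theorem eq_zero_of_wt_eq_zero (hw : ∀ i, 1 ≤ w i) {a : Fin n →₀ ℕ} (h : wt w a ≤ 0) : a = 0 := by
  ext i
  have := apply_le_wt hw a i
  simp only [Finsupp.coe_zero, Pi.zero_apply]
  omega

theorem eq_algebraMap_of_mem_wtSub [Fact p.Prime] (hw : ∀ i, 1 ≤ w i) {u : TruncPoly k p n}
    (hu : u ∈ wtSub w k p (Set.Iic 0)) : u = algebraMap k _ (cf 0 u) := by
  rw [← sub_eq_zero]
  refine eq_zero_of_cf fun a ha => ?_
  rw [Algebra.algebraMap_eq_smul_one, map_sub, map_smul, ← mono_zero, cf_mono ha]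
  by_cases h : 0 = a
  · subst h
    simp
  · rw [if_neg h, cf_eq_zero_of_mem_wtSub hu, smul_zero, sub_zero]
    exact fun h' => h (eq_zero_of_wt_eq_zero hw h').symm

variable [CharP k p] [Fact p.Prime]

/-- Linear parts of vector fields of weight at most `0` have constant derivatives. -/
theorem pd_apply_x_of_mem_nonpos (hw : ∀ i, 1 ≤ w i) {y : W k p n} (hy : y ∈ nonpos w k p)
    {i j : Fin n} (hij : w j ≤ w i) : pd i (y (x k p j)) =
      algebraMap k _ (cf (Finsupp.single i 1) (y (x k p j))) := by
  rw [eq_algebraMap_of_mem_wtSub hw (pd_mem_wtSub (J := Set.Iic 0) (fun a ha => ?_) (hy j)),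
    cf_pd fun _ => (Fact.out : p.Prime).pos]
  · simp
  · simp only [Set.mem_Iic] at *
    omega

end AffineFields

section Poisson

variable {k : Type*} [Field k] {p n : ℕ} [CharP k p]

/-- The field `∑ᵢⱼ Pᵢⱼ (∂ⱼ f) ∂ᵢ` attached to a constant bivector `P`. -/
def bivectorField (P : Matrix (Fin n) (Fin n) k) (f : TruncPoly k p n) : W k p n :=
  ofCoord fun i => ∑ j, P i j • pd j f

@[simp] theorem bivectorField_x (P : Matrix (Fin n) (Fin n) k) (f : TruncPoly k p n) (i : Fin n) :
    bivectorField P f (x k p i) = ∑ j, P i j • pd j f := ofCoord_x _ _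

/-- The polynomial `H` for which the functional `D ↦ ∫ D(xₑ) H` is in general position. Its
coefficients are those for which `∂ₒ H` is `12` times a sum of monomials: the cubes of all
variables, whose derivatives separate the constant and linear terms of a field, and `xₒ² xₑ²`, which
excludes the linear fields that act on the cubes by a common scalar. -/
def genPoly (k : Type*) [Field k] (p : ℕ) {n : ℕ} (o e : Fin n) : TruncPoly k p n :=
  (3 : k) • x k p o ^ 4 +
    (12 : k) • (x k p o * ∑ i ∈ Finset.univ.erase o, x k p i ^ 3) +
    (4 : k) • (x k p o ^ 3 * x k p e ^ 2)

/-- The polynomial `∂ₒ H`. -/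
def genPolyDeriv (k : Type*) [Field k] (p : ℕ) {n : ℕ} (o e : Fin n) : TruncPoly k p n :=
  (12 : k) • (∑ i, x k p i ^ 3) + (12 : k) • (x k p o ^ 2 * x k p e ^ 2)

theorem pd_pow (i j : Fin n) (m : ℕ) :
    pd i (x k p j ^ (m + 1)) = if i = j then (m + 1 : k) • x k p j ^ m else 0 := by
  rw [Derivation.leibniz_pow, pd_x, ← Nat.cast_smul_eq_nsmul k]
  split_ifs <;> simp

theorem pd_genPoly_self {o e : Fin n} (hoe : o ≠ e) :
    pd o (genPoly k p o e) = genPolyDeriv k p o e := by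
  have h1 : pd o (∑ i ∈ Finset.univ.erase o, x k p i ^ 3) = 0 := by
    rw [map_sum]
    refine Finset.sum_eq_zero fun i hi => ?_
    rw [pd_pow, if_neg (Finset.ne_of_mem_erase hi).symm]
  have h2 : ∑ i, x k p i ^ 3 = x k p o ^ 3 + ∑ i ∈ Finset.univ.erase o, x k p i ^ 3 :=
    (Finset.add_sum_erase _ _ (Finset.mem_univ o)).symm
  rw [genPoly, genPolyDeriv, h2]
  simp only [map_add, Derivation.map_smul, Derivation.leibniz, h1, pd_pow, pd_x, if_true,
    if_neg hoe, smul_eq_mul, mul_one]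
  simp only [smul_eq_algebraMap_mul, map_add, map_natCast, map_one, map_ofNat]
  push_cast
  ring

theorem pd_genPoly {o e j : Fin n} (hj : j ≠ o) :
    pd j (genPoly k p o e) = (36 : k) • (x k p o * x k p j ^ 2) +
      if j = e then (8 : k) • (x k p o ^ 3 * x k p e) else 0 := by
  have h1 : pd j (∑ i ∈ Finset.univ.erase o, x k p i ^ 3) = (3 : k) • x k p j ^ 2 := by
    rw [map_sum, Finset.sum_eq_single j]
    · rw [pd_pow, if_pos rfl]
      norm_num
    · intro i _ hi
      rw [pd_pow, if_neg hi.symm]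
    · intro h
      exact absurd (Finset.mem_erase.2 ⟨hj, Finset.mem_univ _⟩) h
  rw [genPoly]
  simp only [map_add, Derivation.map_smul, Derivation.leibniz, h1, pd_pow, pd_x,
    if_neg hj, smul_zero, zero_add, add_zero, smul_eq_mul, mul_zero]
  split_ifs
  all_goals
    simp only [smul_eq_algebraMap_mul, map_add, map_natCast, map_one, map_ofNat]
    push_cast
    ring

theorem pd_genPolyDeriv {o e : Fin n} (hoe : o ≠ e) (j : Fin n) :
    pd j (genPolyDeriv k p o e) = (36 : k) • x k p j ^ 2 +
      (if j = o then (24 : k) • (x k p o * x k p e ^ 2) else 0) +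
      if j = e then (24 : k) • (x k p o ^ 2 * x k p e) else 0 := by
  have h1 : pd j (∑ i, x k p i ^ 3) = (3 : k) • x k p j ^ 2 := by
    rw [map_sum, Finset.sum_eq_single j]
    · rw [pd_pow, if_pos rfl]
      norm_num
    · intro i _ hi
      rw [pd_pow, if_neg hi.symm]
    · simp
  rw [genPolyDeriv]
  simp only [map_add, Derivation.map_smul, Derivation.leibniz, h1, pd_pow, smul_eq_mul]
  split_ifs with h2 h3
  · exact absurd (h2.symm.trans h3) hoe.symm
  all_goals
    simp only [smul_eq_algebraMap_mul, map_add, map_natCast, map_one, map_ofNat]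
    push_cast
    ring

variable [Fact p.Prime]

/-- The functional `D ↦ ∫ D(xₑ) H`. -/
def evalFunctional (e : Fin n) (H : TruncPoly k p n) : W k p n →ₗ[k] k where
  toFun D := integral k p n (D (x k p e) * H)
  map_add' D E := by rw [Derivation.add_apply, add_mul, map_add]
  map_smul' c D := by rw [Derivation.smul_apply, smul_mul_assoc, map_smul]; rfl

theorem evalFunctional_lie (e : Fin n) (H : TruncPoly k p n) (D y : W k p n) :
    evalFunctional e H ⁅D, y⁆ = integral k p n
      (D (y (x k p e)) * H + D (x k p e) * (y H + dvg y * H)) := by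
  change integral k p n (⁅D, y⁆ (x k p e) * H) = _
  rw [Derivation.commutator_apply, sub_mul, map_sub, integral_apply_mul y, map_add, sub_neg_eq_add]

/-- The polynomial `Q` with `χ ⁅D_P f, y⁆ = - ∫ f Q` for the functional `χ = ∫ D(xₑ) H`. -/
theorem evalFunctional_lie_bivectorField {o e : Fin n} (hoe : o ≠ e)
    (P : Matrix (Fin n) (Fin n) k) (hP : ∀ j, P e j = if j = o then 1 else 0)
    (y : W k p n) (hy : y ∈ nonpos (fun _ => 1) k p) :
    ∃ d : k, ∀ f, evalFunctional e (genPoly k p o e) ⁅bivectorField P f, y⁆ =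
      - integral k p n (f * (
        ∑ j, (cf (Finsupp.single o 1) (y (x k p j)) +
            ∑ i, cf (Finsupp.single i 1) (y (x k p e)) * P i j) • pd j (genPoly k p o e) +
          ∑ l, y (x k p l) * pd l (genPolyDeriv k p o e) + d • genPolyDeriv k p o e)) := by
  have hpd : ∀ i j, pd i (y (x k p j)) =
      algebraMap k _ (cf (Finsupp.single i 1) (y (x k p j))) :=
    fun i j => pd_apply_x_of_mem_nonpos (fun _ => le_rfl) hy le_rfl
  refine ⟨∑ i, cf (Finsupp.single i 1) (y (x k p i)), fun f => ?_⟩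
  set H := genPoly k p o e
  have hd : dvg y = algebraMap k _ (∑ i, cf (Finsupp.single i 1) (y (x k p i))) := by
    rw [dvg, map_sum]
    exact Finset.sum_congr rfl fun i _ => hpd i i
  set d := ∑ i, cf (Finsupp.single i 1) (y (x k p i))
  have h1 : bivectorField P f (x k p e) = pd o f := by
    rw [bivectorField_x, Finset.sum_eq_single o] <;> simp +contextual [hP]
  have h2 : bivectorField P f (y (x k p e)) * H =
      ∑ j, pd j f * ((∑ i, cf (Finsupp.single i 1) (y (x k p e)) * P i j) • H) := by
    rw [apply_eq_sum]
    simp only [hpd, bivectorField_x, Finset.sum_mul, Finset.sum_smul, Finset.mul_sum]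
    rw [Finset.sum_comm]
    refine Finset.sum_congr rfl fun j _ => Finset.sum_congr rfl fun i _ => ?_
    simp only [smul_eq_algebraMap_mul, map_mul]
    ring
  have h3 : pd o (y H + dvg y * H) = ∑ j, cf (Finsupp.single o 1) (y (x k p j)) • pd j H +
      ∑ l, y (x k p l) * pd l (genPolyDeriv k p o e) + d • genPolyDeriv k p o e := by
    rw [hd, apply_eq_sum y H, map_add, map_sum, Derivation.leibniz, Derivation.map_algebraMap,
      smul_zero, add_zero, pd_genPoly_self hoe, algebraMap_smul, ← Finset.sum_add_distrib]
    congr 1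
    refine Finset.sum_congr rfl fun j _ => ?_
    rw [Derivation.leibniz, hpd, pd_comm, pd_genPoly_self hoe, smul_eq_mul, smul_eq_mul, add_comm,
      mul_comm (pd j H), smul_eq_algebraMap_mul]
  rw [evalFunctional_lie, map_add, h1, h2, integral_pd_mul, h3, map_sum]
  simp only [integral_pd_mul, Derivation.map_smul]
  rw [Finset.sum_neg_distrib, ← neg_add, ← map_sum, ← map_add, ← Finset.mul_sum, ← mul_add]
  congr 3
  simp only [add_smul, Finset.sum_add_distrib]
  ring

end Poisson

/-! ### The pairing with bivector fields is nondegenerate -/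

section PoissonNondegenerate

variable {k : Type*} [Field k] {p n : ℕ} [CharP k p]

theorem cf_genPolyDeriv {k : Type*} [Field k] {p n : ℕ} {b : Fin n →₀ ℕ} (hb : ∀ i, b i < p)
    (o e : Fin n) :
    cf b (genPolyDeriv k p o e) = 12 * (∑ i, if Finsupp.single i 3 = b then 1 else 0) +
      12 * if Finsupp.single o 2 + Finsupp.single e 2 = b then 1 else 0 := by
  simp only [genPolyDeriv, ← mono_single, ← mono_add, map_add, map_smul, map_sum, cf_mono hb,
    smul_eq_mul]

theorem cf_pd_genPoly {b : Fin n →₀ ℕ} (hb : ∀ i, b i < p) {o e j : Fin n} (hj : j ≠ o) :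
    cf b (pd j (genPoly k p o e)) =
      36 * (if Finsupp.single o 1 + Finsupp.single j 2 = b then 1 else 0) +
      if j = e then 8 * (if Finsupp.single o 3 + Finsupp.single e 1 = b then 1 else 0) else 0 := by
  rw [pd_genPoly hj, ← pow_one (x k p o), ← pow_one (x k p e), ← pow_mul]
  simp only [← mono_single, ← mono_add, map_add, map_smul, cf_mono hb, smul_eq_mul,
    apply_ite (cf b), map_zero, one_mul]

theorem cf_mul_pd_genPolyDeriv {b : Fin n →₀ ℕ} (hb : ∀ i, b i < p) {o e : Fin n} (hoe : o ≠ e)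
    (l : Fin n) (u : TruncPoly k p n) :
    cf b (u * pd l (genPolyDeriv k p o e)) =
      36 * (if Finsupp.single l 2 ≤ b then cf (b - Finsupp.single l 2) u else 0) +
      (if l = o then 24 * (if Finsupp.single o 1 + Finsupp.single e 2 ≤ b then
        cf (b - (Finsupp.single o 1 + Finsupp.single e 2)) u else 0) else 0) +
      if l = e then 24 * (if Finsupp.single o 2 + Finsupp.single e 1 ≤ b then
        cf (b - (Finsupp.single o 2 + Finsupp.single e 1)) u else 0) else 0 := by
  rw [pd_genPolyDeriv hoe]
  have e1 : x k p o * x k p e ^ 2 = mono k p (Finsupp.single o 1 + Finsupp.single e 2) := by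
    rw [mono_add, mono_single, mono_single, pow_one]
  have e2 : x k p o ^ 2 * x k p e = mono k p (Finsupp.single o 2 + Finsupp.single e 1) := by
    rw [mono_add, mono_single, mono_single, pow_one]
  rw [e1, e2, ← mono_single, mul_comm u]
  simp only [add_mul, ite_mul, zero_mul, smul_mul_assoc, map_add, map_smul, apply_ite (cf b),
    map_zero, cf_mono_mul hb, smul_eq_mul]

variable [Fact p.Prime]

theorem cast_ne_zero_of_lt {k : Type*} [Field k] {p : ℕ} [CharP k p] {m : ℕ} (h0 : m ≠ 0)
    (hm : m < p) : (m : k) ≠ 0 := by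
  rw [Ne, CharP.cast_eq_zero_iff k p]
  exact fun h => absurd (Nat.le_of_dvd (Nat.pos_of_ne_zero h0) h) (by omega)

theorem cf_eq_zero_of_integral_pd_pd {w : Fin n → ℕ} {d : ℤ} {Q : TruncPoly k p n} (l : Fin n)
    (h : ∀ f ∈ wtSub w k p (Set.Ici d), integral k p n (pd l (pd l f) * Q) = 0)
    {b : Fin n →₀ ℕ} (hb : ∀ i, b i < p) (hl : 2 ≤ b l)
    (hd : wt w b ≤ wt w (top p n) - d + 2 * w l) : cf b Q = 0 := by
  obtain ⟨c, rfl⟩ : ∃ c, b = c + Finsupp.single l 1 + Finsupp.single l 1 := by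
    refine ⟨b - Finsupp.single l 2, ?_⟩
    ext i
    by_cases hi : i = l
    · subst hi
      simp
      omega
    · simp [Finsupp.single_eq_of_ne hi]
  have hlt : ∀ i, (c + Finsupp.single l 1 : Fin n →₀ ℕ) i < p := fun i =>
    lt_of_le_of_lt (Nat.le_add_right _ _) (hb i)
  have hlt' : ∀ i, c i < p := fun i => lt_of_le_of_lt (Nat.le_add_right _ _) (hlt i)
  have h1 : cf c (pd l (pd l Q)) = 0 := by
    refine cf_eq_zero_of_integral (w := w) (d := d) (fun f hf => ?_) hlt' ?_
    · rw [← h f hf, integral_pd_mul, integral_pd_mul, neg_neg]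
    · simp only [wt_add, wt_single] at hd
      push_cast at hd
      linarith
  have hbl := hb l
  rw [cf_pd hlt', cf_pd hlt] at h1
  simp only [Finsupp.add_apply, Finsupp.single_eq_same] at h1 hbl
  simpa [cast_ne_zero_of_lt (k := k) (p := p) (m := c l + 1) (by omega) (by omega),
    cast_ne_zero_of_lt (k := k) (p := p) (m := c l + 1 + 1) (by omega) (by omega),
    -Nat.cast_add] using h1

theorem eq_zero_of_linear_coeffs {k : Type*} [Field k] {p n : ℕ} {u : TruncPoly k p n}
    (hu : u ∈ wtSub (fun _ => 1) k p (Set.Iic 1))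
    (h0 : cf 0 u = 0) (h1 : ∀ i, cf (Finsupp.single i 1) u = 0) : u = 0 := by
  refine eq_zero_of_cf fun a _ => ?_
  by_contra ha
  have hwt := hu a ha
  by_cases hz : a = 0
  · exact ha (hz ▸ h0)
  obtain ⟨i, hi⟩ : ∃ i, a i ≠ 0 := by
    by_contra hcon
    push Not at hcon
    exact hz (Finsupp.ext hcon)
  have e : a = (a - Finsupp.single i 1) + Finsupp.single i 1 := by
    rw [tsub_add_cancel_of_le]
    rw [Finsupp.single_le_iff]
    omega
  have h2 : a - Finsupp.single i 1 = 0 := by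
    refine eq_zero_of_wt_eq_zero (w := fun _ => 1) (fun _ => le_rfl) ?_
    rw [e, wt_add, wt_single, Set.mem_Iic] at hwt
    simpa using hwt
  rw [h2, zero_add] at e
  exact ha (e ▸ h1 i)

set_option maxHeartbeats 1000000 in
/-- The functional `D ↦ ∫ D(xₑ) H` pairs the fields of weight at most `0` nondegenerately with the
fields `D_P(∂ₗ² f)`. The coefficients that the pairing controls are those at monomials divisible by
some `xₗ²`. -/
theorem eq_zero_of_bivector_pairing (hp : 5 ≤ p) (hn : 2 ≤ n) {o e : Fin n} (hoe : o ≠ e)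
    (P : Matrix (Fin n) (Fin n) k) (hP : ∀ j, P e j = if j = o then 1 else 0) (hPo : P o e = -1)
    {y : W k p n} (hy : y ∈ nonpos (fun _ => 1) k p)
    (h : ∀ l, ∀ f ∈ wtSub (fun _ => 1) k p (Set.Ici ((n : ℤ) + 4)),
      evalFunctional e (genPoly k p o e) ⁅bivectorField P (pd l (pd l f)), y⁆ = 0) : y = 0 := by
  obtain ⟨d, hd⟩ := evalFunctional_lie_bivectorField hoe P hP y hy
  set B : Fin n → Fin n → k := fun i j => cf (Finsupp.single i 1) (y (x k p j)) with hB
  set γ : Fin n → k := fun j => B o j + ∑ i, B i e * P i j with hγ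
  have hvalid : ∀ b : Fin n →₀ ℕ, wt (fun _ => 1) b ≤ 4 → ∀ i, b i < p := fun b hb i => by
    have := apply_le_wt (w := fun _ => 1) (fun _ => le_rfl) b i
    omega
  have hnp : (n : ℤ) * 5 ≤ n * p := by
    exact_mod_cast Nat.mul_le_mul_left n hp
  have key : ∀ b : Fin n →₀ ℕ, wt (fun _ => 1) b ≤ 4 → (∃ l, 2 ≤ b l) →
      (∑ j, γ j * cf b (pd j (genPoly k p o e))) +
        (∑ l, cf b (y (x k p l) * pd l (genPolyDeriv k p o e))) +
        d * cf b (genPolyDeriv k p o e) = 0 := by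
    rintro b hb ⟨l, hl⟩
    have := cf_eq_zero_of_integral_pd_pd (w := fun _ => 1) (d := (n : ℤ) + 4) l
      (fun f hf => neg_eq_zero.1 ((hd _).symm.trans (h l f hf))) (hvalid b hb) hl (by
        rw [wt_top]
        simp only [Nat.cast_one, Finset.sum_const, Finset.card_univ, Fintype.card_fin,
          nsmul_eq_mul, mul_one]
        push_cast [Nat.cast_sub (show 1 ≤ p by omega)]
        have : (2 : ℤ) ≤ n := by exact_mod_cast hn
        linarith)
    simpa only [map_add, map_sum, map_smul, smul_eq_mul] using this
  have h2 : (2 : k) ≠ 0 := by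
    exact_mod_cast cast_ne_zero_of_lt (k := k) (p := p) (m := 2) (by omega) (by omega)
  have h3 : (3 : k) ≠ 0 := by
    exact_mod_cast cast_ne_zero_of_lt (k := k) (p := p) (m := 3) (by omega) (by omega)
  have h12 : (12 : k) ≠ 0 := by
    have : (12 : k) = 2 * 2 * 3 := by norm_num
    rw [this]
    exact mul_ne_zero (mul_ne_zero h2 h2) h3
  have h36 : (36 : k) ≠ 0 := by
    have : (36 : k) = 12 * 3 := by norm_num
    rw [this]
    exact mul_ne_zero h12 h3
  have hlt : ∀ a b : Fin n →₀ ℕ, wt (fun _ => 1) b < wt (fun _ => 1) a → ¬ a ≤ b :=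
    fun a b hab hle => absurd (wt_mono hle) (not_le.2 hab)
  have hne : ∀ a b : Fin n →₀ ℕ, wt (fun _ => 1) a ≠ wt (fun _ => 1) b → a ≠ b :=
    fun a b hab h => hab (by rw [h])
  -- The coefficients of `x_j²` give the constant terms.
  have hC : ∀ j, cf 0 (y (x k p j)) = 0 := by
    intro j
    have hb : wt (fun _ => 1) (Finsupp.single j 2) = 2 := by simp [wt_single]
    have hv := hvalid (Finsupp.single j 2) (by omega)
    have hk := key (Finsupp.single j 2) (by omega) ⟨j, by simp⟩
    have hg : cf (Finsupp.single j 2) (genPolyDeriv k p o e) = 0 := by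
      rw [cf_genPolyDeriv hv, if_neg (hne _ _ (by simp [wt_add, wt_single])),
        Finset.sum_eq_zero fun i _ => if_neg (hne _ _ (by simp [wt_single]))]
      simp
    have hH : ∀ m, cf (Finsupp.single j 2) (pd m (genPoly k p o e)) = 0 := by
      intro m
      by_cases hm : m = o
      · rw [hm, pd_genPoly_self hoe, hg]
      · rw [cf_pd_genPoly hv hm, if_neg (hne _ _ (by simp [wt_add, wt_single])),
          if_neg (hne _ _ (by simp [wt_add, wt_single]))]
        simp
    rw [hg, Finset.sum_eq_zero fun m _ => by rw [hH m, mul_zero], Finset.sum_eq_single j] at hk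
    · rw [cf_mul_pd_genPolyDeriv hv hoe, if_pos le_rfl, tsub_self,
        if_neg (hlt _ _ (by simp [wt_add, wt_single])),
        if_neg (hlt _ _ (by simp [wt_add, wt_single]))] at hk
      simpa [h36] using hk
    · intro l _ hl
      rw [cf_mul_pd_genPolyDeriv hv hoe, if_neg fun h => ?_,
        if_neg (hlt _ _ (by simp [wt_add, wt_single])),
        if_neg (hlt _ _ (by simp [wt_add, wt_single]))]
      · simp
      · simpa [Finsupp.single_eq_of_ne hl] using h l
    · simp
  -- The coefficients of `x_j² x_l` give the off-diagonal linear terms.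
  have hcub : ∀ j l, l ≠ j → (if l = o then γ j else 0) + B l j = 0 := by
    intro j l hlj
    set b : Fin n →₀ ℕ := Finsupp.single j 2 + Finsupp.single l 1 with hbdef
    have hb : wt (fun _ => 1) b = 3 := by simp [hbdef, wt_add, wt_single]
    have hbl : b l = 1 := by simp [hbdef, Finsupp.single_eq_of_ne hlj]
    have hbj : b j = 2 := by simp [hbdef, Finsupp.single_eq_of_ne hlj.symm]
    have hbi : ∀ i, i ≠ j → i ≠ l → b i = 0 := fun i hij hil => by
      simp [hbdef, Finsupp.single_eq_of_ne hij, Finsupp.single_eq_of_ne hil]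
    have hv := hvalid b (by omega)
    have hk := key b (by omega) ⟨j, hbj.ge⟩
    have hg : cf b (genPolyDeriv k p o e) = 0 := by
      rw [cf_genPolyDeriv hv, if_neg (hne _ _ (by simp [hb, wt_add, wt_single])),
        Finset.sum_eq_zero fun i _ => if_neg fun h => ?_]
      · simp
      · have h1 := DFunLike.congr_fun h l
        rw [hbl, Finsupp.single_apply] at h1
        split_ifs at h1
        omega
    have hH : ∀ m, cf b (pd m (genPoly k p o e)) = if m = j ∧ l = o then 36 else 0 := by
      intro m
      by_cases hm : m = o
      · rw [hm, pd_genPoly_self hoe, hg, if_neg]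
        rintro ⟨rfl, rfl⟩
        exact hlj rfl
      · rw [cf_pd_genPoly hv hm, if_neg (hne (Finsupp.single o 3 + Finsupp.single e 1) _
          (by simp [hb, wt_add, wt_single]))]
        have hiff : Finsupp.single o 1 + Finsupp.single m 2 = b ↔ m = j ∧ l = o := by
          constructor
          · intro h
            have h1 := DFunLike.congr_fun h m
            have h2 := DFunLike.congr_fun h o
            simp only [Finsupp.add_apply, Finsupp.single_eq_same, Finsupp.single_eq_of_ne hm,
              Finsupp.single_eq_of_ne (Ne.symm hm)] at h1 h2
            constructor
            · by_contra hmj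
              by_cases hml : m = l
              · rw [hml, hbl] at h1
                omega
              · rw [hbi m hmj hml] at h1
                omega
            · by_contra hlo
              by_cases hoj : o = j
              · rw [hoj, hbj] at h2
                omega
              · rw [hbi o hoj (Ne.symm hlo)] at h2
                omega
          · rintro ⟨rfl, rfl⟩
            rw [hbdef, add_comm]
        simp [hiff]
    have hT : ∀ m, cf b (y (x k p m) * pd m (genPolyDeriv k p o e)) =
        if m = j then 36 * B l j else 0 := by
      intro m
      have h0 : ∀ (a : Fin n →₀ ℕ) (i : Fin n), wt (fun _ => 1) a = 3 →
          (if a ≤ b then cf (b - a) (y (x k p i)) else 0) = 0 := by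
        intro a i ha
        split_ifs with hab
        · have h1 : wt (fun _ => 1) (b - a) ≤ 0 := by
            have := congrArg (wt (fun _ => 1)) (tsub_add_cancel_of_le hab)
            rw [wt_add] at this
            omega
          rw [eq_zero_of_wt_eq_zero (fun _ => le_rfl) h1, hC]
        · rfl
      rw [cf_mul_pd_genPolyDeriv hv hoe,
        h0 (Finsupp.single o 1 + Finsupp.single e 2) _ (by simp [wt_add, wt_single]),
        h0 (Finsupp.single o 2 + Finsupp.single e 1) _ (by simp [wt_add, wt_single])]
      by_cases hm : m = j
      · subst hm
        rw [if_pos le_self_add, if_pos rfl, hbdef, add_tsub_cancel_left]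
        simp [hB]
      · rw [if_neg hm, if_neg fun h => ?_]
        · simp
        · have h1 := h m
          rw [Finsupp.single_eq_same] at h1
          by_cases hml : m = l
          · rw [hml, hbl] at h1
            omega
          · rw [hbi m hm hml] at h1
            omega
    rw [hg, Finset.sum_congr rfl fun m _ => by rw [hH m],
      Finset.sum_congr rfl fun m _ => hT m] at hk
    have hs : ∑ m, γ m * (if m = j ∧ l = o then (36 : k) else 0) =
        36 * if l = o then γ j else 0 := by
      rw [Finset.sum_eq_single j] <;> simp +contextual [mul_comm]
    rw [hs, Finset.sum_ite_eq' Finset.univ j, if_pos (Finset.mem_univ _), mul_zero, add_zero,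
      ← mul_add] at hk
    exact (mul_eq_zero.1 hk).resolve_left h36
  have hB1 : ∀ j l, l ≠ j → l ≠ o → B l j = 0 := by
    intro j l hlj hlo
    simpa [hlo] using hcub j l hlj
  have hγ1 : ∀ j, j ≠ o → γ j = B o j + B o e * P o j := by
    intro j hj
    simp only [hγ]
    congr 1
    refine Finset.sum_eq_single o (fun i _ hi => ?_) (by simp)
    by_cases hie : i = e
    · rw [hie, hP, if_neg hj, mul_zero]
    · rw [hB1 e i hie hi, zero_mul]
  have hBoe : B o e = 0 := by
    have h1 := hcub e o hoe
    rw [if_pos rfl, hγ1 e hoe.symm, hPo] at h1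
    linear_combination h1
  have hBo : ∀ j, j ≠ o → B o j = 0 := by
    intro j hj
    have h1 := hcub j o hj.symm
    rw [if_pos rfl, hγ1 j hj, hBoe, zero_mul, add_zero, ← two_mul] at h1
    exact (mul_eq_zero.1 h1).resolve_left h2
  have hBoff : ∀ i j, i ≠ j → B i j = 0 := by
    intro i j hij
    by_cases hi : i = o
    · subst hi
      exact hBo j hij.symm
    · exact hB1 j i hij hi
  have hγ0 : ∀ j, j ≠ o → γ j = 0 := by
    intro j hj
    rw [hγ1 j hj, hBo j hj, hBoe]
    ring
  have hγo : γ o = B o o + B e e := by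
    simp only [hγ]
    rw [Finset.sum_eq_single e]
    · rw [hP, if_pos rfl, mul_one]
    · intro i _ hi
      rw [hBoff i e hi, zero_mul]
    · simp
  have hsum : ∀ b, ∑ j, γ j * cf b (pd j (genPoly k p o e)) =
      γ o * cf b (genPolyDeriv k p o e) := by
    intro b
    rw [Finset.sum_eq_single o]
    · rw [pd_genPoly_self hoe]
    · intro j _ hj
      rw [hγ0 j hj, zero_mul]
    · simp
  -- The coefficients of `x_i³` and `x_o² x_e²` give the diagonal linear terms.
  have hdiag : ∀ i, γ o + d + 3 * B i i = 0 := by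
    intro i
    have hb : wt (fun _ => 1) (Finsupp.single i 3) = 3 := by simp [wt_single]
    have hv := hvalid (Finsupp.single i 3) (by omega)
    have hk := key (Finsupp.single i 3) (by omega) ⟨i, by simp⟩
    have hg : cf (Finsupp.single i 3) (genPolyDeriv k p o e) = 12 := by
      rw [cf_genPolyDeriv hv, if_neg (hne _ _ (by simp [wt_add, wt_single])),
        Finset.sum_eq_single i]
      · simp
      · intro j _ hj
        rw [if_neg]
        intro h
        have := DFunLike.congr_fun h j
        simp [Finsupp.single_eq_of_ne hj] at this
      · simp
    have hT : ∀ m, cf (Finsupp.single i 3) (y (x k p m) * pd m (genPolyDeriv k p o e)) =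
        if m = i then 36 * B i i else 0 := by
      intro m
      rw [cf_mul_pd_genPolyDeriv hv hoe,
        if_neg (c := Finsupp.single o 1 + Finsupp.single e 2 ≤ _) fun h => ?_,
        if_neg (c := Finsupp.single o 2 + Finsupp.single e 1 ≤ _) fun h => ?_]
      · by_cases hm : m = i
        · subst hm
          have e1 : (Finsupp.single m 3 : Fin n →₀ ℕ) =
              Finsupp.single m 2 + Finsupp.single m 1 := by
            rw [← Finsupp.single_add]
          rw [e1, if_pos le_self_add, add_tsub_cancel_left]
          simp [hB]
        · rw [if_neg hm, if_neg fun h => ?_]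
          · simp
          · simpa [Finsupp.single_eq_of_ne hm] using h m
      all_goals
        have h1 := h o
        have h2 := h e
        simp only [Finsupp.add_apply, Finsupp.single_apply] at h1 h2
        grind
    rw [hsum, hg, Finset.sum_congr rfl fun m _ => hT m, Finset.sum_ite_eq' Finset.univ i,
      if_pos (Finset.mem_univ _)] at hk
    have : 12 * (γ o + d + 3 * B i i) = 0 := by linear_combination hk
    exact (mul_eq_zero.1 this).resolve_left h12
  have hquart : γ o + d + 2 * B o o + 2 * B e e = 0 := by
    set b : Fin n →₀ ℕ := Finsupp.single o 2 + Finsupp.single e 2 with hbdef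
    have hb : wt (fun _ => 1) b = 4 := by simp [hbdef, wt_add, wt_single]
    have hbo : b o = 2 := by simp [hbdef, Finsupp.single_eq_of_ne hoe]
    have hbe : b e = 2 := by simp [hbdef, Finsupp.single_eq_of_ne hoe.symm]
    have hv := hvalid b (by omega)
    have hk := key b (by omega) ⟨o, hbo.ge⟩
    have hg : cf b (genPolyDeriv k p o e) = 12 := by
      rw [cf_genPolyDeriv hv, if_pos rfl, Finset.sum_eq_zero fun i _ => if_neg
        (hne _ _ (by simp [hb, wt_single]))]
      simp
    have hz : ∀ m, (if Finsupp.single m 2 ≤ b then cf (b - Finsupp.single m 2) (y (x k p m))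
        else 0) = 0 := by
      intro m
      split_ifs with hm
      · refine cf_eq_zero_of_mem_wtSub (hy m) ?_
        have := congrArg (wt (fun _ => 1)) (tsub_add_cancel_of_le hm)
        rw [wt_add, wt_single, hb] at this
        rw [Set.mem_Iic]
        push_cast at this ⊢
        omega
      · rfl
    have ho : b = (Finsupp.single o 1 + Finsupp.single e 2) + Finsupp.single o 1 := by
      have : (Finsupp.single o 2 : Fin n →₀ ℕ) = Finsupp.single o 1 + Finsupp.single o 1 := by
        rw [← Finsupp.single_add]
      rw [hbdef, this]
      abel
    have he : b = (Finsupp.single o 2 + Finsupp.single e 1) + Finsupp.single e 1 := by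
      have : (Finsupp.single e 2 : Fin n →₀ ℕ) = Finsupp.single e 1 + Finsupp.single e 1 := by
        rw [← Finsupp.single_add]
      rw [hbdef, this]
      abel
    have ho' : Finsupp.single o 1 + Finsupp.single e 2 ≤ b := by
      rw [ho]
      exact le_self_add
    have he' : Finsupp.single o 2 + Finsupp.single e 1 ≤ b := by
      rw [he]
      exact le_self_add
    have hT : ∀ m, cf b (y (x k p m) * pd m (genPolyDeriv k p o e)) =
        (if m = o then 24 * B o o else 0) + if m = e then 24 * B e e else 0 := by
      intro m
      rw [cf_mul_pd_genPolyDeriv hv hoe, hz, mul_zero, zero_add, if_pos ho', if_pos he']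
      congr 1
      · split_ifs with hm
        · rw [hm, ho, add_tsub_cancel_left]
        · rfl
      · split_ifs with hm
        · rw [hm, he, add_tsub_cancel_left]
        · rfl
    rw [hsum, hg, Finset.sum_congr rfl fun m _ => hT m, Finset.sum_add_distrib,
      Finset.sum_ite_eq' Finset.univ o, Finset.sum_ite_eq' Finset.univ e,
      if_pos (Finset.mem_univ _), if_pos (Finset.mem_univ _)] at hk
    have : 12 * (γ o + d + 2 * B o o + 2 * B e e) = 0 := by linear_combination hk
    exact (mul_eq_zero.1 this).resolve_left h12
  have hBoo : B o o = 0 := by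
    have h1 : 3 * (B o o - B e e) = 0 := by linear_combination hdiag o - hdiag e
    have h4 := (mul_eq_zero.1 h1).resolve_left h3
    linear_combination hquart - hdiag o + 2 * h4
  have hBii : ∀ i, B i i = 0 := by
    intro i
    have h1 : 3 * B i i = 0 := by linear_combination hdiag i - hdiag o + 3 * hBoo
    exact (mul_eq_zero.1 h1).resolve_left h3
  refine derivation_ext fun j => eq_zero_of_linear_coeffs (hy j) (hC j) fun i => ?_
  by_cases hij : i = j
  · subst hij
    exact hBii i
  · exact hBoff i j hij

end PoissonNondegenerate

/-! ### Nondegeneracy in the contact case: coefficients -/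

section ContactCoefficients

variable {k : Type*} [Field k] {p n : ℕ}

theorem cf_mono_mul_of_lt {a b : Fin n →₀ ℕ} (i : Fin n) (h : b i < a i) (u : TruncPoly k p n) :
    cf b (mono k p a * u) = 0 := by
  by_cases hb : ∀ i, b i < p
  · rw [cf_mono_mul hb, if_neg fun hab => absurd (hab i) (by omega)]
  · exact cf_of_not_lt hb _

theorem cf_add_mono_mul {a b : Fin n →₀ ℕ} (hb : ∀ i, (a + b) i < p) (u : TruncPoly k p n) :
    cf (a + b) (mono k p a * u) = cf b u := by
  rw [cf_mono_mul hb, if_pos le_self_add, add_tsub_cancel_left]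

theorem cf_mono_mul_of_wt_lt {w : Fin n → ℕ} {a b : Fin n →₀ ℕ} {r : ℤ} {u : TruncPoly k p n}
    (hu : u ∈ wtSub w k p (Set.Iic r)) (h : r < wt w b - wt w a) :
    cf b (mono k p a * u) = 0 := by
  by_contra h0
  have := mul_mem_wtSub (K := Set.Iic (wt w a + r)) (fun i hi j hj => ?_)
    (mono_mem_wtSub (k := k) (p := p) (Set.mem_Iic.2 (le_refl (wt w a)))) hu b h0
  · rw [Set.mem_Iic] at this
    omega
  · simp only [Set.mem_Iic] at *
    omega

theorem cf_mono_mul_of_coord {w : Fin n → ℕ} {a b : Fin n →₀ ℕ} {r : ℤ} {u : TruncPoly k p n}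
    (hu : u ∈ wtSub w k p (Set.Iic r)) (i : Fin n) (h : r < ((b i : ℤ) - a i) * w i) :
    cf b (mono k p a * u) = 0 := by
  by_cases hab : a ≤ b
  · obtain ⟨c, rfl⟩ := exists_add_of_le hab
    refine cf_mono_mul_of_wt_lt hu (lt_of_lt_of_le h ?_)
    rw [wt_add, add_sub_cancel_left, Finsupp.add_apply, Nat.cast_add, add_sub_cancel_left]
    exact Finset.single_le_sum (f := fun i => (c i : ℤ) * w i) (fun _ _ => by positivity)
      (Finset.mem_univ i)
  · by_cases hb : ∀ i, b i < p
    · rw [cf_mono_mul hb, if_neg hab]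
    · exact cf_of_not_lt hb _

/-- The weights of a contact algebra: `2` for the distinguished variable, `1` for the others. -/
def contactWt (z : Fin n) (i : Fin n) : ℕ := if i = z then 2 else 1

theorem one_le_contactWt (z i : Fin n) : 1 ≤ contactWt z i := by
  rw [contactWt]; split_ifs <;> omega

theorem contactWt_le_two (z i : Fin n) : contactWt z i ≤ 2 := by
  rw [contactWt]; split_ifs <;> omega

@[simp] theorem contactWt_self (z : Fin n) : contactWt z z = 2 := if_pos rfl

theorem contactWt_of_ne {z i : Fin n} (h : i ≠ z) : contactWt z i = 1 := if_neg h

/-- The polynomial `h` for which the functional `D ↦ ∫ h ω(D)` is in general position. The first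
and the last term have derivatives that separate the constant and linear terms of a field; the term
`x_z xₒ⁴` excludes the linear fields that act on the other two by a common scalar. -/
def contactPoly (k : Type*) [Field k] (p : ℕ) {n : ℕ} (z o : Fin n) : TruncPoly k p n :=
  x k p z * ∑ i ∈ Finset.univ.erase z, x k p i ^ 3 + x k p z * x k p o ^ 4 + x k p z ^ 3

theorem cf_contactPoly {b : Fin n →₀ ℕ} (hb : ∀ i, b i < p) (z o : Fin n) :
    cf b (contactPoly k p z o) =
      (∑ i ∈ Finset.univ.erase z, if Finsupp.single z 1 + Finsupp.single i 3 = b then 1 else 0) +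
      (if Finsupp.single z 1 + Finsupp.single o 4 = b then 1 else 0) +
      if Finsupp.single z 3 = b then 1 else 0 := by
  rw [contactPoly, Finset.mul_sum]
  conv_lhs => rw [← pow_one (x k p z), ← pow_mul]
  simp only [one_mul, ← mono_single, ← mono_add, map_add, map_sum, cf_mono hb]

variable [CharP k p]

theorem pd_contactPoly {z o l : Fin n} (hl : l ≠ z) :
    pd l (contactPoly k p z o) =
      (3 : k) • mono k p (Finsupp.single z 1 + Finsupp.single l 2) +
      if l = o then (4 : k) • mono k p (Finsupp.single z 1 + Finsupp.single o 3) else 0 := by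
  have h1 : pd l (∑ i ∈ Finset.univ.erase z, x k p i ^ 3) = (3 : k) • x k p l ^ 2 := by
    rw [map_sum, Finset.sum_eq_single l]
    · rw [pd_pow, if_pos rfl]
      norm_num
    · intro i _ hi
      rw [pd_pow, if_neg hi.symm]
    · intro h
      exact absurd (Finset.mem_erase.2 ⟨hl, Finset.mem_univ _⟩) h
  rw [contactPoly]
  simp only [map_add, Derivation.leibniz, h1, pd_pow, pd_x, if_neg hl, add_zero,
    smul_eq_mul, mono_add, mono_single, pow_one]
  split_ifs
  all_goals
    simp only [smul_eq_algebraMap_mul, map_add, map_natCast, map_one, map_ofNat]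
    push_cast
    ring

theorem pd_contactPoly_self {z o : Fin n} (ho : o ≠ z) :
    pd z (contactPoly k p z o) =
      ∑ i ∈ Finset.univ.erase z, mono k p (Finsupp.single i 3) + mono k p (Finsupp.single o 4) +
      (3 : k) • mono k p (Finsupp.single z 2) := by
  have h1 : pd z (∑ i ∈ Finset.univ.erase z, x k p i ^ 3) = 0 := by
    rw [map_sum]
    refine Finset.sum_eq_zero fun i hi => ?_
    rw [pd_pow, if_neg (Finset.ne_of_mem_erase hi).symm]
  rw [contactPoly]
  simp only [map_add, Derivation.leibniz, h1, pd_pow, pd_x, if_neg ho.symm, if_true,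
    smul_eq_mul, mono_single, mul_one]
  simp only [smul_eq_algebraMap_mul, map_add, map_natCast, map_one, map_ofNat]
  push_cast
  ring

theorem cf_mul_pd_contactPoly {z o l : Fin n} (hl : l ≠ z) (b : Fin n →₀ ℕ)
    (u : TruncPoly k p n) :
    cf b (u * pd l (contactPoly k p z o)) =
      3 * cf b (mono k p (Finsupp.single z 1 + Finsupp.single l 2) * u) +
      if l = o then 4 * cf b (mono k p (Finsupp.single z 1 + Finsupp.single o 3) * u) else 0 := by
  rw [pd_contactPoly hl, mul_comm u, add_mul, map_add, smul_mul_assoc, map_smul, smul_eq_mul]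
  split_ifs
  · rw [smul_mul_assoc, map_smul, smul_eq_mul]
  · rw [zero_mul, map_zero]

theorem cf_mul_pd_contactPoly_self {z o : Fin n} (ho : o ≠ z) (b : Fin n →₀ ℕ)
    (u : TruncPoly k p n) :
    cf b (u * pd z (contactPoly k p z o)) =
      ∑ i ∈ Finset.univ.erase z, cf b (mono k p (Finsupp.single i 3) * u) +
      cf b (mono k p (Finsupp.single o 4) * u) +
      3 * cf b (mono k p (Finsupp.single z 2) * u) := by
  rw [pd_contactPoly_self ho, mul_comm u, add_mul, add_mul, map_add, map_add, smul_mul_assoc,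
    map_smul, smul_eq_mul, Finset.sum_mul, map_sum]

set_option maxHeartbeats 1000000 in
/-- If `y h + κ h` has no monomials of weight at most `6` that are divisible by `x_z`, then a field
`y` of weight at most `0` vanishes. -/
theorem eq_zero_of_cf_contactPoly (hp : 5 ≤ p) {z o : Fin n} (ho : o ≠ z) {y : W k p n}
    (hy : y ∈ nonpos (contactWt z) k p) (κ : k)
    (h : ∀ b : Fin n →₀ ℕ, (∀ i, b i < p) → 1 ≤ b z → wt (contactWt z) b ≤ 6 →
      cf b (y (contactPoly k p z o) + κ • contactPoly k p z o) = 0) : y = 0 := by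
  have hyj : ∀ j, j ≠ z → y (x k p j) ∈ wtSub (contactWt z) k p (Set.Iic 1) := fun j hj => by
    have := hy j
    rwa [contactWt_of_ne hj, Nat.cast_one] at this
  have hyz : y (x k p z) ∈ wtSub (contactWt z) k p (Set.Iic 2) := by
    have := hy z
    rwa [contactWt_self] at this
  have wts : ∀ i e, i ≠ z → wt (contactWt z) (Finsupp.single i e) = e := fun i e hi => by
    rw [wt_single, contactWt_of_ne hi, Nat.cast_one, mul_one]
  have wtz : ∀ e, wt (contactWt z) (Finsupp.single z e) = 2 * e := fun e => by
    rw [wt_single, contactWt_self, mul_comm]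
    rfl
  have hval : ∀ b : Fin n →₀ ℕ, (∀ i, b i ≤ 4) → ∀ i, b i < p := fun b hb i => by
    have := hb i
    omega
  have key : ∀ b : Fin n →₀ ℕ, (∀ i, b i ≤ 4) → 1 ≤ b z → wt (contactWt z) b ≤ 6 →
      (∑ l ∈ Finset.univ.erase z,
        (3 * cf b (mono k p (Finsupp.single z 1 + Finsupp.single l 2) * y (x k p l)) +
        if l = o then 4 * cf b (mono k p (Finsupp.single z 1 + Finsupp.single o 3) *
          y (x k p l)) else 0)) +
      ((∑ i ∈ Finset.univ.erase z, cf b (mono k p (Finsupp.single i 3) * y (x k p z))) +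
        cf b (mono k p (Finsupp.single o 4) * y (x k p z)) +
        3 * cf b (mono k p (Finsupp.single z 2) * y (x k p z))) +
      κ * ((∑ i ∈ Finset.univ.erase z,
          if Finsupp.single z 1 + Finsupp.single i 3 = b then 1 else 0) +
        (if Finsupp.single z 1 + Finsupp.single o 4 = b then 1 else 0) +
        if Finsupp.single z 3 = b then 1 else 0) = 0 := by
    intro b hb hbz hwt
    have := h b (hval b hb) hbz hwt
    rw [apply_eq_sum, map_add, map_sum, map_smul, cf_contactPoly (hval b hb), smul_eq_mul,
      ← Finset.sum_erase_add _ _ (Finset.mem_univ z), cf_mul_pd_contactPoly_self ho] at this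
    refine Eq.trans ?_ this
    congr 2
    exact Finset.sum_congr rfl fun l hl =>
      (cf_mul_pd_contactPoly (Finset.ne_of_mem_erase hl) _ _).symm
  have h2 : (2 : k) ≠ 0 := by
    exact_mod_cast cast_ne_zero_of_lt (k := k) (p := p) (m := 2) (by omega) (by omega)
  have h3 : (3 : k) ≠ 0 := by
    exact_mod_cast cast_ne_zero_of_lt (k := k) (p := p) (m := 3) (by omega) (by omega)
  have sz : ∀ (i : Fin n) (e : ℕ), i ≠ z → Finsupp.single i e z = 0 := fun i e hi =>
    Finsupp.single_eq_of_ne hi.symm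
  have zs : ∀ (i : Fin n) (e : ℕ), i ≠ z → Finsupp.single z e i = 0 := fun i e hi =>
    Finsupp.single_eq_of_ne hi
  have hadd : ∀ (a b c : Fin n →₀ ℕ) (u : TruncPoly k p n), (∀ i, b i ≤ 4) → b = a + c →
      cf b (mono k p a * u) = cf c u := by
    rintro a b c u hb rfl
    exact cf_add_mono_mul (hval _ hb) u
  have hneq : ∀ {a b : Fin n →₀ ℕ} (i : Fin n), a i ≠ b i → a ≠ b := fun i hi hab =>
    hi (DFunLike.congr_fun hab i)
  -- The coefficients of `z x_j² x^c` give the constant and the off-diagonal linear terms.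
  have hquad : ∀ j, j ≠ z → ∀ c : Fin n →₀ ℕ, c z = 0 → c j = 0 → (∀ i, c i ≤ 1) →
      wt (contactWt z) c ≤ 2 → cf c (y (x k p j)) = 0 := by
    intro j hj c hcz hcj hc hcw
    set b : Fin n →₀ ℕ := Finsupp.single z 1 + Finsupp.single j 2 + c with hb
    have hbw : wt (contactWt z) b ≤ 6 := by
      rw [hb, wt_add, wt_add, wtz, wts _ _ hj]
      push_cast
      omega
    have hbz : b z = 1 := by simp [hb, sz j 2 hj, hcz]
    have hbj : ∀ i, i ≠ z → i ≠ j → b i ≤ 1 := fun i hi hij => by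
      simp [hb, zs i 1 hi, Finsupp.single_eq_of_ne hij, hc]
    have hb2 : ∀ i, b i ≤ 2 := fun i => by
      by_cases hi : i = z
      · rw [hi, hbz]; omega
      · by_cases hij : i = j
        · simp [hij, hb, zs j 1 hj, hcj]
        · exact (hbj i hi hij).trans (by omega)
    have hb4 : ∀ i, b i ≤ 4 := fun i => (hb2 i).trans (by omega)
    have hk := key b hb4 hbz.ge hbw
    have t1 : ∀ l ∈ Finset.univ.erase z,
        (3 * cf b (mono k p (Finsupp.single z 1 + Finsupp.single l 2) * y (x k p l)) +
        if l = o then 4 * cf b (mono k p (Finsupp.single z 1 + Finsupp.single o 3) *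
          y (x k p l)) else 0) = if l = j then 3 * cf c (y (x k p j)) else 0 := by
      intro l hl
      have hlz := Finset.ne_of_mem_erase hl
      rw [cf_mono_mul_of_lt (a := Finsupp.single z 1 + Finsupp.single o 3) o, mul_zero, ite_self,
        add_zero]
      · split_ifs with hlj
        · rw [hlj, hadd _ b c _ hb4 rfl]
        · rw [cf_mono_mul_of_lt l, mul_zero]
          have := hbj l hlz hlj
          simp [zs l 1 hlz]
          omega
      · have := hb2 o
        simp [zs o 1 ho]
        omega
    have t2 : ∀ i ∈ Finset.univ.erase z,
        cf b (mono k p (Finsupp.single i 3) * y (x k p z)) = 0 := fun i _ =>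
      cf_mono_mul_of_lt i (by have := hb2 i; simp; omega) _
    have t3 : ∀ i ∈ Finset.univ.erase z,
        (if Finsupp.single z 1 + Finsupp.single i 3 = b then (1 : k) else 0) = 0 := fun i hi => by
      refine if_neg (hneq i ?_)
      have := hb2 i
      simp [zs i 1 (Finset.ne_of_mem_erase hi)]
      omega
    rw [Finset.sum_congr rfl t1, Finset.sum_eq_zero t2, Finset.sum_eq_zero t3,
      Finset.sum_ite_eq', if_pos (Finset.mem_erase.2 ⟨hj, Finset.mem_univ _⟩),
      cf_mono_mul_of_lt (a := Finsupp.single o 4) o (by have := hb2 o; simp; omega),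
      cf_mono_mul_of_lt (a := Finsupp.single z 2) z (by simp [hbz]),
      if_neg (c := Finsupp.single z 1 + Finsupp.single o 4 = b)
        (hneq o (by have := hb2 o; simp [zs o 1 ho]; omega)),
      if_neg (c := Finsupp.single z 3 = b) (hneq z (by simp [hbz]))] at hk
    simpa [h3] using hk
  have hC : ∀ j, j ≠ z → cf 0 (y (x k p j)) = 0 := fun j hj =>
    hquad j hj 0 rfl rfl (fun _ => by simp) (by simp)
  have hB : ∀ j l, j ≠ z → l ≠ z → l ≠ j → cf (Finsupp.single l 1) (y (x k p j)) = 0 :=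
    fun j l hj hl hlj => hquad j hj _ (sz l 1 hl) (Finsupp.single_eq_of_ne hlj.symm)
      (fun i => by rw [Finsupp.single_apply]; split_ifs <;> omega)
      (by rw [wts _ _ hl]; norm_num)
  -- The coefficients of `z² x^c` give the component along `z`, except for its term in `z`.
  have hD : ∀ c : Fin n →₀ ℕ, c z = 0 → wt (contactWt z) c ≤ 2 → cf c (y (x k p z)) = 0 := by
    intro c hcz hcw
    have hc2 : ∀ i, c i ≤ 2 := fun i => by
      have := apply_le_wt (one_le_contactWt z) c i
      omega
    set b : Fin n →₀ ℕ := Finsupp.single z 2 + c with hb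
    have hbw : wt (contactWt z) b ≤ 6 := by
      rw [hb, wt_add, wtz]
      push_cast
      omega
    have hbz : b z = 2 := by simp [hb, hcz]
    have hb4 : ∀ i, b i ≤ 4 := fun i => by
      by_cases hi : i = z
      · rw [hi, hbz]; omega
      · have := hc2 i
        simp [hb, zs i 2 hi]
        omega
    have hk := key b hb4 (by omega) hbw
    have t1 : ∀ l ∈ Finset.univ.erase z,
        (3 * cf b (mono k p (Finsupp.single z 1 + Finsupp.single l 2) * y (x k p l)) +
        if l = o then 4 * cf b (mono k p (Finsupp.single z 1 + Finsupp.single o 3) *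
          y (x k p l)) else 0) = 0 := by
      intro l hl
      have hlz := Finset.ne_of_mem_erase hl
      rw [cf_mono_mul_of_coord (hyj l hlz) z (by simp [hbz, sz l 2 hlz]),
        cf_mono_mul_of_coord (hyj l hlz) z (by simp [hbz, sz o 3 ho])]
      simp
    have t2 : ∀ i ∈ Finset.univ.erase z,
        cf b (mono k p (Finsupp.single i 3) * y (x k p z)) = 0 := fun i hi =>
      cf_mono_mul_of_coord hyz z (by simp [hbz, sz i 3 (Finset.ne_of_mem_erase hi)])
    have t3 : ∀ i ∈ Finset.univ.erase z,
        (if Finsupp.single z 1 + Finsupp.single i 3 = b then (1 : k) else 0) = 0 := fun i hi =>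
      if_neg (hneq z (by simp [hbz, sz i 3 (Finset.ne_of_mem_erase hi)]))
    rw [Finset.sum_eq_zero t1, Finset.sum_eq_zero t2, Finset.sum_eq_zero t3,
      cf_mono_mul_of_coord (a := Finsupp.single o 4) hyz z (by simp [hbz, sz o 4 ho]),
      hadd (Finsupp.single z 2) b c _ hb4 rfl,
      if_neg (c := Finsupp.single z 1 + Finsupp.single o 4 = b)
        (hneq z (by simp [hbz, sz o 4 ho])),
      if_neg (c := Finsupp.single z 3 = b) (hneq z (by simp [hbz]))] at hk
    simpa [h3] using hk
  set β : k := cf (Finsupp.single z 1) (y (x k p z)) with hβ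
  -- The coefficients of `z³`, `z x_j³` and `z xₒ⁴` give the diagonal terms.
  have hz3 : 3 * β + κ = 0 := by
    set b : Fin n →₀ ℕ := Finsupp.single z 3 with hb
    have hbz : b z = 3 := by simp [hb]
    have hbi : ∀ i, i ≠ z → b i = 0 := fun i hi => zs i 3 hi
    have hb4 : ∀ i, b i ≤ 4 := fun i => by
      by_cases hi : i = z
      · rw [hi, hbz]; omega
      · rw [hbi i hi]; omega
    have hk := key b hb4 (by omega) (by rw [hb, wtz]; norm_num)
    have t1 : ∀ l ∈ Finset.univ.erase z,
        (3 * cf b (mono k p (Finsupp.single z 1 + Finsupp.single l 2) * y (x k p l)) +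
        if l = o then 4 * cf b (mono k p (Finsupp.single z 1 + Finsupp.single o 3) *
          y (x k p l)) else 0) = 0 := by
      intro l hl
      have hlz := Finset.ne_of_mem_erase hl
      rw [cf_mono_mul_of_lt l (by simp [hbi l hlz]), cf_mono_mul_of_lt o (by simp [hbi o ho])]
      simp
    have t2 : ∀ i ∈ Finset.univ.erase z,
        cf b (mono k p (Finsupp.single i 3) * y (x k p z)) = 0 := fun i hi =>
      cf_mono_mul_of_lt i (by simp [hbi i (Finset.ne_of_mem_erase hi)]) _
    have t3 : ∀ i ∈ Finset.univ.erase z,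
        (if Finsupp.single z 1 + Finsupp.single i 3 = b then (1 : k) else 0) = 0 := fun i hi =>
      if_neg (hneq i (by simp [hbi i (Finset.ne_of_mem_erase hi)]))
    rw [Finset.sum_eq_zero t1, Finset.sum_eq_zero t2, Finset.sum_eq_zero t3,
      cf_mono_mul_of_lt (a := Finsupp.single o 4) o (by simp [hbi o ho]),
      hadd (Finsupp.single z 2) b (Finsupp.single z 1) _ hb4 (by rw [hb, ← Finsupp.single_add]),
      if_neg (c := Finsupp.single z 1 + Finsupp.single o 4 = b)
        (hneq o (by simp [hbi o ho])), if_pos rfl] at hk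
    linear_combination hk
  have hdiag : ∀ j, j ≠ z → 3 * cf (Finsupp.single j 1) (y (x k p j)) + β + κ = 0 := by
    intro j hj
    set b : Fin n →₀ ℕ := Finsupp.single z 1 + Finsupp.single j 3 with hb
    have hbz : b z = 1 := by simp [hb, sz j 3 hj]
    have hbj : b j = 3 := by simp [hb, zs j 1 hj]
    have hbi : ∀ i, i ≠ z → i ≠ j → b i = 0 := fun i hi hij => by
      simp [hb, zs i 1 hi, Finsupp.single_eq_of_ne hij]
    have hb3 : ∀ i, b i ≤ 3 := fun i => by
      by_cases hi : i = z
      · rw [hi, hbz]; omega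
      · by_cases hij : i = j
        · rw [hij, hbj]
        · rw [hbi i hi hij]; omega
    have hb4 : ∀ i, b i ≤ 4 := fun i => (hb3 i).trans (by omega)
    have hk := key b hb4 hbz.ge (by rw [hb, wt_add, wtz, wts _ _ hj]; norm_num)
    have t1 : ∀ l ∈ Finset.univ.erase z,
        (3 * cf b (mono k p (Finsupp.single z 1 + Finsupp.single l 2) * y (x k p l)) +
        if l = o then 4 * cf b (mono k p (Finsupp.single z 1 + Finsupp.single o 3) *
          y (x k p l)) else 0) =
        if l = j then 3 * cf (Finsupp.single j 1) (y (x k p j)) else 0 := by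
      intro l hl
      have hlz := Finset.ne_of_mem_erase hl
      have h0 : cf b (mono k p (Finsupp.single z 1 + Finsupp.single o 3) * y (x k p l)) = 0 := by
        by_cases hoj : o = j
        · rw [hoj, hadd _ b 0 _ hb4 (add_zero _).symm, hC l hlz]
        · exact cf_mono_mul_of_lt o (by simp [hbi o ho hoj]) _
      rw [h0, mul_zero, ite_self, add_zero]
      split_ifs with hlj
      · rw [hlj, hadd _ b (Finsupp.single j 1) _ hb4
          (by rw [hb, add_assoc, ← Finsupp.single_add])]
      · rw [cf_mono_mul_of_lt l (by simp [hbi l hlz hlj]), mul_zero]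
    have t2 : ∀ i ∈ Finset.univ.erase z,
        cf b (mono k p (Finsupp.single i 3) * y (x k p z)) = if i = j then β else 0 := by
      intro i hi
      split_ifs with hij
      · rw [hij, hadd _ b (Finsupp.single z 1) _ hb4 (by rw [hb, add_comm])]
      · exact cf_mono_mul_of_lt i (by simp [hbi i (Finset.ne_of_mem_erase hi) hij]) _
    have t3 : ∀ i ∈ Finset.univ.erase z,
        (if Finsupp.single z 1 + Finsupp.single i 3 = b then (1 : k) else 0) =
          if i = j then 1 else 0 := by
      intro i hi
      by_cases hij : i = j
      · rw [hij, if_pos hb.symm, if_pos rfl]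
      · rw [if_neg hij, if_neg (hneq i (by simp [hbi i (Finset.ne_of_mem_erase hi) hij]))]
    rw [Finset.sum_congr rfl t1, Finset.sum_congr rfl t2, Finset.sum_congr rfl t3,
      Finset.sum_ite_eq', Finset.sum_ite_eq', Finset.sum_ite_eq',
      if_pos (Finset.mem_erase.2 ⟨hj, Finset.mem_univ _⟩),
      if_pos (Finset.mem_erase.2 ⟨hj, Finset.mem_univ _⟩),
      if_pos (Finset.mem_erase.2 ⟨hj, Finset.mem_univ _⟩),
      cf_mono_mul_of_lt (a := Finsupp.single o 4) o (by have := hb3 o; simp; omega),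
      cf_mono_mul_of_lt (a := Finsupp.single z 2) z (by simp [hbz]),
      if_neg (c := Finsupp.single z 1 + Finsupp.single o 4 = b)
        (hneq o (by have := hb3 o; simp [zs o 1 ho]; omega)),
      if_neg (c := Finsupp.single z 3 = b) (hneq z (by simp [hbz]))] at hk
    linear_combination hk
  have hquart : 4 * cf (Finsupp.single o 1) (y (x k p o)) + β + κ = 0 := by
    set b : Fin n →₀ ℕ := Finsupp.single z 1 + Finsupp.single o 4 with hb
    have hbz : b z = 1 := by simp [hb, sz o 4 ho]
    have hbo : b o = 4 := by simp [hb, zs o 1 ho]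
    have hbi : ∀ i, i ≠ z → i ≠ o → b i = 0 := fun i hi hij => by
      simp [hb, zs i 1 hi, Finsupp.single_eq_of_ne hij]
    have hb4 : ∀ i, b i ≤ 4 := fun i => by
      by_cases hi : i = z
      · rw [hi, hbz]; omega
      · by_cases hij : i = o
        · rw [hij, hbo]
        · rw [hbi i hi hij]; omega
    have hbw : wt (contactWt z) b = 6 := by rw [hb, wt_add, wtz, wts _ _ ho]; norm_num
    have hk := key b hb4 hbz.ge hbw.le
    have t1 : ∀ l ∈ Finset.univ.erase z,
        (3 * cf b (mono k p (Finsupp.single z 1 + Finsupp.single l 2) * y (x k p l)) +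
        if l = o then 4 * cf b (mono k p (Finsupp.single z 1 + Finsupp.single o 3) *
          y (x k p l)) else 0) =
        if l = o then 4 * cf (Finsupp.single o 1) (y (x k p o)) else 0 := by
      intro l hl
      have hlz := Finset.ne_of_mem_erase hl
      rw [cf_mono_mul_of_wt_lt (hyj l hlz)
        (by rw [hbw, wt_add, wtz, wts _ _ hlz]; norm_num), mul_zero, zero_add]
      split_ifs with hlo
      · rw [hlo, hadd _ b (Finsupp.single o 1) _ hb4
          (by rw [hb, add_assoc, ← Finsupp.single_add])]
      · rfl
    have t2 : ∀ i ∈ Finset.univ.erase z,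
        cf b (mono k p (Finsupp.single i 3) * y (x k p z)) = 0 := fun i hi =>
      cf_mono_mul_of_wt_lt hyz
        (by rw [hbw, wts _ _ (Finset.ne_of_mem_erase hi)]; norm_num)
    have t3 : ∀ i ∈ Finset.univ.erase z,
        (if Finsupp.single z 1 + Finsupp.single i 3 = b then (1 : k) else 0) = 0 := by
      intro i hi
      refine if_neg (hneq i ?_)
      by_cases hio : i = o
      · rw [hio, hbo]
        simp [zs o 1 ho]
      · simp [hbi i (Finset.ne_of_mem_erase hi) hio]
    rw [Finset.sum_congr rfl t1, Finset.sum_eq_zero t2, Finset.sum_eq_zero t3,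
      Finset.sum_ite_eq', if_pos (Finset.mem_erase.2 ⟨ho, Finset.mem_univ _⟩),
      hadd (Finsupp.single o 4) b (Finsupp.single z 1) _ hb4 (by rw [hb, add_comm]),
      cf_mono_mul_of_lt (a := Finsupp.single z 2) z (by simp [hbz]), if_pos hb.symm,
      if_neg (c := Finsupp.single z 3 = b) (hneq z (by simp [hbz]))] at hk
    linear_combination hk
  -- Eliminating the diagonal terms from the last three relations leaves `2 κ = 0`.
  have hκ : κ = 0 := by
    have h4 : 2 * κ = 0 := by linear_combination -9 * hquart + 12 * hdiag o ho - hz3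
    exact (mul_eq_zero.1 h4).resolve_left h2
  have hβ0 : β = 0 := by
    have h4 : 3 * β = 0 := by linear_combination hz3 - hκ
    exact (mul_eq_zero.1 h4).resolve_left h3
  have hjj : ∀ j, j ≠ z → cf (Finsupp.single j 1) (y (x k p j)) = 0 := by
    intro j hj
    have h4 : 3 * cf (Finsupp.single j 1) (y (x k p j)) = 0 := by
      linear_combination hdiag j hj - hκ - hβ0
    exact (mul_eq_zero.1 h4).resolve_left h3
  -- A monomial in which `x_i` occurs is `x_i` or has larger weight.
  have hsub : ∀ (c : Fin n →₀ ℕ) (i : Fin n), c i ≠ 0 →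
      wt (contactWt z) c ≤ contactWt z i → c = Finsupp.single i 1 := by
    intro c i hi hc
    have e : c = (c - Finsupp.single i 1) + Finsupp.single i 1 := by
      rw [tsub_add_cancel_of_le]
      rw [Finsupp.single_le_iff]
      omega
    have h4 : c - Finsupp.single i 1 = 0 := by
      refine eq_zero_of_wt_eq_zero (one_le_contactWt z) ?_
      rw [e, wt_add, wt_single] at hc
      push_cast at hc
      linarith
    rw [e, h4, zero_add]
  refine derivation_ext fun j => eq_zero_of_cf fun c _ => ?_
  by_contra hne
  by_cases hj : j = z
  · subst hj
    have hcw := hyz c hne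
    by_cases hcz : c j = 0
    · exact hne (hD c hcz hcw)
    · rw [hsub c j hcz (by simpa using hcw)] at hne
      exact hne hβ0
  · have hcw := hyj j hj c hne
    rw [Set.mem_Iic] at hcw
    by_cases hc0 : c = 0
    · exact hne (hc0 ▸ hC j hj)
    obtain ⟨i, hi⟩ : ∃ i, c i ≠ 0 := by
      by_contra hcon
      push Not at hcon
      exact hc0 (Finsupp.ext hcon)
    have hci := hsub c i hi (by
      have := one_le_contactWt z i
      omega)
    rw [hci] at hne hcw
    have hiz : i ≠ z := by
      rintro rfl
      rw [wtz] at hcw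
      norm_num at hcw
    by_cases hij : i = j
    · exact hne (hij ▸ hjj j hj)
    · exact hne (hB j i hj hiz hij)

end ContactCoefficients

/-! ### Bivector fields suffice; the Witt–Jacobson algebras -/

section WeightBounds

variable {k : Type*} [Field k] {p n : ℕ}

theorem pow_mem_wtSub {w : Fin n → ℕ} {I : Set ℤ} (i : Fin n) (e : ℕ) (h : (e * w i : ℤ) ∈ I) :
    x k p i ^ e ∈ wtSub w k p I := by
  rw [← mono_single]
  exact mono_mem_wtSub (by rwa [wt_single])

theorem integral_eq_zero_of_mem_wtSub {w : Fin n → ℕ} {d : ℤ} {u : TruncPoly k p n}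
    (hu : u ∈ wtSub w k p (Set.Iic d)) (hd : d < wt w (top p n)) : integral k p n u = 0 :=
  cf_eq_zero_of_mem_wtSub hu (by simpa using hd)

theorem genPoly_mem_wtSub (o e : Fin n) :
    genPoly k p o e ∈ wtSub (fun _ => 1) k p (Set.Iic 5) := by
  have hx : ∀ (i : Fin n) (a : ℕ), x k p i ^ a ∈ wtSub (fun _ => 1) k p (Set.Iic (a : ℤ)) :=
    fun i a => pow_mem_wtSub i a (by simp)
  have hmul : ∀ {a b c : ℤ} {u v : TruncPoly k p n}, u ∈ wtSub (fun _ => 1) k p (Set.Iic a) →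
      v ∈ wtSub (fun _ => 1) k p (Set.Iic b) → a + b ≤ c →
      u * v ∈ wtSub (fun _ => 1) k p (Set.Iic c) := fun hu hv hc =>
    mul_mem_wtSub (fun i hi j hj => by simp only [Set.mem_Iic] at *; omega) hu hv
  refine Submodule.add_mem _ (Submodule.add_mem _ (Submodule.smul_mem _ _ ?_)
    (Submodule.smul_mem _ _ ?_)) (Submodule.smul_mem _ _ ?_)
  · exact wtSub_mono (Set.Iic_subset_Iic.2 (by norm_num)) (hx o 4)
  · rw [← pow_one (x k p o)]
    exact hmul (hx o 1) (Submodule.sum_mem _ fun i _ => hx i 3) (by norm_num)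
  · exact hmul (hx o 3) (hx e 2) (by norm_num)

end WeightBounds

section BivectorCriterion

variable {k : Type*} [Field k] {p n : ℕ} [CharP k p] [Fact p.Prime]

/-- A dilation-stable Lie algebra of derivations that contains the fields `D_P(∂ₗ² f)` for a
constant bivector `P` in suitable position has only constant coadjoint invariants. -/
theorem coadjointInvariants_eq_bot_of_bivector [IsAlgClosed k] (hp : 5 ≤ p) (hn : 2 ≤ n)
    {o e : Fin n} (hoe : o ≠ e) (P : Matrix (Fin n) (Fin n) k)
    (hP : ∀ j, P e j = if j = o then 1 else 0) (hPo : P o e = -1)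
    {L : Type*} [LieRing L] [LieAlgebra k L]
    (ι : L →ₗ⁅k⁆ W k p n) (hι : Function.Injective ι)
    (hdil : ∀ t : kˣ, ∃ g : L ≃ₗ⁅k⁆ L, ∀ y, ι (g y) = conj (dil (fun _ => 1) t) (ι y))
    (hL : ∀ l f, ∃ D : L, ι D = bivectorField P (pd l (pd l f))) :
    coadjointInvariants k L = ⊥ := by
  have htop : wt (fun _ => 1) (top p n) = ((p - 1 : ℕ) : ℤ) * n := by
    rw [wt_top]
    simp
  have hp1 : ((p - 1 : ℕ) : ℤ) = p - 1 := by
    rw [Nat.cast_sub (by omega), Nat.cast_one]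
  have hn' : (2 : ℤ) ≤ n := by exact_mod_cast hn
  have hp' : (5 : ℤ) ≤ p := by exact_mod_cast hp
  rw [hp1] at htop
  refine coadjointInvariants_eq_bot_of_pairing (w := fun _ => 1) (r := 1) (d := n)
    (fun _ => le_rfl) (fun _ => le_rfl) ?_ ι hι hdil (evalFunctional e (genPoly k p o e)) ?_ ?_
  · rw [htop]
    push_cast
    linarith
  -- The integrand has weight at most `1 + 5`, and the top weight is at least `2 (p - 1)`.
  · intro D hD
    refine integral_eq_zero_of_mem_wtSub (w := fun _ => 1) (d := 6)
      (mul_mem_wtSub ?_ (hD e) (genPoly_mem_wtSub o e)) ?_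
    · intro i hi j hj
      simp only [Set.mem_Iic] at *
      push_cast at hi
      omega
    · rw [htop]
      nlinarith
  · intro y hy h
    refine eq_zero_of_bivector_pairing hp hn hoe P hP hPo hy fun l f hf => ?_
    obtain ⟨D, hD⟩ := hL l f
    rw [← hD]
    refine h D ?_
    rw [hD]
    refine mem_fil_of_coord fun i => ?_
    rw [bivectorField_x]
    have hpd : ∀ {a b : ℤ} {u : TruncPoly k p n} (j : Fin n), a - 1 = b →
        u ∈ wtSub (fun _ => 1) k p (Set.Ici a) → pd j u ∈ wtSub (fun _ => 1) k p (Set.Ici b) :=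
      fun j hab hu => pd_mem_wtSub (fun c hc => by
        simp only [Set.mem_Ici] at *
        push_cast
        omega) hu
    exact Submodule.sum_mem _ fun j _ => Submodule.smul_mem _ _
      (hpd j (by push_cast; ring) (hpd l rfl (hpd l rfl hf)))

/-- The constant bivector `∂ₑ ∧ ∂ₒ`. -/
def planeBivector (k : Type*) [Field k] {n : ℕ} (o e : Fin n) : Matrix (Fin n) (Fin n) k :=
  Matrix.of fun i j => if i = e ∧ j = o then 1 else if i = o ∧ j = e then -1 else 0

theorem planeBivector_right {o e : Fin n} (hoe : o ≠ e) (j : Fin n) :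
    planeBivector k o e e j = if j = o then 1 else 0 := by
  simp [planeBivector, hoe.symm]

theorem planeBivector_left {o e : Fin n} (hoe : o ≠ e) : planeBivector k o e o e = -1 := by
  simp [planeBivector, hoe]

theorem coadjointInvariants_W_of_two_le [IsAlgClosed k] (hp : 5 ≤ p) (hn : 2 ≤ n) :
    coadjointInvariants k (W k p n) = ⊥ := by
  have hoe : (⟨0, by omega⟩ : Fin n) ≠ ⟨1, by omega⟩ := by simp [Fin.ext_iff]
  exact coadjointInvariants_eq_bot_of_bivector hp hn hoe (planeBivector k _ _)
    (planeBivector_right hoe) (planeBivector_left hoe) (LieHom.id : W k p n →ₗ⁅k⁆ W k p n)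
    Function.injective_id (fun t => ⟨conj (dil _ t), fun _ => rfl⟩) (fun l f => ⟨_, rfl⟩)

theorem eq_zero_of_cf_add_smul_x {k : Type*} [Field k] {p : ℕ} [CharP k p] (hp : 5 ≤ p)
    {u : TruncPoly k p 1}
    (hu : u ∈ wtSub (fun _ => 1) k p (Set.Iic 1))
    (h : ∀ b : Fin 1 →₀ ℕ, wt (fun _ => 1) b ≤ 1 →
      cf b (u + (2 * cf (Finsupp.single 0 1) u) • x k p 0) = 0) : u = 0 := by
  have hx : x k p (0 : Fin 1) = mono k p (Finsupp.single 0 1) := by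
    rw [mono_single, pow_one]
  have h3 : (3 : k) ≠ 0 := by
    have := cast_ne_zero_of_lt (k := k) (p := p) (m := 3) (by omega) (by omega)
    exact_mod_cast this
  have hvalid : ∀ i, (Finsupp.single (0 : Fin 1) 1) i < p := fun i => by
    obtain rfl : i = 0 := Subsingleton.elim _ _
    rw [Finsupp.single_eq_same]
    omega
  have hx0 : cf 0 (x k p (0 : Fin 1)) = 0 :=
    cf_eq_zero_of_mem_wtSub (w := fun _ => 1) (I := Set.Ici 1) (x_mem_wtSub (by simp)) (by simp)
  refine eq_zero_of_linear_coeffs hu ?_ fun i => ?_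
  · have := h 0 (by simp)
    rwa [map_add, map_smul, hx0, smul_zero, add_zero] at this
  · obtain rfl : i = 0 := Subsingleton.elim _ _
    have := h (Finsupp.single 0 1) (by simp [wt_single])
    rw [map_add, map_smul, hx, cf_mono hvalid, if_pos rfl, smul_eq_mul] at this
    have h4 : 3 * cf (Finsupp.single 0 1) u = 0 := by linear_combination this
    exact (mul_eq_zero.1 h4).resolve_left h3

/-- For `W(1)` the functional `f ∂ ↦ ∫ f x` pairs `f ∂` with `y ∂` to `∫ f (y + 2 y' x)`. -/
theorem coadjointInvariants_W_one [IsAlgClosed k] (hp : 5 ≤ p) :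
    coadjointInvariants k (W k p 1) = ⊥ := by
  have htop : wt (fun _ => 1) (top p 1) = ((p - 1 : ℕ) : ℤ) := by
    rw [wt_top]
    simp
  have hp1 : ((p - 1 : ℕ) : ℤ) = p - 1 := by
    rw [Nat.cast_sub (by omega), Nat.cast_one]
  have hp' : (5 : ℤ) ≤ p := by exact_mod_cast hp
  rw [hp1] at htop
  refine coadjointInvariants_eq_bot_of_pairing (w := fun _ => 1) (r := 1) (d := 2)
    (fun _ => le_rfl) (fun _ => le_rfl) ?_ (LieHom.id : W k p 1 →ₗ⁅k⁆ W k p 1)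
    Function.injective_id (fun t => ⟨conj (dil _ t), fun _ => rfl⟩)
    (evalFunctional 0 (x k p 0)) ?_ ?_
  · rw [htop]
    push_cast
    linarith
  · intro D hD
    refine integral_eq_zero_of_mem_wtSub (w := fun _ => 1) (d := 2)
      (mul_mem_wtSub ?_ (hD 0) (x_mem_wtSub (I := Set.Iic 1) (by simp))) ?_
    · intro i hi j hj
      simp only [Set.mem_Iic] at *
      push_cast at hi
      omega
    · rw [htop]
      linarith
  · intro y hy h
    change y ∈ nonpos (fun _ => 1) k p at hy
    change y = 0
    set β := cf (Finsupp.single 0 1) (y (x k p 0)) with hβ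
    have hpd : pd 0 (y (x k p 0)) = algebraMap k _ β :=
      pd_apply_x_of_mem_nonpos (fun _ => le_rfl) hy le_rfl
    have hdvg : dvg y = algebraMap k _ β := by
      rw [dvg, Fin.sum_univ_one, hpd]
    have key : ∀ b : Fin 1 →₀ ℕ, wt (fun _ => 1) b ≤ 1 →
        cf b (y (x k p 0) + (2 * β) • x k p 0) = 0 := by
      intro b hb
      refine cf_eq_zero_of_integral (w := fun _ => 1) (d := 3) (fun f hf => ?_) (fun i => ?_) ?_
      · have h1 := h (f • pd 0) (mem_fil_of_coord fun i => ?_)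
        · change evalFunctional 0 (x k p 0) ⁅f • pd 0, y⁆ = 0 at h1
          rw [evalFunctional_lie, apply_eq_sum _ (y (x k p 0)), Fin.sum_univ_one, hpd, hdvg] at h1
          rw [← h1]
          congr 1
          simp only [Derivation.smul_apply, pd_x, if_true, smul_eq_mul, mul_one,
            smul_eq_algebraMap_mul, map_mul, map_ofNat]
          ring
        · change (f • pd 0 : W k p 1) (x k p i) ∈ _
          rw [Derivation.smul_apply, pd_x, Subsingleton.elim i 0, if_pos rfl, smul_eq_mul, mul_one]
          simpa using hf
      · have := apply_le_wt (w := fun _ => 1) (fun _ => le_rfl) b i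
        omega
      · rw [htop]
        linarith
    refine derivation_ext fun j => ?_
    rw [Subsingleton.elim j 0]
    exact eq_zero_of_cf_add_smul_x hp (hy 0) key

end BivectorCriterion

/-! ### Contact fields -/

section SymplecticSign

/-- The sign `σⱼ` with `∑ⱼ σⱼ xⱼ dx_{j'} = ∑ᵢ (xᵢ dx_{i'} - x_{i'} dxᵢ)`, where `j` runs through all
of the `2m` indices and `i` through the first `m`; the conjugate index `j'` is `j.rev`. -/
def symSign (k : Type*) [Field k] {m : ℕ} (j : Fin (2 * m)) : k := if (j : ℕ) < m then 1 else -1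

variable {k : Type*} [Field k] {m : ℕ}

theorem symSign_rev (j : Fin (2 * m)) : symSign k j.rev = -symSign k j := by
  have : (j.rev : ℕ) < m ↔ ¬ (j : ℕ) < m := by
    rw [Fin.val_rev]
    omega
  rw [symSign, symSign, if_congr this rfl rfl]
  split_ifs <;> simp

@[simp] theorem symSign_mul_self (j : Fin (2 * m)) : symSign k j * symSign k j = 1 := by
  rw [symSign]
  split_ifs <;> simp

theorem sum_symSign_rev {M : Type*} [AddCommGroup M] [Module k M] (F : Fin (2 * m) → M) :
    ∑ j, symSign k j • F j.rev = -∑ j, symSign k j • F j := by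
  rw [← Finset.sum_neg_distrib, ← Equiv.sum_comp Fin.revPerm]
  refine Finset.sum_congr rfl fun j _ => ?_
  rw [Fin.revPerm_apply, Fin.rev_rev, symSign_rev, neg_smul]

end SymplecticSign

section Contact

variable {k : Type*} [Field k] {p m : ℕ}

/-- The contact form `∑ⱼ σⱼ xⱼ dx_{j'} + dz`, where `z` is the last variable. -/
def contactForm (k : Type*) [Field k] (p m : ℕ) :
    W k p (2 * m + 1) →ₗ[TruncPoly k p (2 * m + 1)] TruncPoly k p (2 * m + 1) :=
  ∑ j : Fin (2 * m), (symSign k j • x k p j.castSucc) • dx k p j.rev.castSucc +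
    dx k p (Fin.last (2 * m))

theorem contactForm_apply (D : W k p (2 * m + 1)) :
    contactForm k p m D = ∑ j : Fin (2 * m), symSign k j •
      (x k p j.castSucc * D (x k p j.rev.castSucc)) + D (x k p (Fin.last (2 * m))) := by
  simp only [contactForm, LinearMap.add_apply, LinearMap.sum_apply, LinearMap.smul_apply,
    smul_eq_mul, smul_mul_assoc]
  rfl

theorem contactForm_lie_skew (D E : W k p (2 * m + 1)) :
    contactForm k p m ⁅D, E⁆ = -contactForm k p m ⁅E, D⁆ := by
  have h : ⁅D, E⁆ + ⁅E, D⁆ = 0 := derivation_ext fun i => by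
    rw [Derivation.add_apply, Derivation.commutator_apply, Derivation.commutator_apply,
      sub_add_sub_cancel, sub_self, Derivation.zero_apply]
  refine eq_neg_of_add_eq_zero_left ?_
  rw [← map_add, h, map_zero]

/-- Cartan's formula for the Lie derivative of the contact form. -/
theorem contactForm_cartan (D X : W k p (2 * m + 1)) :
    D (contactForm k p m X) - contactForm k p m ⁅D, X⁆ =
      X (contactForm k p m D) + (2 : k) • ∑ j : Fin (2 * m), symSign k j •
        (D (x k p j.castSucc) * X (x k p j.rev.castSucc)) := by
  have h1 : ∑ j : Fin (2 * m), symSign k j • (X (x k p j.rev.castSucc) * D (x k p j.castSucc)) =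
      ∑ j : Fin (2 * m), symSign k j • (D (x k p j.castSucc) * X (x k p j.rev.castSucc)) :=
    Finset.sum_congr rfl fun j _ => by rw [mul_comm (X _)]
  have h2 : ∑ j : Fin (2 * m), symSign k j • (D (x k p j.rev.castSucc) * X (x k p j.castSucc)) =
      -∑ j : Fin (2 * m), symSign k j • (D (x k p j.castSucc) * X (x k p j.rev.castSucc)) := by
    rw [← sum_symSign_rev]
    simp only [Fin.rev_rev]
  rw [two_smul]
  simp only [contactForm_apply, Derivation.commutator_apply, map_add, map_sum,
    Derivation.map_smul, Derivation.leibniz, smul_eq_mul, mul_sub, smul_sub, smul_add,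
    Finset.sum_add_distrib, Finset.sum_sub_distrib]
  linear_combination h1 - h2

theorem contactForm_mem_wtSub {D : W k p (2 * m + 1)}
    (hD : D ∈ nonpos (contactWt (Fin.last (2 * m))) k p) :
    contactForm k p m D ∈ wtSub (contactWt (Fin.last (2 * m))) k p (Set.Iic 2) := by
  have hne : ∀ j : Fin (2 * m), j.castSucc ≠ Fin.last _ := fun j => (Fin.castSucc_lt_last j).ne
  rw [contactForm_apply]
  refine Submodule.add_mem _ (Submodule.sum_mem _ fun j _ => Submodule.smul_mem _ _ ?_) ?_
  · refine mul_mem_wtSub (I := Set.Iic 1) ?_ (x_mem_wtSub ?_) (hD j.rev.castSucc)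
    · intro a ha b hb
      rw [contactWt_of_ne (hne _)] at hb
      simp only [Set.mem_Iic] at *
      push_cast at hb
      omega
    · rw [contactWt_of_ne (hne _)]
      simp
  · have := hD (Fin.last _)
    rwa [contactWt_self] at this

theorem contactPoly_mem_wtSub {n : ℕ} {z o : Fin n} (ho : o ≠ z) :
    contactPoly k p z o ∈ wtSub (contactWt z) k p (Set.Iic 6) := by
  have hadd : ∀ {a b c : ℤ}, a + b ≤ c → ∀ i ∈ Set.Iic a, ∀ j ∈ Set.Iic b, i + j ∈ Set.Iic c := by
    intro a b c h i hi j hj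
    simp only [Set.mem_Iic] at *
    omega
  have hz : x k p z ∈ wtSub (contactWt z) k p (Set.Iic 2) := x_mem_wtSub (by simp)
  refine Submodule.add_mem _ (Submodule.add_mem _ ?_ ?_) ?_
  · refine mul_mem_wtSub (J := Set.Iic 3) (hadd (by norm_num)) hz
      (Submodule.sum_mem _ fun i hi => pow_mem_wtSub i 3 ?_)
    rw [contactWt_of_ne (Finset.ne_of_mem_erase hi)]
    simp
  · refine mul_mem_wtSub (J := Set.Iic 4) (hadd (by norm_num)) hz (pow_mem_wtSub o 4 ?_)
    rw [contactWt_of_ne ho]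
    simp
  · exact pow_mem_wtSub z 3 (by simp)

variable [CharP k p]

theorem contactForm_pd_last : contactForm k p m (pd (Fin.last (2 * m))) = 1 := by
  rw [contactForm_apply, pd_x, if_pos rfl, Finset.sum_eq_zero, zero_add]
  intro j _
  rw [pd_x, if_neg (Fin.castSucc_lt_last _).ne', mul_zero, smul_zero]

/-- The contact field with generating function `F`, normalized so that the contact form takes the
value `2 F` on it. -/
def contactField (F : TruncPoly k p (2 * m + 1)) : W k p (2 * m + 1) :=
  ofCoord (Fin.lastCases ((2 : k) • F - ∑ j : Fin (2 * m), x k p j.castSucc * pd j.castSucc F)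
    fun j => x k p j.castSucc * pd (Fin.last _) F - symSign k j • pd j.rev.castSucc F)

@[simp] theorem contactField_castSucc (F : TruncPoly k p (2 * m + 1)) (j : Fin (2 * m)) :
    contactField F (x k p j.castSucc) =
      x k p j.castSucc * pd (Fin.last _) F - symSign k j • pd j.rev.castSucc F := by
  rw [contactField, ofCoord_x, Fin.lastCases_castSucc]

@[simp] theorem contactField_last (F : TruncPoly k p (2 * m + 1)) :
    contactField F (x k p (Fin.last _)) =
      (2 : k) • F - ∑ j : Fin (2 * m), x k p j.castSucc * pd j.castSucc F := by
  rw [contactField, ofCoord_x, Fin.lastCases_last]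

theorem contactForm_contactField (F : TruncPoly k p (2 * m + 1)) :
    contactForm k p m (contactField F) = (2 : k) • F := by
  have h0 : ∑ j : Fin (2 * m), symSign k j •
      (x k p j.castSucc * (x k p j.rev.castSucc * pd (Fin.last _) F)) = 0 := by
    refine Finset.sum_involution (fun j _ => j.rev) (fun j _ => ?_) (fun j _ _ => ?_)
      (fun _ _ => Finset.mem_univ _) (fun j _ => Fin.rev_rev j)
    · rw [symSign_rev, Fin.rev_rev, neg_smul, add_neg_eq_zero]
      congr 1
      ring
    · rw [Ne, Fin.ext_iff, Fin.val_rev]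
      omega
  have h1 : ∀ j : Fin (2 * m), symSign k j •
      (x k p j.castSucc * (symSign k j.rev • pd j.castSucc F)) =
        -(x k p j.castSucc * pd j.castSucc F) := by
    intro j
    rw [mul_smul_comm, smul_smul, symSign_rev, mul_neg, symSign_mul_self, neg_one_smul]
  simp only [contactForm_apply, contactField_castSucc, contactField_last, Fin.rev_rev, mul_sub,
    smul_sub, Finset.sum_sub_distrib, h0, h1, Finset.sum_neg_distrib]
  ring

/-- A contact field multiplies the contact form by `2 ∂_z F`. -/
theorem lieDeriv_contactField (F : TruncPoly k p (2 * m + 1)) (X : W k p (2 * m + 1)) :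
    contactField F (contactForm k p m X) - contactForm k p m ⁅contactField F, X⁆ =
      ((2 : k) • pd (Fin.last _) F) * contactForm k p m X := by
  have hX : X F = ∑ j : Fin (2 * m), X (x k p j.rev.castSucc) * pd j.rev.castSucc F +
      X (x k p (Fin.last _)) * pd (Fin.last _) F := by
    rw [apply_eq_sum, Fin.sum_univ_castSucc]
    congr 1
    exact (Equiv.sum_comp Fin.revPerm _).symm
  rw [contactForm_cartan, contactForm_contactField, Derivation.map_smul, hX, contactForm_apply]
  have h : ∀ j : Fin (2 * m), symSign k j •
      (contactField F (x k p j.castSucc) * X (x k p j.rev.castSucc)) =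
      pd (Fin.last _) F * (symSign k j • (x k p j.castSucc * X (x k p j.rev.castSucc))) -
        X (x k p j.rev.castSucc) * pd j.rev.castSucc F := by
    intro j
    rw [contactField_castSucc, sub_mul, smul_sub, smul_mul_assoc, smul_smul, symSign_mul_self,
      one_smul, mul_smul_comm]
    congr 1
    · congr 1
      ring
    · ring
  rw [Finset.sum_congr rfl fun j _ => h j, Finset.sum_sub_distrib, ← Finset.mul_sum]
  simp only [smul_eq_algebraMap_mul, map_ofNat]
  ring

theorem lie_pd_contactField (F : TruncPoly k p (2 * m + 1)) :
    ⁅(pd (Fin.last (2 * m)) : W k p (2 * m + 1)), contactField F⁆ =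
      contactField (pd (Fin.last _) F) := by
  refine derivation_ext fun i => ?_
  rw [Derivation.commutator_apply, pd_x]
  have h0 : contactField F (if Fin.last (2 * m) = i then 1 else 0) = 0 := by
    split_ifs <;> simp
  rw [h0, sub_zero]
  refine Fin.lastCases ?_ (fun j => ?_) i
  · rw [contactField_last, contactField_last, map_sub, Derivation.map_smul, map_sum]
    congr 1
    refine Finset.sum_congr rfl fun j _ => ?_
    rw [Derivation.leibniz, pd_x, if_neg (Fin.castSucc_lt_last _).ne', smul_zero, add_zero,
      smul_eq_mul, pd_comm]
  · rw [contactField_castSucc, contactField_castSucc, map_sub, Derivation.map_smul,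
      Derivation.leibniz, pd_x, if_neg (Fin.castSucc_lt_last _).ne', smul_zero, add_zero,
      smul_eq_mul, pd_comm j.rev.castSucc]

theorem contactField_mem_fil {d : ℤ} {F : TruncPoly k p (2 * m + 1)}
    (hF : F ∈ wtSub (contactWt (Fin.last (2 * m))) k p (Set.Ici (d + 2))) :
    contactField F ∈ fil (contactWt (Fin.last (2 * m))) k p d := by
  have hne : ∀ j : Fin (2 * m), j.castSucc ≠ Fin.last _ := fun j => (Fin.castSucc_lt_last j).ne
  have hpd : ∀ j : Fin (2 * m), pd j.castSucc F ∈
      wtSub (contactWt (Fin.last (2 * m))) k p (Set.Ici (d + 1)) := fun j =>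
    pd_mem_wtSub (fun a ha => by
      rw [contactWt_of_ne (hne j)]
      simp only [Set.mem_Ici] at *
      push_cast
      omega) hF
  have hpz : pd (Fin.last _) F ∈
      wtSub (contactWt (Fin.last (2 * m))) k p (Set.Ici d) :=
    pd_mem_wtSub (fun a ha => by
      rw [contactWt_self]
      simp only [Set.mem_Ici] at *
      push_cast
      omega) hF
  have hx : ∀ j : Fin (2 * m), x k p j.castSucc ∈
      wtSub (contactWt (Fin.last (2 * m))) k p (Set.Ici 1) := fun j =>
    x_mem_wtSub (by rw [contactWt_of_ne (hne j)]; simp)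
  have hadd : ∀ {a b c : ℤ}, a + b = c → ∀ i ∈ Set.Ici a, ∀ j ∈ Set.Ici b, i + j ∈ Set.Ici c := by
    intro a b c h i hi j hj
    simp only [Set.mem_Ici] at *
    omega
  refine mem_fil_of_coord fun i => ?_
  refine Fin.lastCases ?_ (fun j => ?_) i
  · rw [contactField_last, contactWt_self]
    refine Submodule.sub_mem _ (Submodule.smul_mem _ _ hF) (Submodule.sum_mem _ fun j _ => ?_)
    exact mul_mem_wtSub (hadd (by push_cast; ring)) (hx j) (hpd j)
  · rw [contactField_castSucc, contactWt_of_ne (hne j)]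
    exact Submodule.sub_mem _ (mul_mem_wtSub (hadd (by push_cast; ring)) (hx j) hpz)
      (Submodule.smul_mem _ _ (hpd _))

variable [Fact p.Prime]

/-- A dilation-stable Lie algebra of conformal contact fields that contains the contact fields of
all `∂_z F` has only constant coadjoint invariants. -/
theorem coadjointInvariants_eq_bot_of_contact [IsAlgClosed k] (hp : 5 ≤ p) (hm : 1 ≤ m)
    {L : Type*} [LieRing L] [LieAlgebra k L]
    (ι : L →ₗ⁅k⁆ W k p (2 * m + 1)) (hι : Function.Injective ι)
    (hdil : ∀ t : kˣ, ∃ g : L ≃ₗ⁅k⁆ L, ∀ y,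
      ι (g y) = conj (dil (contactWt (Fin.last (2 * m))) t) (ι y))
    (hconf : ∀ y : L, ∃ u, ∀ X,
      ι y (contactForm k p m X) - contactForm k p m ⁅ι y, X⁆ = u * contactForm k p m X)
    (hL : ∀ F, ∃ D : L, ι D = contactField (pd (Fin.last (2 * m)) F)) :
    coadjointInvariants k L = ⊥ := by
  set z := Fin.last (2 * m) with hz
  set o : Fin (2 * m + 1) := (⟨0, by omega⟩ : Fin (2 * m)).castSucc with hodef
  have ho : o ≠ z := (Fin.castSucc_lt_last _).ne
  have hp1 : ((p - 1 : ℕ) : ℤ) = p - 1 := by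
    rw [Nat.cast_sub (by omega), Nat.cast_one]
  have htop : wt (contactWt z) (top p (2 * m + 1)) = (p - 1) * (2 * m + 2) := by
    rw [wt_top, hp1, Fin.sum_univ_castSucc, ← hz, contactWt_self,
      Finset.sum_congr rfl fun j _ => by rw [contactWt_of_ne (Fin.castSucc_lt_last j).ne]]
    simp
  have hm' : (1 : ℤ) ≤ m := by exact_mod_cast hm
  have hp' : (5 : ℤ) ≤ p := by exact_mod_cast hp
  have h2 : (2 : k) ≠ 0 := by
    have := cast_ne_zero_of_lt (k := k) (p := p) (m := 2) (by omega) (by omega)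
    exact_mod_cast this
  let χ₀ : W k p (2 * m + 1) →ₗ[k] k :=
    { toFun := fun D => integral k p _ (contactForm k p m D * contactPoly k p z o)
      map_add' := fun D E => by rw [map_add, add_mul, map_add]
      map_smul' := fun c D => by
        rw [LinearMap.map_smul_of_tower, smul_mul_assoc, map_smul]
        rfl }
  refine coadjointInvariants_eq_bot_of_pairing (w := contactWt z) (r := 2) (d := 2 * m + 2)
    (one_le_contactWt z) (contactWt_le_two z) ?_ ι hι hdil χ₀ ?_ ?_
  · rw [htop]
    push_cast
    linarith
  · intro D hD
    refine integral_eq_zero_of_mem_wtSub (w := contactWt z) (d := 8)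
      (mul_mem_wtSub ?_ (contactForm_mem_wtSub hD) (contactPoly_mem_wtSub ho)) ?_
    · intro i hi j hj
      simp only [Set.mem_Iic] at *
      omega
    · rw [htop]
      nlinarith
  · intro y hy h
    obtain ⟨u, hu⟩ := hconf y
    set E := ι y with hE
    -- The conformal factor `u` and the divergence have weight at most `0`, so they are scalars.
    have hu0 : u ∈ wtSub (contactWt z) k p (Set.Iic 0) := by
      have := hu (pd z)
      rw [contactForm_cartan, contactForm_pd_last, mul_one, Finset.sum_eq_zero, smul_zero,
        add_zero] at this
      · rw [← this]
        refine pd_mem_wtSub (fun a ha => ?_) (contactForm_mem_wtSub hy)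
        rw [contactWt_self]
        simp only [Set.mem_Iic] at *
        push_cast
        omega
      · intro j _
        rw [pd_x, if_neg (Fin.castSucc_lt_last _).ne', mul_zero, smul_zero]
    have hd0 : dvg E ∈ wtSub (contactWt z) k p (Set.Iic 0) := by
      refine Submodule.sum_mem _ fun i _ => pd_mem_wtSub (fun a ha => ?_) (hy i)
      simp only [Set.mem_Iic] at *
      omega
    have hκ := eq_algebraMap_of_mem_wtSub (one_le_contactWt z) (Submodule.add_mem _ hu0 hd0)
    set κ := cf 0 (u + dvg E)
    have hpair : ∀ F, χ₀ ⁅contactField F, E⁆ =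
        2 * integral k p _ (F * (E (contactPoly k p z o) + κ • contactPoly k p z o)) := by
      intro F
      change integral k p _ (contactForm k p m ⁅contactField F, E⁆ * contactPoly k p z o) = _
      have h1 := hu (contactField F)
      have hskew : contactForm k p m ⁅E, contactField F⁆ =
          -contactForm k p m ⁅contactField F, E⁆ := contactForm_lie_skew _ _
      rw [contactForm_contactField, hskew, sub_neg_eq_add] at h1
      have h3 : contactForm k p m ⁅contactField F, E⁆ = (2 : k) • (F * u) - (2 : k) • E F := by
        rw [Derivation.map_smul] at h1
        rw [mul_comm F, ← mul_smul_comm, ← h1]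
        ring
      rw [h3, sub_mul, map_sub, smul_mul_assoc, smul_mul_assoc, map_smul, map_smul,
        integral_apply_mul, smul_eq_mul, smul_eq_mul, mul_neg, sub_neg_eq_add, ← mul_add,
        ← map_add, smul_eq_algebraMap_mul κ, ← hκ]
      congr 2
      ring
    refine eq_zero_of_cf_contactPoly hp ho hy κ fun b hb hbz hwt => ?_
    -- The integrals `∫ ∂_z F · Q` only control `∂_z Q`, whence the condition that `z` divide `x^b`.
    obtain ⟨c, rfl⟩ := exists_add_of_le (Finsupp.single_le_iff.2 hbz)
    have hc : cf c (pd z (E (contactPoly k p z o) + κ • contactPoly k p z o)) = 0 := by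
      refine cf_eq_zero_of_integral (w := contactWt z) (d := 2 * m + 6) (fun F hF => ?_)
        (fun i => lt_of_le_of_lt (by simp) (hb i)) ?_
      · obtain ⟨D, hD⟩ := hL F
        have h1 := h D (by
          rw [hD]
          refine contactField_mem_fil (pd_mem_wtSub (fun a ha => ?_) hF)
          rw [contactWt_self]
          simp only [Set.mem_Ici] at *
          push_cast
          omega)
        rw [hD, hpair, integral_pd_mul, mul_neg, neg_eq_zero] at h1
        exact (mul_eq_zero.1 h1).resolve_left h2
      · rw [wt_add, wt_single, contactWt_self] at hwt
        rw [htop]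
        push_cast at hwt
        nlinarith
    rw [cf_pd fun i => lt_of_le_of_lt (by simp) (hb i), add_comm c] at hc
    refine (mul_eq_zero.1 hc).resolve_left ?_
    have hbz' := hb z
    rw [Finsupp.add_apply, Finsupp.single_eq_same] at hbz'
    exact cast_ne_zero_of_lt (p := p) (by omega) (by omega)

end Contact

/-! ### Derived series, transport of forms, and determinants -/

section DerivedSeries

variable {k V : Type*} [Field k] [LieRing V] [LieAlgebra k V]

theorem exists_restrict_derivedSeries {M : Type*} [LieRing M] [LieAlgebra k M] (g : M ≃ₗ⁅k⁆ M)
    (j : ℕ) : ∃ h : LieAlgebra.derivedSeries k M j ≃ₗ⁅k⁆ LieAlgebra.derivedSeries k M j,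
      ∀ y, (h y : M) = g y := by
  have hmem : ∀ (f : M ≃ₗ⁅k⁆ M), ∀ y ∈ LieAlgebra.derivedSeries k M j,
      f y ∈ LieAlgebra.derivedSeries k M j := fun f y hy =>
    LieIdeal.derivedSeries_map_le (f := (f : M →ₗ⁅k⁆ M)) j (LieIdeal.mem_map hy)
  exact ⟨{
    toFun := fun y => ⟨g y, hmem g y y.2⟩
    map_add' := fun _ _ => Subtype.ext (map_add g _ _)
    map_smul' := fun c _ => Subtype.ext (map_smul g c _)
    map_lie' := fun {_ _} => Subtype.ext (LieEquiv.map_lie g _ _)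
    invFun := fun y => ⟨g.symm y, hmem g.symm y y.2⟩
    left_inv := fun _ => Subtype.ext (g.symm_apply_apply _)
    right_inv := fun _ => Subtype.ext (g.apply_symm_apply _) }, fun _ => rfl⟩

theorem exists_restrict_subalgebra (M : LieSubalgebra k V) (g : V ≃ₗ⁅k⁆ V)
    (h1 : ∀ y ∈ M, g y ∈ M) (h2 : ∀ y ∈ M, g.symm y ∈ M) :
    ∃ h : M ≃ₗ⁅k⁆ M, ∀ y, (h y : V) = g y :=
  ⟨{
    toFun := fun y => ⟨g y, h1 y y.2⟩
    map_add' := fun _ _ => Subtype.ext (map_add g _ _)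
    map_smul' := fun c _ => Subtype.ext (map_smul g c _)
    map_lie' := fun {_ _} => Subtype.ext (LieEquiv.map_lie g _ _)
    invFun := fun y => ⟨g.symm y, h2 y y.2⟩
    left_inv := fun _ => Subtype.ext (g.symm_apply_apply _)
    right_inv := fun _ => Subtype.ext (g.apply_symm_apply _) }, fun _ => rfl⟩

/-- The inclusion into `V` of a term of the derived series of a subalgebra of `V`. -/
def derivedIncl (M : LieSubalgebra k V) (j : ℕ) : LieAlgebra.derivedSeries k M j →ₗ⁅k⁆ V :=
  M.incl.comp (LieAlgebra.derivedSeries k M j).incl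

theorem derivedIncl_apply (M : LieSubalgebra k V) (j : ℕ) (y : LieAlgebra.derivedSeries k M j) :
    derivedIncl M j y = ((y : M) : V) := rfl

theorem derivedIncl_injective (M : LieSubalgebra k V) (j : ℕ) :
    Function.Injective (derivedIncl M j) :=
  Subtype.val_injective.comp Subtype.val_injective

theorem exists_derivedIncl_one {M : LieSubalgebra k V} {D E : V} (hD : D ∈ M) (hE : E ∈ M) :
    ∃ y, derivedIncl M 1 y = ⁅D, E⁆ := by
  have h : ⁅(⟨D, hD⟩ : M), (⟨E, hE⟩ : M)⁆ ∈ LieAlgebra.derivedSeries k M 1 := by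
    rw [LieAlgebra.derivedSeries, LieAlgebra.derivedSeriesOfIdeal_succ]
    exact LieSubmodule.lie_mem_lie (LieSubmodule.mem_top _) (LieSubmodule.mem_top _)
  exact ⟨⟨_, h⟩, rfl⟩

theorem exists_derivedIncl_two {M : LieSubalgebra k V} {D E : V}
    (hD : ∃ y, derivedIncl M 1 y = D) (hE : ∃ y, derivedIncl M 1 y = E) :
    ∃ y, derivedIncl M 2 y = ⁅D, E⁆ := by
  obtain ⟨y, rfl⟩ := hD
  obtain ⟨z, rfl⟩ := hE
  have h : ⁅(y : M), (z : M)⁆ ∈ LieAlgebra.derivedSeries k M 2 := by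
    rw [LieAlgebra.derivedSeries, LieAlgebra.derivedSeriesOfIdeal_succ]
    exact LieSubmodule.lie_mem_lie y.2 z.2
  exact ⟨⟨_, h⟩, rfl⟩

theorem exists_derivedIncl_equivariant (M : LieSubalgebra k V) (g : V ≃ₗ⁅k⁆ V)
    (h1 : ∀ y ∈ M, g y ∈ M) (h2 : ∀ y ∈ M, g.symm y ∈ M) (j : ℕ) :
    ∃ h : LieAlgebra.derivedSeries k M j ≃ₗ⁅k⁆ LieAlgebra.derivedSeries k M j,
      ∀ y, derivedIncl M j (h y) = g (derivedIncl M j y) := by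
  obtain ⟨g', hg'⟩ := exists_restrict_subalgebra M g h1 h2
  obtain ⟨h, hh⟩ := exists_restrict_derivedSeries g' j
  exact ⟨h, fun y => by rw [derivedIncl_apply, hh, hg', derivedIncl_apply]⟩

end DerivedSeries

section Transport

variable {k A : Type*} [Field k] [CommRing A] [Algebra k A] {r : ℕ}

/-- The automorphism `e` of `A` multiplies the form `ω` by the scalar `c`; derivations, on which `ω`
is evaluated, are transported by `conj`. -/
def Scales (e : A ≃ₐ[k] A) (ω : Form k A r) (c : k) : Prop :=
  ∀ X : Fin r → Derivation k A A, e (ω fun i => conj e.symm (X i)) = c • ω X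

theorem Scales.smul_lieDeriv {e : A ≃ₐ[k] A} {ω : Form k A r} {c : k} (h : Scales e ω c)
    (D : Derivation k A A) (X : Fin r → Derivation k A A) :
    c • lieDeriv (conj e D) ω X = e (lieDeriv D ω fun i => conj e.symm (X i)) := by
  have h1 : c • conj e D (ω X) = e (D (ω fun i => conj e.symm (X i))) := by
    rw [← Derivation.map_smul, ← h, conj_apply, AlgEquiv.symm_apply_apply]
  have h2 : ∀ i, c • ω (Function.update X i ⁅conj e D, X i⁆) =
      e (ω (Function.update (fun i => conj e.symm (X i)) i ⁅D, conj e.symm (X i)⁆)) := by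
    intro i
    rw [← h]
    congr 2
    funext j
    by_cases hj : j = i
    · subst hj
      rw [Function.update_self, Function.update_self, ← conj_symm, LieEquiv.map_lie,
        LieEquiv.symm_apply_apply]
    · rw [Function.update_of_ne hj, Function.update_of_ne hj]
  rw [lieDeriv, lieDeriv, smul_sub, h1, Finset.smul_sum, map_sub, map_sum,
    Finset.sum_congr rfl fun i _ => h2 i]

theorem Scales.conj_mem_annihilator {e : A ≃ₐ[k] A} {ω : Form k A r} {c : k} (h : Scales e ω c)
    (hc : c ≠ 0) {D : Derivation k A A} (hD : D ∈ annihilator ω) : conj e D ∈ annihilator ω := by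
  change lieDeriv D ω = 0 at hD
  change lieDeriv (conj e D) ω = 0
  funext X
  have h1 := h.smul_lieDeriv D X
  rw [hD, Pi.zero_apply, map_zero] at h1
  exact (smul_eq_zero_iff_right hc).1 h1

theorem Scales.conj_mem_conformalStabilizer {e : A ≃ₐ[k] A} {ω : Form k A r} {c : k}
    (h : Scales e ω c) (hc : c ≠ 0) {D : Derivation k A A} (hD : D ∈ conformalStabilizer ω) :
    conj e D ∈ conformalStabilizer ω := by
  obtain ⟨u, hu⟩ := hD
  refine ⟨e u, ?_⟩
  funext X
  have h1 := h.smul_lieDeriv D X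
  rw [hu, Pi.smul_apply, smul_eq_mul, map_mul, h, mul_smul_comm] at h1
  exact smul_right_injective A hc h1

end Transport

section Determinant

theorem derivation_prod {k A ι : Type*} [CommRing k] [CommRing A] [Algebra k A] [DecidableEq ι]
    (D : Derivation k A A) (s : Finset ι) (f : ι → A) :
    D (∏ i ∈ s, f i) = ∑ i ∈ s, ∏ j ∈ s, Function.update f i (D (f i)) j := by
  induction s using Finset.induction_on with
  | empty => simp
  | insert a s ha ih =>
    have h1 : ∏ j ∈ s, Function.update f a (D (f a)) j = ∏ j ∈ s, f j :=
      Finset.prod_congr rfl fun j hj => Function.update_of_ne (ne_of_mem_of_not_mem hj ha) _ _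
    have h2 : ∀ i ∈ s, ∏ j ∈ insert a s, Function.update f i (D (f i)) j =
        f a * ∏ j ∈ s, Function.update f i (D (f i)) j := fun i hi => by
      rw [Finset.prod_insert ha, Function.update_of_ne (ne_of_mem_of_not_mem hi ha).symm]
    rw [Finset.prod_insert ha, Derivation.leibniz, ih, Finset.sum_insert ha, Finset.prod_insert ha,
      Function.update_self, h1, Finset.sum_congr rfl h2, ← Finset.mul_sum, smul_eq_mul,
      smul_eq_mul]
    ring

/-- The derivative of a determinant, row by row. -/
theorem derivation_det {k A ι : Type*} [CommRing k] [CommRing A] [Algebra k A] [DecidableEq ι]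
    [Fintype ι] (D : Derivation k A A) (M : Matrix ι ι A) :
    D M.det = ∑ i, (M.updateRow i fun j => D (M i j)).det := by
  simp only [← Matrix.det_transpose M, ← Matrix.det_transpose (Matrix.updateRow _ _ _),
    Matrix.det_apply, Matrix.transpose_apply]
  rw [map_sum, Finset.sum_comm]
  refine Finset.sum_congr rfl fun σ _ => ?_
  rw [← Finset.smul_sum, Units.smul_def, Units.smul_def, map_zsmul, derivation_prod]
  congr 1
  refine Finset.sum_congr rfl fun i _ => Finset.prod_congr rfl fun j _ => ?_
  by_cases hj : j = i
  · subst hj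
    simp
  · rw [Function.update_of_ne hj, Matrix.updateRow_ne hj]

end Determinant

/-! ### The volume form, the symplectic form and the contact form -/

section

variable {k : Type*} [Field k] {p n : ℕ}

theorem wedge_apply {A : Type*} [CommRing A] [Algebra k A] {r : ℕ}
    (α : Fin r → (Derivation k A A →ₗ[A] A)) (X : Fin r → Derivation k A A) :
    wedge α X = (Matrix.of fun i j => α j (X i)).det := rfl

section Special

theorem det_updateRow_sub {ι A : Type*} [DecidableEq ι] [Fintype ι] [CommRing A]
    (M : Matrix ι ι A) (i : ι) (u v : ι → A) :
    (M.updateRow i (u - v)).det = (M.updateRow i u).det - (M.updateRow i v).det := by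
  simp only [← Matrix.cramer_transpose_apply, map_sub, Pi.sub_apply]

theorem sum_det_updateRow_mul {ι A : Type*} [DecidableEq ι] [Fintype ι] [CommRing A]
    (M J : Matrix ι ι A) : ∑ i, (M.updateRow i ((M * J) i)).det = J.trace * M.det := by
  have h : ∀ i, (M.updateRow i ((M * J) i)).det = (M * J * M.adjugate) i i := by
    intro i
    rw [← Matrix.cramer_transpose_apply, Matrix.cramer_eq_adjugate_mulVec, Matrix.mul_apply,
      Matrix.mulVec, dotProduct]
    refine Finset.sum_congr rfl fun j _ => ?_
    rw [← Matrix.adjugate_transpose, Matrix.transpose_apply, mul_comm]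
  rw [Finset.sum_congr rfl fun i _ => h i]
  change (M * J * M.adjugate).trace = _
  rw [Matrix.trace_mul_comm, ← Matrix.mul_assoc, Matrix.adjugate_mul, Matrix.smul_mul,
    Matrix.one_mul, Matrix.trace_smul, smul_eq_mul, mul_comm]

theorem omegaS_apply (X : Fin n → W k p n) :
    omegaS k p n X = (Matrix.of fun i j => X i (x k p j)).det := rfl

theorem omegaS_update (X : Fin n → W k p n) (i : Fin n) (Y : W k p n) :
    omegaS k p n (Function.update X i Y) =
      ((Matrix.of fun i j => X i (x k p j)).updateRow i fun j => Y (x k p j)).det := by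
  rw [omegaS_apply]
  congr 1
  ext a b
  by_cases ha : a = i
  · subst ha
    simp
  · simp [Function.update_of_ne ha, Matrix.updateRow_ne ha]

variable [CharP k p]

/-- The Lie derivative of the volume form is the multiplication by the divergence. -/
theorem lieDeriv_omegaS (D : W k p n) (X : Fin n → W k p n) :
    lieDeriv D (omegaS k p n) X = dvg D * omegaS k p n X := by
  let M : Matrix (Fin n) (Fin n) (TruncPoly k p n) := Matrix.of fun i j => X i (x k p j)
  let J : Matrix (Fin n) (Fin n) (TruncPoly k p n) := Matrix.of fun l j => pd l (D (x k p j))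
  have h1 : ∀ i, (fun j => D (M i j)) - (fun j => ⁅D, X i⁆ (x k p j)) = (M * J) i := by
    intro i
    funext j
    rw [Pi.sub_apply, Derivation.commutator_apply, Matrix.mul_apply]
    change D (X i (x k p j)) - (D (X i (x k p j)) - X i (D (x k p j))) = _
    rw [sub_sub_cancel, apply_eq_sum]
    rfl
  have h2 : omegaS k p n X = M.det := rfl
  have h3 : dvg D = J.trace := rfl
  rw [h3, h2, ← sum_det_updateRow_mul, lieDeriv, h2, derivation_det,
    Finset.sum_congr rfl fun i _ => omegaS_update _ _ _, ← Finset.sum_sub_distrib]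
  refine Finset.sum_congr rfl fun i _ => ?_
  rw [← h1, det_updateRow_sub]

theorem mem_fullS_of_dvg_eq_zero {D : W k p n} (h : dvg D = 0) : D ∈ fullS k p n := by
  change lieDeriv D (omegaS k p n) = 0
  funext X
  rw [lieDeriv_omegaS, h, zero_mul, Pi.zero_apply]

theorem pd_pd_x (i l j : Fin n) : pd i (pd l (x k p j)) = 0 := by
  rw [pd_x]
  split_ifs <;> simp

theorem pd_mem_fullS (l : Fin n) : pd l ∈ fullS k p n :=
  mem_fullS_of_dvg_eq_zero (Finset.sum_eq_zero fun i _ => pd_pd_x i l i)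

theorem dvg_bivectorField (h2 : (2 : k) ≠ 0) {P : Matrix (Fin n) (Fin n) k}
    (hP : ∀ i j, P i j = -P j i) (f : TruncPoly k p n) : dvg (bivectorField P f) = 0 := by
  have h : dvg (bivectorField P f) = ∑ i, ∑ j, P i j • pd i (pd j f) := by
    refine Finset.sum_congr rfl fun i _ => ?_
    rw [bivectorField_x, map_sum]
    exact Finset.sum_congr rfl fun j _ => Derivation.map_smul _ _ _
  have h' : dvg (bivectorField P f) = -dvg (bivectorField P f) := by
    conv_lhs => rw [h, Finset.sum_comm]
    rw [h, ← Finset.sum_neg_distrib]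
    refine Finset.sum_congr rfl fun i _ => ?_
    rw [← Finset.sum_neg_distrib]
    refine Finset.sum_congr rfl fun j _ => ?_
    rw [hP j i, neg_smul, pd_comm]
  have h3 : (2 : k) • dvg (bivectorField P f) = 0 := by
    rw [two_smul]
    nth_rewrite 1 [h']
    exact neg_add_cancel _
  exact (smul_eq_zero_iff_right h2).1 h3

theorem lie_pd_bivectorField (P : Matrix (Fin n) (Fin n) k) (l : Fin n) (f : TruncPoly k p n) :
    ⁅(pd l : W k p n), bivectorField P f⁆ = bivectorField P (pd l f) := by
  refine derivation_ext fun i => ?_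
  have h0 : bivectorField P f (pd l (x k p i)) = 0 := by
    rw [pd_x]
    split_ifs <;> simp
  rw [Derivation.commutator_apply, h0, sub_zero, bivectorField_x, bivectorField_x, map_sum]
  refine Finset.sum_congr rfl fun j _ => ?_
  rw [Derivation.map_smul, pd_comm]

theorem planeBivector_antisymm {o e : Fin n} (hoe : o ≠ e) (i j : Fin n) :
    planeBivector k o e i j = -planeBivector k o e j i := by
  simp only [planeBivector, Matrix.of_apply]
  by_cases h1 : i = e ∧ j = o
  · obtain ⟨rfl, rfl⟩ := h1
    simp [hoe, hoe.symm]
  · by_cases h2 : i = o ∧ j = e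
    · obtain ⟨rfl, rfl⟩ := h2
      simp [hoe]
    · rw [if_neg h1, if_neg h2, if_neg fun h => h2 ⟨h.2, h.1⟩, if_neg fun h => h1 ⟨h.2, h.1⟩,
        neg_zero]

end Special

section Hamiltonian

variable {m : ℕ}

/-- The bivector dual to the symplectic form; its fields are the Hamiltonian fields. -/
def sympBivector (k : Type*) [Field k] (m : ℕ) : Matrix (Fin (2 * m)) (Fin (2 * m)) k :=
  Matrix.of fun i j => if i = j.rev then symSign k j else 0

theorem sum_castLE_sub_rev {M : Type*} [AddCommGroup M] [Module k M] (F : Fin (2 * m) → M) :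
    ∑ i : Fin m, (F (Fin.castLE (by omega) i) - F (Fin.castLE (by omega) i : Fin (2 * m)).rev) =
      ∑ j, symSign k j • F j := by
  let e : Fin m ⊕ Fin m ≃ Fin (2 * m) := finSumFinEquiv.trans (finCongr (two_mul m).symm)
  have h1 : ∀ i, e (Sum.inl i) = Fin.castLE (by omega) i := fun i => Fin.ext rfl
  have h2 : ∀ i, e (Sum.inr i.rev) = (Fin.castLE (by omega) i : Fin (2 * m)).rev := fun i => by
    refine Fin.ext ?_
    change m + (m - (i + 1)) = 2 * m - (i + 1)
    omega
  rw [← Equiv.sum_comp e, Fintype.sum_sum_type, ← Equiv.sum_comp Fin.revPerm fun i =>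
    symSign k (e (Sum.inr i)) • F (e (Sum.inr i)), ← Finset.sum_add_distrib]
  refine Finset.sum_congr rfl fun i _ => ?_
  have h3 : symSign k (Fin.castLE (by omega) i : Fin (2 * m)) = 1 := if_pos i.2
  rw [Fin.revPerm_apply, h1, h2, symSign_rev, h3, one_smul, neg_one_smul, sub_eq_add_neg]

theorem omegaH_apply (X : Fin 2 → W k p (2 * m)) :
    omegaH k p m X = ∑ j : Fin (2 * m), symSign k j • (X 0 (x k p j) * X 1 (x k p j.rev)) := by
  let ev : Form k (TruncPoly k p (2 * m)) 2 →+ TruncPoly k p (2 * m) :=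
    { toFun := fun ω => ω X
      map_zero' := rfl
      map_add' := fun _ _ => rfl }
  rw [← sum_castLE_sub_rev]
  change ev (omegaH k p m) = _
  rw [omegaH, map_sum]
  refine Finset.sum_congr rfl fun i _ => ?_
  change wedge _ X = _
  rw [wedge_apply, Matrix.det_fin_two, Fin.rev_rev]
  rfl

/-- Cartan's formula for the Lie derivative of the symplectic form. -/
theorem lieDeriv_omegaH (D : W k p (2 * m)) (X : Fin 2 → W k p (2 * m)) :
    lieDeriv D (omegaH k p m) X = ∑ j : Fin (2 * m), symSign k j •
      (X 0 (D (x k p j)) * X 1 (x k p j.rev) + X 0 (x k p j) * X 1 (D (x k p j.rev))) := by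
  rw [lieDeriv, Fin.sum_univ_two, omegaH_apply, omegaH_apply, omegaH_apply, map_sum,
    ← Finset.sum_add_distrib, ← Finset.sum_sub_distrib]
  refine Finset.sum_congr rfl fun j _ => ?_
  rw [Function.update_self, Function.update_self, Function.update_of_ne (by decide),
    Function.update_of_ne (by decide), Derivation.map_smul, ← smul_add, ← smul_sub]
  congr 1
  simp only [Derivation.leibniz, Derivation.commutator_apply, smul_eq_mul]
  ring

variable [CharP k p]

theorem pd_mem_fullH (l : Fin (2 * m)) : pd l ∈ fullH k p m := by
  change lieDeriv _ (omegaH k p m) = 0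
  funext X
  rw [lieDeriv_omegaH, Pi.zero_apply]
  refine Finset.sum_eq_zero fun j _ => ?_
  have h : ∀ (Y : W k p (2 * m)) (i : Fin (2 * m)), Y (pd l (x k p i)) = 0 := fun Y i => by
    rw [pd_x]
    split_ifs <;> simp
  rw [h, h, zero_mul, mul_zero, add_zero, smul_zero]

theorem bivectorField_sympBivector_rev (f : TruncPoly k p (2 * m)) (j : Fin (2 * m)) :
    bivectorField (sympBivector k m) f (x k p j.rev) = symSign k j • pd j f := by
  rw [bivectorField_x, Finset.sum_eq_single j]
  · simp [sympBivector]
  · intro i _ hi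
    rw [sympBivector, Matrix.of_apply, if_neg fun h => hi (Fin.rev_injective h).symm, zero_smul]
  · simp

theorem bivectorField_mem_fullH (f : TruncPoly k p (2 * m)) :
    bivectorField (sympBivector k m) f ∈ fullH k p m := by
  change lieDeriv _ (omegaH k p m) = 0
  funext X
  rw [lieDeriv_omegaH, Pi.zero_apply]
  have h1 : ∀ j : Fin (2 * m), symSign k j •
      (X 0 (bivectorField (sympBivector k m) f (x k p j)) * X 1 (x k p j.rev) +
        X 0 (x k p j) * X 1 (bivectorField (sympBivector k m) f (x k p j.rev))) =
      X 0 (x k p j) * X 1 (pd j f) - X 0 (pd j.rev f) * X 1 (x k p j.rev) := by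
    intro j
    have h2 := bivectorField_sympBivector_rev f j.rev
    rw [Fin.rev_rev] at h2
    rw [h2, bivectorField_sympBivector_rev, Derivation.map_smul, Derivation.map_smul, symSign_rev,
      smul_mul_assoc, mul_smul_comm, neg_smul, smul_add, smul_neg, smul_smul, smul_smul,
      symSign_mul_self, one_smul, one_smul, neg_add_eq_sub]
  have h3 : ∀ Y Z : W k p (2 * m), ∑ j, Y (x k p j) * Z (pd j f) =
      ∑ j, ∑ l, Y (x k p j) * Z (x k p l) * pd l (pd j f) := fun Y Z =>
    Finset.sum_congr rfl fun j _ => by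
      rw [apply_eq_sum Z (pd j f), Finset.mul_sum]
      exact Finset.sum_congr rfl fun l _ => (mul_assoc _ _ _).symm
  have h4 : ∑ j : Fin (2 * m), X 0 (pd j.rev f) * X 1 (x k p j.rev) =
      ∑ j, X 0 (pd j f) * X 1 (x k p j) :=
    Equiv.sum_comp Fin.revPerm fun j => X 0 (pd j f) * X 1 (x k p j)
  rw [Finset.sum_congr rfl fun j _ => h1 j, Finset.sum_sub_distrib, h4,
    Finset.sum_congr rfl fun j _ => mul_comm (X 0 (pd j f)) _, h3, h3, sub_eq_zero,
    Finset.sum_comm]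
  refine Finset.sum_congr rfl fun j _ => Finset.sum_congr rfl fun l _ => ?_
  rw [pd_comm j l]
  ring

end Hamiltonian

section ContactMembership

variable {m : ℕ}

theorem omegaK_apply (X : Fin 1 → W k p (2 * m + 1)) :
    omegaK k p m X = contactForm k p m (X 0) := by
  rw [contactForm_apply, ← sum_castLE_sub_rev]
  rw [omegaK, wedge_apply, Matrix.det_fin_one, Matrix.of_apply, LinearMap.add_apply,
    LinearMap.sum_apply]
  simp only [Fin.rev_rev]
  rfl

theorem lieDeriv_omegaK (D : W k p (2 * m + 1)) (X : Fin 1 → W k p (2 * m + 1)) :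
    lieDeriv D (omegaK k p m) X = D (contactForm k p m (X 0)) - contactForm k p m ⁅D, X 0⁆ := by
  rw [lieDeriv, Fin.sum_univ_one, omegaK_apply, omegaK_apply, Function.update_self]

/-- The conformal condition that defines the contact algebra, in terms of the one-form. -/
theorem mem_fullK_iff {D : W k p (2 * m + 1)} : D ∈ fullK k p m ↔ ∃ u, ∀ X,
    D (contactForm k p m X) - contactForm k p m ⁅D, X⁆ = u * contactForm k p m X := by
  refine exists_congr fun u => ⟨fun h X => ?_, fun h => funext fun X => ?_⟩
  · have := congrFun h fun _ => X
    rwa [lieDeriv_omegaK, Pi.smul_apply, omegaK_apply] at this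
  · rw [lieDeriv_omegaK, h, Pi.smul_apply, omegaK_apply, smul_eq_mul]

variable [CharP k p]

theorem contactField_mem_fullK (F : TruncPoly k p (2 * m + 1)) : contactField F ∈ fullK k p m :=
  mem_fullK_iff.2 ⟨_, lieDeriv_contactField F⟩

theorem pd_last_mem_fullK : pd (Fin.last (2 * m)) ∈ fullK k p m := by
  refine mem_fullK_iff.2 ⟨0, fun X => ?_⟩
  rw [contactForm_cartan, contactForm_pd_last, Derivation.map_one_eq_zero, Finset.sum_eq_zero,
    smul_zero, add_zero, zero_mul]
  intro j _
  rw [pd_x, if_neg (Fin.castSucc_lt_last _).ne', zero_mul, smul_zero]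

end ContactMembership

section DilationOfForms

theorem conj_dil_symm_apply_x (w : Fin n → ℕ) (t : kˣ) (X : W k p n) (i : Fin n) :
    dil w t (conj (dil w t).symm X (x k p i)) = (t : k) ^ w i • X (x k p i) := by
  rw [conj_apply, AlgEquiv.apply_symm_apply, AlgEquiv.symm_symm, dil_x, Derivation.map_smul]

theorem scales_omegaS (t : kˣ) :
    Scales (dil (fun _ => 1) t) (omegaS k p n) ((t : k) ^ n) := by
  intro X
  rw [omegaS_apply, omegaS_apply, AlgEquiv.map_det]
  have h : (dil (fun _ => 1) t).mapMatrix
      (Matrix.of fun i j => conj (dil (fun _ => 1) t).symm (X i) (x k p j)) =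
      (t : k) • (Matrix.of fun i j => X i (x k p j)) := by
    ext i j
    change dil (fun _ => 1) t (conj (dil (fun _ => 1) t).symm (X i) (x k p j)) = _
    rw [conj_dil_symm_apply_x, pow_one]
    rfl
  rw [h, Matrix.det_smul_of_tower, Fintype.card_fin]

theorem scales_omegaH {m : ℕ} (t : kˣ) :
    Scales (dil (fun _ => 1) t) (omegaH k p m) ((t : k) ^ 2) := by
  intro X
  rw [omegaH_apply, omegaH_apply, map_sum, Finset.smul_sum]
  refine Finset.sum_congr rfl fun j _ => ?_
  rw [map_smul, map_mul, conj_dil_symm_apply_x, conj_dil_symm_apply_x, smul_mul_smul_comm,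
    pow_one, ← pow_two, smul_comm]

theorem scales_omegaK {m : ℕ} (t : kˣ) :
    Scales (dil (contactWt (Fin.last (2 * m))) t) (omegaK k p m) ((t : k) ^ 2) := by
  have hne : ∀ j : Fin (2 * m), j.castSucc ≠ Fin.last _ := fun j => (Fin.castSucc_lt_last j).ne
  intro X
  rw [omegaK_apply, omegaK_apply, contactForm_apply, contactForm_apply, map_add, map_sum,
    smul_add, Finset.smul_sum, conj_dil_symm_apply_x, contactWt_self]
  congr 1
  refine Finset.sum_congr rfl fun j _ => ?_
  rw [map_smul, map_mul, conj_dil_symm_apply_x, dil_x, smul_mul_smul_comm, contactWt_of_ne (hne _),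
    contactWt_of_ne (hne _), pow_one, ← pow_two, smul_comm]

end DilationOfForms

end

/-! ### The four families -/

section

variable {k : Type*} [Field k] [IsAlgClosed k] {p : ℕ} [CharP k p] [Fact p.Prime]

theorem coadjointInvariants_W (hp : 5 ≤ p) {n : ℕ} (hn : 1 ≤ n) :
    coadjointInvariants k (W k p n) = ⊥ := by
  rcases hn.eq_or_lt with rfl | hn
  · exact coadjointInvariants_W_one hp
  · exact coadjointInvariants_W_of_two_le hp hn

/-- In two variables `2 ∂ₑ = ⁅∂ₒ, D_P(xₒ²)⁆` lies in the first derived algebra, so that commutators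
with `∂ₑ` are available in the second one. -/
theorem exists_derivedIncl_fullS_two {k : Type*} [Field k] {p : ℕ} [CharP k p]
    (h2 : (2 : k) ≠ 0) {o e : Fin 2} (hoe : o ≠ e) :
    ∃ y, derivedIncl (fullS k p 2) 1 y = pd e := by
  obtain ⟨y, hy⟩ := exists_derivedIncl_one (pd_mem_fullS (k := k) (p := p) o)
    (mem_fullS_of_dvg_eq_zero
      (dvg_bivectorField h2 (planeBivector_antisymm hoe) (x k p o ^ 2)))
  refine ⟨(2 : k)⁻¹ • y, ?_⟩
  rw [map_smul, hy, lie_pd_bivectorField, inv_smul_eq_iff₀ h2]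
  have h1 : pd o (x k p o ^ 2) = (2 : k) • x k p o := by
    rw [pd_pow, if_pos rfl, pow_one]
    norm_num
  refine derivation_ext fun i => ?_
  rw [h1, bivectorField_x, Finset.sum_eq_single o, Derivation.map_smul, pd_x, if_pos rfl,
    Derivation.smul_apply, pd_x, planeBivector, Matrix.of_apply]
  · by_cases hi : i = e
    · simp [hi]
    · rw [if_neg fun h => hi h.1, if_neg fun h => hoe h.2, if_neg (Ne.symm hi), zero_smul,
        smul_zero]
  · intro j _ hj
    rw [Derivation.map_smul, pd_x, if_neg hj, smul_zero, smul_zero]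
  · simp

theorem coadjointInvariants_S (hp : 5 ≤ p) {n : ℕ} (hn : 2 ≤ n) :
    coadjointInvariants k (S k p n) = ⊥ := by
  have h2 : (2 : k) ≠ 0 := by
    have := cast_ne_zero_of_lt (k := k) (p := p) (m := 2) (by omega) (by omega)
    exact_mod_cast this
  set o : Fin n := ⟨0, by omega⟩
  set e : Fin n := ⟨1, by omega⟩
  have hoe : o ≠ e := by simp [o, e, Fin.ext_iff]
  have hmem : ∀ f : TruncPoly k p n, bivectorField (planeBivector k o e) f ∈ fullS k p n :=
    fun f => mem_fullS_of_dvg_eq_zero (dvg_bivectorField h2 (planeBivector_antisymm hoe) f)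
  refine coadjointInvariants_eq_bot_of_bivector hp hn hoe (planeBivector k o e)
    (planeBivector_right hoe) (planeBivector_left hoe) (derivedIncl (fullS k p n) _)
    (derivedIncl_injective _ _) (fun t => ?_) fun l f => ?_
  · refine exists_derivedIncl_equivariant _ _ (fun y hy => ?_) (fun y hy => ?_) _
    · exact (scales_omegaS t).conj_mem_annihilator (pow_ne_zero _ t.ne_zero) hy
    · rw [conj_symm, dil_symm]
      exact (scales_omegaS t⁻¹).conj_mem_annihilator (pow_ne_zero _ t⁻¹.ne_zero) hy
  · have key : ∀ j, (n = 2 ∧ j = 2) ∨ j = 1 → ∃ D, derivedIncl (fullS k p n) j D =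
        bivectorField (planeBivector k o e) (pd l (pd l f)) := by
      rintro j (⟨rfl, rfl⟩ | rfl)
      · rw [← lie_pd_bivectorField]
        refine exists_derivedIncl_two ?_ ?_
        · obtain ⟨i, hi⟩ := exists_ne l
          exact exists_derivedIncl_fullS_two h2 hi
        · rw [← lie_pd_bivectorField]
          exact exists_derivedIncl_one (pd_mem_fullS l) (hmem f)
      · rw [← lie_pd_bivectorField]
        exact exists_derivedIncl_one (pd_mem_fullS l) (hmem _)
    exact key _ (by split_ifs <;> simp_all)

theorem coadjointInvariants_H (hp : 5 ≤ p) {m : ℕ} (hm : 1 ≤ m) :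
    coadjointInvariants k (H k p m) = ⊥ := by
  set o : Fin (2 * m) := ⟨0, by omega⟩
  have ho : symSign k o = 1 := if_pos (by simp only [o]; omega)
  have hoe : o ≠ o.rev := by
    rw [Ne, Fin.ext_iff, Fin.val_rev]
    simp only [o]
    omega
  refine coadjointInvariants_eq_bot_of_bivector hp (by omega) hoe (sympBivector k m)
    (fun j => ?_) ?_ (derivedIncl (fullH k p m) _)
    (derivedIncl_injective _ _) (fun t => ?_) fun l f => ?_
  · rw [sympBivector, Matrix.of_apply]
    by_cases hj : j = o
    · rw [hj, if_pos rfl, if_pos rfl, ho]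
    · rw [if_neg hj, if_neg fun h => hj (Fin.rev_injective h).symm]
  · rw [sympBivector, Matrix.of_apply, Fin.rev_rev, if_pos rfl, symSign_rev, ho]
  · refine exists_derivedIncl_equivariant _ _ (fun y hy => ?_) (fun y hy => ?_) _
    · exact (scales_omegaH t).conj_mem_annihilator (pow_ne_zero _ t.ne_zero) hy
    · rw [conj_symm, dil_symm]
      exact (scales_omegaH t⁻¹).conj_mem_annihilator (pow_ne_zero _ t⁻¹.ne_zero) hy
  · rw [← lie_pd_bivectorField]
    exact exists_derivedIncl_one (pd_mem_fullH l) (bivectorField_mem_fullH _)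

theorem coadjointInvariants_K (hp : 5 ≤ p) {m : ℕ} (hm : 1 ≤ m) :
    coadjointInvariants k (K k p m) = ⊥ := by
  refine coadjointInvariants_eq_bot_of_contact hp hm (derivedIncl (fullK k p m) _)
    (derivedIncl_injective _ _) (fun t => ?_) (fun y => mem_fullK_iff.1 y.1.2) fun F => ?_
  · refine exists_derivedIncl_equivariant _ _ (fun y hy => ?_) (fun y hy => ?_) _
    · exact (scales_omegaK t).conj_mem_conformalStabilizer (pow_ne_zero _ t.ne_zero) hy
    · rw [conj_symm, dil_symm]
      exact (scales_omegaK t⁻¹).conj_mem_conformalStabilizer (pow_ne_zero _ t⁻¹.ne_zero) hy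
  · rw [← lie_pd_contactField]
    exact exists_derivedIncl_one pd_last_mem_fullK (contactField_mem_fullK F)

end

end CartanType

end

theorem theorem3p5 (k : Type*) [Field k] [IsAlgClosed k] (p : ℕ) [CharP k p] (hp : 3 < p) :
    (∀ n : ℕ, 1 ≤ n → CartanType.coadjointInvariants k (CartanType.W k p n) = ⊥) ∧
    (∀ n : ℕ, 2 ≤ n → CartanType.coadjointInvariants k (CartanType.S k p n) = ⊥) ∧
    (∀ m : ℕ, 2 ≤ m → CartanType.coadjointInvariants k (CartanType.H k p m) = ⊥) ∧
    (∀ m : ℕ, 1 ≤ m → CartanType.coadjointInvariants k (CartanType.K k p m) = ⊥) := by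
  have hprime : p.Prime := (CharP.char_is_prime_or_zero k p).resolve_right (by omega)
  have : Fact p.Prime := ⟨hprime⟩
  have hp5 : 5 ≤ p := by
    have h4 : p ≠ 4 := fun h => absurd (h ▸ hprime) (by norm_num)
    omega
  exact ⟨fun n hn => CartanType.coadjointInvariants_W hp5 hn,
    fun n hn => CartanType.coadjointInvariants_S hp5 hn,
    fun m hm => CartanType.coadjointInvariants_H hp5 (by omega),
    fun m hm => CartanType.coadjointInvariants_K hp5 hm⟩
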